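/- All digraphs are finite and without parallel arcs; a homomorphism of a digraph $G$ to a digraph $H$ is a map $f:V(G)\to V(H)$ such that $f(u)f(v)\in A(H)$ whenever $uv\in A(G)$. For a fixed digraph $H$, MinHOM$(H)$ is the following problem: given a digraph $G$ and rational costs $c_i(u)$ ($u\in V(G)$, $i\in V(H)$), decide whether there is a homomorphism of $G$ to $H$ and, if so, find one, $f$, that minimizes $\sum_{u\in V(G)}c_{f(u)}(u)$. A digraph is locally semicomplete if, for every vertex $x$, any two distinct in-neighbours of $x$ are joined by at least one arc, and so are any two distinct out-neighbours of $x$. A digraph is connected if its underlying undirected graph is connected and non-empty. **Theorem.** Let $H$ be a connected loopless locally semicomplete digraph that is either acyclic or a directed cycle $\overrightarrow{C_k}$ with $k\ge 2$. Then MinHOM$(H)$ is polynomial-time solvable: there is an algorithm (depending on $H$) that solves MinHOM$(H)$ in time polynomial in the size of the input $G$, $(c_i(u))$, the costs being written in binary. -/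

import Mathlib

/-! ### Digraphs -/

namespace MinHOM

/-- No vertex dominates itself. (`Digraph` never has parallel arcs.) -/
def Loopless {V : Type*} (H : Digraph V) : Prop :=
  ∀ v, ¬ H.Adj v v

/-- A digraph is connected if its underlying undirected graph is connected
(in particular it has at least one vertex). -/
def Connected {V : Type*} (H : Digraph V) : Prop :=
  H.toSimpleGraphInclusive.Connected

/-- `S` induces a semicomplete digraph in `H`: any two distinct vertices of `S` are joined by at
least one arc. -/
def InducesSemicomplete {V : Type*} (H : Digraph V) (S : Set V) : Prop :=
  ∀ y ∈ S, ∀ z ∈ S, y ≠ z → H.Adj y z ∨ H.Adj z y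

/-- For every vertex, its in-neighbours induce a semicomplete digraph, and so do its
out-neighbours. -/
def LocallySemicomplete {V : Type*} (H : Digraph V) : Prop :=
  ∀ x, InducesSemicomplete H {y | H.Adj y x} ∧ InducesSemicomplete H {y | H.Adj x y}

/-- There is no closed directed walk of positive length (equivalently, no directed cycle). -/
def Acyclic {V : Type*} (H : Digraph V) : Prop :=
  ∀ v, ¬ Relation.TransGen H.Adj v v

/-- The directed cycle on the vertices `0, 1, …, k - 1`, with arcs `i → i + 1` modulo `k`
(for `k ≥ 1`). -/
def directedCycle (k : ℕ) : Digraph (ZMod k) where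
  Adj i j := j = i + 1

/-- `H` is isomorphic to the directed cycle with `k` vertices for some `k ≥ 2`. -/
def IsDirectedCycle {V : Type*} (H : Digraph V) : Prop :=
  ∃ k : ℕ, 2 ≤ k ∧ Nonempty (H.Adj ≃r (directedCycle k).Adj)

/-- `f` is a homomorphism of `G` to `H`. -/
def IsHom {U V : Type*} (G : Digraph U) (H : Digraph V) (f : U → V) : Prop :=
  ∀ u v, G.Adj u v → H.Adj (f u) (f v)

/-! ### Random access machines with a step count -/

namespace RAM

/-- The registers, each holding one integer. Registers are numbered by the integers. -/
abbrev Memory : Type := ℤ → ℤ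

/-- The elementary instructions of a random access machine. There is no multiplication, so one
instruction lengthens the binary expansion of the largest stored number by at most one bit
(constants in the program aside). Hence counting every instruction as one step is, up to a
polynomial, the same as counting the steps of a Turing machine. -/
inductive Instr : Type
  /-- `X x := c` -/
  | const (x : ℤ) (c : ℤ)
  /-- `X x := X y + X z` -/
  | add (x y z : ℤ)
  /-- `X x := X y - X z` -/
  | sub (x y z : ℤ)
  /-- `X x := ⌊X y / 2⌋` -/
  | half (x y : ℤ)
  /-- `X x := X (X y)` -/
  | load (x y : ℤ)
  /-- `X (X x) := X y` -/
  | store (x y : ℤ)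

/-- The effect of one instruction. -/
def Instr.exec : Instr → Memory → Memory
  | .const x c, m => Function.update m x c
  | .add x y z, m => Function.update m x (m y + m z)
  | .sub x y z, m => Function.update m x (m y - m z)
  | .half x y, m => Function.update m x (m y / 2)
  | .load x y, m => Function.update m x (m (m y))
  | .store x y, m => Function.update m (m x) (m y)

/-- Programs, with structured control flow. Branches and loops test whether a register is
positive. -/
inductive Program : Type
  | skip
  | instr (i : Instr)
  | seq (p q : Program)
  | ite (x : ℤ) (p q : Program)
  | while (x : ℤ) (p : Program)

/-- `Runs p m t m'`: started on memory `m`, the program `p` halts after exactly `t` steps with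
memory `m'`. Each executed instruction and each executed test is one step. -/
inductive Runs : Program → Memory → ℕ → Memory → Prop
  | skip (m : Memory) : Runs .skip m 1 m
  | instr (i : Instr) (m : Memory) : Runs (.instr i) m 1 (i.exec m)
  | seq {p q : Program} {m₁ m₂ m₃ : Memory} {s t : ℕ} :
      Runs p m₁ s m₂ → Runs q m₂ t m₃ → Runs (.seq p q) m₁ (s + t) m₃
  | ite_pos {x : ℤ} {p q : Program} {m m' : Memory} {t : ℕ} :
      0 < m x → Runs p m t m' → Runs (.ite x p q) m (1 + t) m'
  | ite_neg {x : ℤ} {p q : Program} {m m' : Memory} {t : ℕ} :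
      ¬ 0 < m x → Runs q m t m' → Runs (.ite x p q) m (1 + t) m'
  | while_pos {x : ℤ} {p : Program} {m₁ m₂ m₃ : Memory} {s t : ℕ} :
      0 < m₁ x → Runs p m₁ s m₂ → Runs (.while x p) m₂ t m₃ →
        Runs (.while x p) m₁ (1 + s + t) m₃
  | while_neg {x : ℤ} {p : Program} {m : Memory} :
      ¬ 0 < m x → Runs (.while x p) m 1 m

/-- The initial memory on input `w`: the entries of `w` are in the registers `0, 1, 2, …`, and all
other registers hold `0`. -/
def initMemory (w : List ℤ) : Memory
  | .ofNat j => w.getD j 0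
  | .negSucc _ => 0

/-- The size of an input: the total number of binary digits of its entries, with one extra symbol
per entry for sign and separation. -/
def size (w : List ℤ) : ℕ :=
  (w.map fun a => Nat.size a.natAbs + 1).sum

end RAM

/-! ### The minimum cost homomorphism problem -/

/-- An input of the minimum cost homomorphism problem for a digraph with vertex set `V`: a finite
digraph `G` and rational costs `cost u i` of mapping the vertex `u` of `G` to `i`. -/
structure Instance (V : Type*) where
  /-- number of vertices of `G` -/
  n : ℕ
  /-- the input digraph -/
  G : Digraph (Fin n)
  /-- `cost u i` is the cost of mapping `u` to `i` -/
  cost : Fin n → V → ℚ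

/-- The cost of a mapping of `V(G)` to `V(H)`. -/
def Instance.totalCost {V : Type*} (I : Instance V) (f : Fin I.n → V) : ℚ :=
  ∑ u, I.cost u (f u)

/-- `f` is a homomorphism of the input digraph to `H` of minimum cost. -/
def Instance.IsMinCostHom {V : Type*} (I : Instance V) (H : Digraph V) (f : Fin I.n → V) : Prop :=
  IsHom I.G H f ∧ ∀ g : Fin I.n → V, IsHom I.G H g → I.totalCost f ≤ I.totalCost g

open Classical in
/-- An input, written as a list of integers with respect to a numbering `e` of `V(H)`: the number
`n` of vertices of `G`, the `n × n` adjacency matrix of `G` row by row, the `n × k` matrix of the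
numerators of the costs row by row, and the `n × k` matrix of their denominators row by row. -/
noncomputable def Instance.encode {V : Type*} {k : ℕ} (I : Instance V) (e : V ≃ Fin k) : List ℤ :=
  [(I.n : ℤ)]
    ++ List.ofFn (fun p : Fin (I.n * I.n) => if I.G.Adj p.divNat p.modNat then (1 : ℤ) else 0)
    ++ List.ofFn (fun p : Fin (I.n * k) => (I.cost p.divNat (e.symm p.modNat)).num)
    ++ List.ofFn (fun p : Fin (I.n * k) => ((I.cost p.divNat (e.symm p.modNat)).den : ℤ))

/-- The memory `m` holds a correct answer: register `0` holds `0` and there is no homomorphism of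
`G` to `H`, or register `0` holds `1` and the registers `1, …, n` hold (the numbers of) the images
of the vertices of `G` under a homomorphism of minimum cost. -/
def Instance.IsAnswer {V : Type*} {k : ℕ} (I : Instance V) (H : Digraph V) (e : V ≃ Fin k)
    (m : RAM.Memory) : Prop :=
  (m 0 = 0 ∧ ¬ ∃ f : Fin I.n → V, IsHom I.G H f) ∨
    (m 0 = 1 ∧ ∃ f : Fin I.n → V, I.IsMinCostHom H f ∧
      ∀ u : Fin I.n, m (1 + (u : ℕ)) = ((e (f u) : ℕ) : ℤ))

/-- The minimum cost homomorphism problem for the fixed digraph `H` is polynomial-time solvable: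
however `V(H)` is numbered, some program, which may depend on `H`, solves every input in a number
of steps that is bounded by a polynomial in the size of the input. -/
def PolyTimeSolvable {V : Type*} [Fintype V] (H : Digraph V) : Prop :=
  ∀ e : V ≃ Fin (Fintype.card V), ∃ (P : RAM.Program) (b : Polynomial ℕ), ∀ I : Instance V,
    ∃ (t : ℕ) (m : RAM.Memory),
      RAM.Runs P (RAM.initMemory (I.encode e)) t m ∧
        t ≤ b.eval (RAM.size (I.encode e)) ∧ I.IsAnswer H e m

end MinHOM

/-! Acyclic case. Local semicompleteness lets a neighbour of a vertex slide along a directed path,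
so in a connected `H` any two vertices are comparable by reachability (`comparable`), and acyclicity
turns reachability into a linear order. If `ac` is an arc and `a ≤ x < y ≤ c`, then `xy` is an arc
(`adj_of_between`, `adj_of_between'`). This gives the interval property in `exists_ordering`.

With such an ordering the problem becomes a minimum cut. A map `f` is encoded by the truth values of
"`a ≤ f u`", one node `(u, a)` for each `0 ≤ a ≤ k`. The arc from `(u, a)` to `(u, a + 1)` carries
the cost of mapping `u` to `a`. Every implication between thresholds that all homomorphisms obey
becomes an arc of prohibitive capacity. Obeying these implications also suffices to be a
homomorphism (`homOn_of_forced`), by the interval property. Hence the affordable cuts correspond to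
homomorphisms and cut capacity is cost (`cut_eq_cost`, `solves_of_mincut`).

Minimum cuts are found by reading the capacities digit by digit and augmenting at most `N * N` times
per digit (`mincutCmd_spec`). No flow is stored. It is enough that the residual capacities are
nonnegative and that, for a single number `F`, every separating set has residual cut equal to its
original cut minus `F`. A separating set of residual cut zero is then minimum.

Directed cycle. On each component of the input a homomorphism is determined by its value at one
vertex. Merging classes along arcs while recording offsets modulo `k` leaves `k` candidate shifts
per class, and the classes can be optimized independently (`cycleCmd_spec`).

Neither solver detects infeasibility: each promises an optimal homomorphism only if some
homomorphism exists. Testing the map that was found therefore decides existence (`mainCmd_spec`).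

The machine. Programs are written in a language of bounded loops whose running time is a polynomial
in the loop counts, read off from the syntax (`Cmd.halts_compile`). The loop counts are polynomial
in the input size because the adjacency matrix alone has `n * n` entries. Costs are made integral by
multiplying with denominators through shifts and additions, and nonnegative by a common shift. Both
changes preserve the order of the total costs. -/

namespace MinHOM

namespace RAM

/-! ### Running programs with a time bound -/

/-- Started on `m`, the program `p` halts within `T` steps with a memory satisfying `Q`. -/
def Halts (p : Program) (m : Memory) (T : ℕ) (Q : Memory → Prop) : Prop :=
  ∃ t m', Runs p m t m' ∧ t ≤ T ∧ Q m'

theorem Halts.mono {p : Program} {m : Memory} {S T : ℕ} {Q R : Memory → Prop}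
    (h : Halts p m S Q) (hT : S ≤ T) (hQ : ∀ m', Q m' → R m') : Halts p m T R := by
  obtain ⟨t, m', hr, ht, hq⟩ := h
  exact ⟨t, m', hr, ht.trans hT, hQ _ hq⟩

theorem Halts.seq {p q : Program} {m : Memory} {S T : ℕ} {Q R : Memory → Prop}
    (hp : Halts p m S Q) (hq : ∀ m', Q m' → Halts q m' T R) :
    Halts (.seq p q) m (S + T) R := by
  obtain ⟨t, m', hr, ht, h⟩ := hp
  obtain ⟨t', m'', hr', ht', h'⟩ := hq m' h
  exact ⟨t + t', m'', .seq hr hr', by omega, h'⟩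

theorem Halts.ite {p q : Program} {x : ℤ} {m : Memory} {S T : ℕ} {Q : Memory → Prop}
    (hp : 0 < m x → Halts p m S Q) (hq : ¬ 0 < m x → Halts q m T Q) :
    Halts (.ite x p q) m (1 + S + T) Q := by
  by_cases h : 0 < m x
  · obtain ⟨t, m', hr, ht, h'⟩ := hp h
    exact ⟨1 + t, m', .ite_pos h hr, by omega, h'⟩
  · obtain ⟨t, m', hr, ht, h'⟩ := hq h
    exact ⟨1 + t, m', .ite_neg h hr, by omega, h'⟩

/-- The invariant is indexed by the number of rounds done, so that it carries termination as well:
the test must succeed in each of the first `N` rounds and fail afterwards. -/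
theorem Halts.while {p : Program} {x : ℤ} {T : ℕ} (I : ℕ → Memory → Prop) (N : ℕ)
    (hstep : ∀ i < N, ∀ m, I i m → 0 < m x ∧ Halts p m T (I (i + 1)))
    (hend : ∀ m, I N m → ¬ 0 < m x) {m : Memory} (h0 : I 0 m) :
    Halts (.while x p) m (N * (T + 1) + 1) (I N) := by
  -- Induct on the number `j` of rounds still to come, because `Runs` peels off the first round.
  suffices h : ∀ j ≤ N, ∀ m, I (N - j) m → Halts (.while x p) m (j * (T + 1) + 1) (I N) by
    exact h N le_rfl m (by simpa using h0)
  intro j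
  induction j with
  | zero =>
    intro _ m hm
    exact ⟨1, m, .while_neg (hend m (by simpa using hm)), by simp, by simpa using hm⟩
  | succ j ih =>
    intro hj m hm
    obtain ⟨hx, t, m', hr, ht, hm'⟩ := hstep (N - (j + 1)) (by omega) m hm
    rw [show N - (j + 1) + 1 = N - j by omega] at hm'
    obtain ⟨t', m'', hr', ht', h⟩ := ih (by omega) m' hm'
    exact ⟨1 + t + t', m'', .while_pos hx hr hr', by linarith, h⟩

/-- Straight-line code. -/
def block : List Instr → Program
  | [] => .skip
  | i :: l => .seq (.instr i) (block l)

/-- The effect of straight-line code. -/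
def execList (l : List Instr) (m : Memory) : Memory :=
  l.foldl (fun m i => i.exec m) m

@[simp] theorem execList_nil (m : Memory) : execList [] m = m := rfl

@[simp] theorem execList_cons (i : Instr) (l : List Instr) (m : Memory) :
    execList (i :: l) m = execList l (i.exec m) := rfl

theorem halts_block (l : List Instr) (m : Memory) {T : ℕ} {Q : Memory → Prop}
    (hT : l.length + 1 ≤ T) (hQ : Q (execList l m)) : Halts (block l) m T Q := by
  refine Halts.mono (S := l.length + 1) (Q := fun m' => m' = execList l m) ?_ hT
    (by rintro _ rfl; exact hQ)
  clear hQ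
  induction l generalizing m T with
  | nil => exact ⟨1, m, .skip m, by simp, rfl⟩
  | cons i l ih =>
    obtain ⟨t, m', hr, ht, h⟩ := ih (i.exec m) le_rfl
    exact ⟨1 + t, m', .seq (.instr i m) hr, by simp; omega, h⟩

/-! ### Memory layout -/

/-- The register of the scalar variable `x`. -/
def var (x : ℕ) : ℤ := -(32 * x + 17)

/-- The `d`-th auxiliary register. -/
def tmp (d : ℕ) : ℤ := -(32 * d + 18)

/-- The `j`-th register of the auxiliary array. -/
def buf (j : ℕ) : ℤ := -(32 * j + 19)

/-- The register of the `j`-th entry of the array `a`. -/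
def cell (a : Fin 16) (j : ℕ) : ℤ := if a = 0 then j else -(32 * j + ((a : ℕ) + 1))

-- The layout separates registers by residues modulo 32: the nonzero arrays use the offsets 2 to 16,
-- variables 17, auxiliary registers 18, the buffer 19, all at negative addresses. Array 0 fills the
-- nonnegative registers, where input and output live.
@[simp] theorem var_inj {x y : ℕ} : var x = var y ↔ x = y := by unfold var; omega
@[simp] theorem tmp_inj {x y : ℕ} : tmp x = tmp y ↔ x = y := by unfold tmp; omega
@[simp] theorem buf_inj {x y : ℕ} : buf x = buf y ↔ x = y := by unfold buf; omega
@[simp] theorem var_ne_tmp {x y : ℕ} : var x ≠ tmp y := by unfold var tmp; omega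
@[simp] theorem tmp_ne_var {x y : ℕ} : tmp x ≠ var y := by unfold var tmp; omega
@[simp] theorem var_ne_buf {x y : ℕ} : var x ≠ buf y := by unfold var buf; omega
@[simp] theorem buf_ne_var {x y : ℕ} : buf x ≠ var y := by unfold var buf; omega
@[simp] theorem tmp_ne_buf {x y : ℕ} : tmp x ≠ buf y := by unfold tmp buf; omega
@[simp] theorem buf_ne_tmp {x y : ℕ} : buf x ≠ tmp y := by unfold tmp buf; omega

@[simp] theorem cell_inj {a b : Fin 16} {i j : ℕ} : cell a i = cell b j ↔ a = b ∧ i = j := by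
  have ha := a.isLt
  have hb := b.isLt
  unfold cell
  simp only [Fin.ext_iff]
  split_ifs with h₁ h₂ h₂ <;> simp at h₁ h₂ <;> omega

@[simp] theorem cell_ne_var {a : Fin 16} {i j : ℕ} : cell a i ≠ var j := by
  have ha := a.isLt
  unfold cell var
  split_ifs <;> omega
@[simp] theorem cell_ne_tmp {a : Fin 16} {i j : ℕ} : cell a i ≠ tmp j := by
  have ha := a.isLt
  unfold cell tmp
  split_ifs <;> omega
@[simp] theorem cell_ne_buf {a : Fin 16} {i j : ℕ} : cell a i ≠ buf j := by
  have ha := a.isLt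
  unfold cell buf
  split_ifs <;> omega
@[simp] theorem var_ne_cell {a : Fin 16} {i j : ℕ} : var j ≠ cell a i := cell_ne_var.symm
@[simp] theorem tmp_ne_cell {a : Fin 16} {i j : ℕ} : tmp j ≠ cell a i := cell_ne_tmp.symm
@[simp] theorem buf_ne_cell {a : Fin 16} {i j : ℕ} : buf j ≠ cell a i := cell_ne_buf.symm

/-- Code that replaces an index by the register of that entry of the array `a`. -/
def toCell (a : Fin 16) (d : ℕ) : Program :=
  .seq (.ite (tmp d) .skip (.instr (.const (tmp d) 0)))
    (if a = 0 then .skip else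
      block [.add (tmp d) (tmp d) (tmp d), .add (tmp d) (tmp d) (tmp d),
        .add (tmp d) (tmp d) (tmp d), .add (tmp d) (tmp d) (tmp d),
        .add (tmp d) (tmp d) (tmp d), .const (tmp (d + 1)) (a + 1 : ℕ),
        .add (tmp d) (tmp d) (tmp (d + 1)), .const (tmp (d + 1)) 0,
        .sub (tmp d) (tmp (d + 1)) (tmp d)])

/-- The initial test replaces a negative index by 0, in agreement with `Int.toNat`. Five doublings
replace the missing multiplication by 32. -/
theorem halts_toCell (a : Fin 16) (d : ℕ) (m : Memory) :
    Halts (toCell a d) m 13 (fun m' => m' (tmp d) = cell a (m (tmp d)).toNat ∧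
      ∀ z, z ≠ tmp d → z ≠ tmp (d + 1) → m' z = m z) := by
  unfold toCell
  refine Halts.mono (S := (1 + 1 + 1) + 10) (Halts.seq (Q := fun m' =>
    m' (tmp d) = (m (tmp d)).toNat ∧ ∀ z, z ≠ tmp d → m' z = m z) (Halts.ite ?_ ?_) ?_)
    (by norm_num) (fun _ h => h)
  · intro h
    exact ⟨1, m, .skip m, le_rfl, by omega, fun _ _ => rfl⟩
  · intro h
    refine ⟨1, _, .instr _ m, le_rfl, ?_, fun z hz => ?_⟩
    · simp only [Instr.exec, Function.update_self]; omega
    · simp [Instr.exec, hz]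
  · rintro m' ⟨h₁, h₂⟩
    split_ifs with ha
    · exact ⟨1, m', .skip m', by norm_num, by rw [h₁]; simp [cell, ha], fun z hz _ => h₂ z hz⟩
    · refine halts_block _ _ (by simp) ⟨?_, fun z hz hz' => ?_⟩
      · simp [Instr.exec, h₁, cell, ha]
        ring
      · simp [Instr.exec, hz, hz', h₂]

/-- Code that replaces an index by the register of that entry of the auxiliary array. -/
def toBuf (d : ℕ) : Program :=
  block [.add (tmp d) (tmp d) (tmp d), .add (tmp d) (tmp d) (tmp d),
    .add (tmp d) (tmp d) (tmp d), .add (tmp d) (tmp d) (tmp d),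
    .add (tmp d) (tmp d) (tmp d), .const (tmp (d + 1)) 19,
    .add (tmp d) (tmp d) (tmp (d + 1)), .const (tmp (d + 1)) 0,
    .sub (tmp d) (tmp (d + 1)) (tmp d)]

theorem halts_toBuf (d j : ℕ) (m : Memory) (hm : m (tmp d) = j) :
    Halts (toBuf d) m 10 (fun m' => m' (tmp d) = buf j ∧
      ∀ z, z ≠ tmp d → z ≠ tmp (d + 1) → m' z = m z) := by
  refine halts_block _ _ (by simp) ⟨?_, fun z hz hz' => ?_⟩
  · simp [Instr.exec, hm, buf]
    ring
  · simp [Instr.exec, hz, hz']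

/-- Code that copies the register `y` to the register `x ≠ y`. -/
def move (x y : ℤ) : List Instr := [.const x 0, .add x x y]

/-- `for x in 0, …, n - 1`: the counters are in auxiliary registers, and `x` is restored at the
end. -/
def forLoop (d x n : ℕ) (p : Program) : Program :=
  .seq (block (move (tmp d) (var n) ++ move (tmp (d + 1)) (var x) ++ [.const (tmp (d + 2)) 0]))
    (.seq (.while (tmp d) (.seq (block (move (var x) (tmp (d + 2)))) (.seq p
        (block [.const (tmp (d + 3)) 1, .add (tmp (d + 2)) (tmp (d + 2)) (tmp (d + 3)),
          .sub (tmp d) (tmp d) (tmp (d + 3))]))))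
      (block (move (var x) (tmp (d + 1)))))

/-- Four consecutive auxiliary registers hold the number of rounds left, the saved value of `x`, the
round number and the constant 1. The body has to preserve the first three. It may overwrite `x`,
which is reset from the round number each time, and the number of rounds is read only once. The
invariant must ignore all registers that the loop itself writes. -/
theorem halts_forLoop {d x n : ℕ} {p : Program} {T N : ℕ} (J : ℕ → Memory → Prop) {m : Memory}
    (hN : (m (var n)).toNat = N)
    (hJ : ∀ i m₁ m₂, J i m₁ → (∀ z, z ≠ var x → z ≠ tmp d → z ≠ tmp (d + 1) → z ≠ tmp (d + 2) →
      z ≠ tmp (d + 3) → m₂ z = m₁ z) → J i m₂)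
    (h0 : J 0 m)
    (hp : ∀ i < N, ∀ m', J i m' → m' (var x) = i → Halts p m' T (fun m'' => J (i + 1) m'' ∧
      m'' (tmp d) = m' (tmp d) ∧ m'' (tmp (d + 1)) = m' (tmp (d + 1)) ∧
      m'' (tmp (d + 2)) = m' (tmp (d + 2)))) :
    Halts (forLoop d x n p) m (N * (T + 8) + 10)
      (fun m' => J N m' ∧ m' (var x) = m (var x)) := by
  unfold forLoop
  refine Halts.mono (S := 6 + ((N * ((3 + (T + 4)) + 1) + 1) + 3)) (Halts.seq (Q := fun m' =>
    J 0 m' ∧ m' (tmp d) = m (var n) ∧ m' (tmp (d + 1)) = m (var x) ∧ m' (tmp (d + 2)) = 0)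
    (halts_block _ _ (by simp [move]) ⟨?_, ?_⟩) ?_) (by ring_nf; omega) (fun _ h => h)
  · refine hJ 0 m _ h0 fun z _ h₁ h₂ h₃ _ => ?_
    simp [move, Instr.exec, h₁, h₂, h₃]
  · simp [move, Instr.exec]
  rintro m₁ ⟨hJ1, hd, hd1, hd2⟩
  refine Halts.seq (Q := fun m' => J N m' ∧ m' (tmp (d + 1)) = m (var x)) ?_ ?_
  · refine Halts.mono (Halts.while (T := 3 + (T + 4)) (fun i m' => J i m' ∧
      (m' (tmp d)).toNat = N - i ∧ m' (tmp (d + 1)) = m (var x) ∧ m' (tmp (d + 2)) = i) N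
      ?_ ?_ ⟨hJ1, by rw [hd, hN]; simp, hd1, by simp [hd2]⟩) (by ring_nf; omega)
      (fun _ h => ⟨h.1, h.2.2.1⟩)
    · rintro i hi m' ⟨h1, h2, h3, h4⟩
      refine ⟨by omega, Halts.seq (Q := fun m'' => J i m'' ∧ m'' (var x) = i ∧
        m'' (tmp d) = m' (tmp d) ∧ m'' (tmp (d + 1)) = m' (tmp (d + 1)) ∧
        m'' (tmp (d + 2)) = m' (tmp (d + 2))) (halts_block _ _ (by simp [move]) ⟨?_, ?_⟩) ?_⟩
      · refine hJ i m' _ h1 fun z h _ _ _ _ => ?_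
        simp [move, Instr.exec, h]
      · simp [move, Instr.exec, h4]
      rintro m₂ ⟨g0, g1, g2, g3, g4⟩
      refine Halts.seq (hp i hi m₂ g0 g1) ?_
      rintro m₃ ⟨k0, k1, k2, k3⟩
      refine halts_block _ _ (by simp) ⟨?_, ?_, ?_, ?_⟩
      · refine hJ _ m₃ _ k0 fun z _ h₁ h₂ h₃ h₄ => ?_
        simp [Instr.exec, h₁, h₃, h₄]
      · simp [Instr.exec, k1, g2]; omega
      · simp [Instr.exec, k2, g3, h3]
      · simp [Instr.exec, k3, g4, h4]
    · rintro m' ⟨_, h, _, _⟩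
      omega
  · rintro m' ⟨h1, h2⟩
    refine halts_block _ _ (by simp [move]) ⟨?_, ?_⟩
    · refine hJ _ m' _ h1 fun z h _ _ _ _ => ?_
      simp [move, Instr.exec, h]
    · simp [move, Instr.exec, h2]

end RAM

end MinHOM

namespace MinHOM

open Finset

namespace RAM

/-! ### A language of bounded loops -/

/-- The state of a computation: integer variables and integer arrays. -/
structure State where
  /-- the variables -/
  v : ℕ → ℤ
  /-- the arrays -/
  a : Fin 16 → ℕ → ℤ

/-- Assign `c` to the variable `x`. -/
def State.setv (s : State) (x : ℕ) (c : ℤ) : State := ⟨Function.update s.v x c, s.a⟩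

/-- Assign `f` to the array `b`. -/
def State.seta (s : State) (b : Fin 16) (f : ℕ → ℤ) : State := ⟨s.v, Function.update s.a b f⟩

@[simp] theorem State.setv_v (s : State) (x y : ℕ) (c : ℤ) :
    (s.setv x c).v y = if y = x then c else s.v y := by
  simp [State.setv, Function.update_apply]
@[simp] theorem State.setv_a (s : State) (x : ℕ) (c : ℤ) : (s.setv x c).a = s.a := rfl
@[simp] theorem State.seta_v (s : State) (b : Fin 16) (f : ℕ → ℤ) : (s.seta b f).v = s.v := rfl
@[simp] theorem State.seta_a (s : State) (b b' : Fin 16) (f : ℕ → ℤ) :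
    (s.seta b f).a b' = if b' = b then f else s.a b' := by
  simp [State.seta, Function.update_apply]

/-- Expressions: constants, variables, array entries (negative indices are read as `0`), sums,
differences, halves, case distinctions on the sign of an expression, bounded sums
`∑ x < n, e` and the bit lengths of input entries. -/
inductive Exp : Type
  | const (c : ℤ)
  | var (x : ℕ)
  | arr (a : Fin 16) (i : Exp)
  | add (e f : Exp)
  | sub (e f : Exp)
  | half (e : Exp)
  | ite (c e f : Exp)
  | sum (x n : ℕ) (e : Exp)
  | blen (i : Exp)

/-- The value of an expression. -/
def Exp.eval : Exp → State → ℤ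
  | .const c, _ => c
  | .var x, s => s.v x
  | .arr a i, s => s.a a (i.eval s).toNat
  | .add e f, s => e.eval s + f.eval s
  | .sub e f, s => e.eval s - f.eval s
  | .half e, s => e.eval s / 2
  | .ite c e f, s => if 0 < c.eval s then e.eval s else f.eval s
  | .sum x n e, s => ∑ i ∈ range (s.v n).toNat, e.eval (s.setv x i)
  | .blen i, s => (Nat.size (s.a 0 (i.eval s).toNat).natAbs : ℕ)

/-- Commands: assignment to a variable, to an array entry (of a constant), simultaneous assignment
`a[x] := e` for all `x < n`, sequences, case distinctions and bounded loops. -/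
inductive Cmd : Type
  | assign (x : ℕ) (e : Exp)
  | setc (a : Fin 16) (j : ℕ) (c : ℤ)
  | gen (a : Fin 16) (x n : ℕ) (e : Exp)
  | seq (c c' : Cmd)
  | ite (e : Exp) (c c' : Cmd)
  | loop (x n : ℕ) (c : Cmd)

/-- The state after `i` rounds of `f`, where the variable `x` counts the rounds. -/
def iter (f : State → State) (x : ℕ) (s : State) : ℕ → State
  | 0 => s
  | i + 1 => f ((iter f x s i).setv x i)

/-- The state after a command. -/
def Cmd.eval : Cmd → State → State
  | .assign x e, s => s.setv x (e.eval s)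
  | .setc a j c, s => s.seta a (Function.update (s.a a) j c)
  | .gen a x n e, s =>
      s.seta a (fun j => if j < (s.v n).toNat then e.eval (s.setv x j) else s.a a j)
  | .seq c c', s => c'.eval (c.eval s)
  | .ite e c c', s => if 0 < e.eval s then c.eval s else c'.eval s
  | .loop x n c, s => (iter c.eval x s (s.v n).toNat).setv x (s.v x)

/-! ### Compilation -/

/-- Code that computes an expression in the `d`-th auxiliary register. -/
def Exp.compile : Exp → ℕ → Program
  | .const c, d => block [.const (tmp d) c]
  | .var x, d => block (move (tmp d) (RAM.var x))
  | .arr a i, d => .seq (i.compile d) (.seq (toCell a d) (block [.load (tmp d) (tmp d)]))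
  | .add e f, d => .seq (e.compile d) (.seq (f.compile (d + 1))
      (block [.add (tmp d) (tmp d) (tmp (d + 1))]))
  | .sub e f, d => .seq (e.compile d) (.seq (f.compile (d + 1))
      (block [.sub (tmp d) (tmp d) (tmp (d + 1))]))
  | .half e, d => .seq (e.compile d) (block [.half (tmp d) (tmp d)])
  | .ite c e f, d => .seq (c.compile d) (.ite (tmp d) (e.compile d) (f.compile d))
  | .sum x n e, d => .seq (block [.const (tmp (d + 4)) 0])
      (.seq (forLoop d x n (.seq (e.compile (d + 5))
        (block [.add (tmp (d + 4)) (tmp (d + 4)) (tmp (d + 5))])))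
      (block (move (tmp d) (tmp (d + 4)))))
  | .blen i, d => .seq (i.compile d) (.seq (toCell 0 d) (.seq (block [.load (tmp d) (tmp d)])
      (.seq (.ite (tmp d) .skip
          (block [.const (tmp (d + 1)) 0, .sub (tmp d) (tmp (d + 1)) (tmp d)]))
      (.seq (block [.const (tmp (d + 1)) 0, .const (tmp (d + 2)) 1])
      (.seq (.while (tmp d) (block [.half (tmp d) (tmp d),
        .add (tmp (d + 1)) (tmp (d + 1)) (tmp (d + 2))]))
      (block (move (tmp d) (tmp (d + 1)))))))))

/-- Code for a command that leaves the first `d` auxiliary registers unchanged. -/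
def Cmd.compile : Cmd → ℕ → Program
  | .assign x e, d => .seq (e.compile d) (block (move (RAM.var x) (tmp d)))
  | .setc a j c, _ => block [.const (cell a j) c]
  | .gen a x n e, d => .seq
      (forLoop d x n (.seq (e.compile (d + 4)) (.seq (block (move (tmp (d + 5)) (RAM.var x)))
        (.seq (toBuf (d + 5)) (block [.store (tmp (d + 5)) (tmp (d + 4))])))))
      (forLoop d x n (.seq (block (move (tmp (d + 4)) (RAM.var x))) (.seq (toBuf (d + 4))
        (.seq (block (.load (tmp (d + 4)) (tmp (d + 4)) :: move (tmp (d + 5)) (RAM.var x)))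
          (.seq (toCell a (d + 5)) (block [.store (tmp (d + 5)) (tmp (d + 4))]))))))
  | .seq c c', d => .seq (c.compile d) (c'.compile d)
  | .ite e c c', d => .seq (e.compile d) (.ite (tmp d) (c.compile d) (c'.compile d))
  | .loop x n c, d => forLoop d x n (c.compile (d + 4))

/-- The memory `m` holds the state `s`. -/
def Rep (m : Memory) (s : State) : Prop :=
  (∀ x, m (var x) = s.v x) ∧ ∀ a j, m (cell a j) = s.a a j

/-- All loop counts of the expression are among the variables `0, …, P - 1`, which are not bound in
it, and bit lengths of input entries are only taken if `b` holds. -/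
def Exp.ok (P : ℕ) (b : Bool) : Exp → Bool
  | .const _ => true
  | .var _ => true
  | .arr _ i => i.ok P b
  | .add e f => e.ok P b && f.ok P b
  | .sub e f => e.ok P b && f.ok P b
  | .half e => e.ok P b
  | .ite c e f => c.ok P b && (e.ok P b && f.ok P b)
  | .sum x n e => decide (n < P) && (decide (P ≤ x) && e.ok P b)
  | .blen i => b && i.ok P b

/-- All loop counts of the command are among the variables `0, …, P - 1`, which are not changed by
it. If `b` holds, then the array `0` is not changed, otherwise bit lengths of its entries are not
taken. -/
def Cmd.ok (P : ℕ) (b : Bool) : Cmd → Bool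
  | .assign x e => decide (P ≤ x) && e.ok P b
  | .setc a _ _ => !b || decide (a ≠ 0)
  | .gen a x n e => (!b || decide (a ≠ 0)) && (decide (n < P) && (decide (P ≤ x) && e.ok P b))
  | .seq c c' => c.ok P b && c'.ok P b
  | .ite e c c' => e.ok P b && (c.ok P b && c'.ok P b)
  | .loop x n c => decide (n < P) && (decide (P ≤ x) && c.ok P b)

open Polynomial in
/-- A bound on the number of steps in terms of a bound on the loop counts. -/
noncomputable def Exp.bound : Exp → Polynomial ℕ
  | .const _ => 2
  | .var _ => 3
  | .arr _ i => i.bound + 15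
  | .add e f => e.bound + f.bound + 2
  | .sub e f => e.bound + f.bound + 2
  | .half e => e.bound + 2
  | .ite c e f => c.bound + e.bound + f.bound + 1
  | .sum _ _ e => X * (e.bound + 10) + 15
  | .blen i => i.bound + 4 * X + 30

open Polynomial in
/-- A bound on the number of steps in terms of a bound on the loop counts. -/
noncomputable def Cmd.bound : Cmd → Polynomial ℕ
  | .assign _ e => e.bound + 3
  | .setc _ _ _ => 2
  | .gen _ _ _ e => X * (e.bound + 70) + 20
  | .seq c c' => c.bound + c'.bound
  | .ite e c c' => e.bound + c.bound + c'.bound + 1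
  | .loop _ _ c => X * (c.bound + 8) + 10

/-- The variables `0, …, P - 1` are at most `B`, and so are the bit lengths of the input entries if
`b` holds. -/
def State.Bounded (s : State) (P : ℕ) (b : Bool) (B : ℕ) : Prop :=
  (∀ x < P, (s.v x).toNat ≤ B) ∧ (b = true → ∀ j, Nat.size (s.a 0 j).natAbs ≤ B)

/-! ### Correctness and running time of compiled code -/

theorem State.Bounded.setv {s : State} {P : ℕ} {b : Bool} {B : ℕ} (h : s.Bounded P b B) {x : ℕ}
    (hx : P ≤ x) (c : ℤ) : (s.setv x c).Bounded P b B := by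
  refine ⟨fun y hy => ?_, h.2⟩
  rw [State.setv_v, if_neg (by omega)]
  exact h.1 y hy

theorem State.Bounded.seta {s : State} {P : ℕ} {b : Bool} {B : ℕ} (h : s.Bounded P b B) {a : Fin 16}
    (ha : (!b || decide (a ≠ 0)) = true) (f : ℕ → ℤ) : (s.seta a f).Bounded P b B := by
  refine ⟨h.1, fun hb => ?_⟩
  subst hb
  have : a ≠ 0 := by simpa using ha
  rw [State.seta_a, if_neg this.symm]
  exact h.2 rfl

theorem iter_induction {f : State → State} {x : ℕ} {s : State} (I : ℕ → State → Prop) {N : ℕ}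
    (h0 : I 0 s) (hs : ∀ i < N, ∀ t, I i t → I (i + 1) (f (t.setv x i))) : I N (iter f x s N) := by
  suffices h : ∀ i ≤ N, I i (iter f x s i) from h N le_rfl
  intro i
  induction i with
  | zero => exact fun _ => h0
  | succ i ih => exact fun hi => hs i (by omega) _ (ih (by omega))

/-- Since `Cmd.ok` protects the loop counts from assignment, one bound `B` remains valid throughout.
This is what allows nested loops to be timed by composing polynomials. -/
theorem Cmd.eval_bounded {P : ℕ} {b : Bool} {B : ℕ} (c : Cmd) (hc : c.ok P b = true) (s : State)
    (h : s.Bounded P b B) : (c.eval s).Bounded P b B := by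
  induction c generalizing s with
  | assign x e =>
    simp only [Cmd.ok, Bool.and_eq_true, decide_eq_true_eq] at hc
    exact h.setv hc.1 _
  | setc a j c => exact h.seta hc _
  | gen a x n e =>
    simp only [Cmd.ok, Bool.and_eq_true] at hc
    exact h.seta hc.1 _
  | seq c c' ih ih' =>
    simp only [Cmd.ok, Bool.and_eq_true] at hc
    exact ih' hc.2 _ (ih hc.1 _ h)
  | ite e c c' ih ih' =>
    simp only [Cmd.ok, Bool.and_eq_true] at hc
    unfold Cmd.eval
    split_ifs
    · exact ih hc.2.1 _ h
    · exact ih' hc.2.2 _ h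
  | loop x n c ih =>
    simp only [Cmd.ok, Bool.and_eq_true, decide_eq_true_eq] at hc
    exact (iter_induction (fun _ s => s.Bounded P b B) h
      fun i _ t ht => ih hc.2.2 _ (ht.setv hc.2.1 _)).setv hc.2.1 _

theorem Rep.of_eq {m m' : Memory} {s : State} (h : Rep m s) {d : ℕ}
    (hm : ∀ z, (∀ i, d ≤ i → z ≠ tmp i) → m' z = m z) : Rep m' s :=
  ⟨fun x => (hm _ fun _ _ => var_ne_tmp).trans (h.1 x),
    fun a j => (hm _ fun _ _ => cell_ne_tmp).trans (h.2 a j)⟩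

theorem size_eq_size_half_add_one {n : ℕ} (hn : 0 < n) : Nat.size n = Nat.size (n / 2) + 1 := by
  apply le_antisymm
  · rw [Nat.size_le, pow_succ]
    have := Nat.lt_size_self (n / 2)
    omega
  · rw [Nat.succ_le_iff, Nat.lt_size]
    rcases Nat.eq_zero_or_pos (n / 2) with h | h
    · rw [h]; simpa using Nat.succ_le_of_lt hn
    · have h1 : Nat.size (n / 2) - 1 < Nat.size (n / 2) := by
        have := Nat.size_pos.2 h
        omega
      have h2 := Nat.lt_size.1 h1
      have h3 : Nat.size (n / 2) = Nat.size (n / 2) - 1 + 1 := by omega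
      rw [h3, pow_succ]
      omega

/-- Halving lowers the bit length by one, so the bit length of the current value plus the number of
rounds stays equal to `Nat.size w`. -/
theorem halts_blen_loop (d : ℕ) (m : Memory) (w : ℕ) (hw : m (tmp d) = w)
    (h1 : m (tmp (d + 1)) = 0) (h2 : m (tmp (d + 2)) = 1) :
    Halts (.while (tmp d) (block [.half (tmp d) (tmp d),
        .add (tmp (d + 1)) (tmp (d + 1)) (tmp (d + 2))])) m (Nat.size w * 4 + 1)
      (fun m' => m' (tmp (d + 1)) = Nat.size w ∧ ∀ z, (∀ i, d ≤ i → z ≠ tmp i) → m' z = m z) := by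
  refine Halts.mono (Halts.while (T := 3) (fun i m' => Nat.size (m' (tmp d)).toNat + i = Nat.size w ∧
    m' (tmp (d + 1)) = i ∧ m' (tmp (d + 2)) = 1 ∧ ∀ z, (∀ i, d ≤ i → z ≠ tmp i) → m' z = m z)
    (Nat.size w) ?_ ?_ ?_) le_rfl ?_
  · rintro i hi m' ⟨g1, g2, g3, g4⟩
    have hpos : 0 < m' (tmp d) := by
      have : 0 < Nat.size (m' (tmp d)).toNat := by omega
      have := Nat.size_pos.1 this
      omega
    refine ⟨hpos, halts_block _ _ (by simp) ⟨?_, ?_, ?_, fun z hz => ?_⟩⟩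
    · rw [size_eq_size_half_add_one (by omega)] at g1
      have : (m' (tmp d) / 2).toNat = (m' (tmp d)).toNat / 2 := by omega
      simp only [execList_cons, execList_nil, Instr.exec, Function.update_apply, tmp_inj]
      simp [this]
      omega
    · simp [Instr.exec, g2, g3]
    · simp [Instr.exec, g3]
    · simp [Instr.exec, hz d le_rfl, hz (d + 1) (by omega), g4 z hz]
  · rintro m' ⟨g1, -⟩
    have : Nat.size (m' (tmp d)).toNat = 0 := by omega
    have := Nat.size_eq_zero.1 this
    omega
  · exact ⟨by simp [hw], by simpa using h1, h2, fun _ _ => rfl⟩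
  · rintro m' ⟨-, g2, -, g4⟩
    exact ⟨g2, g4⟩

/-- Registers outside the auxiliary registers from `d` on are unchanged. -/
def Same (d : ℕ) (m m' : Memory) : Prop := ∀ z, (∀ i, d ≤ i → z ≠ tmp i) → m' z = m z

theorem Same.tmp {d : ℕ} {m m' : Memory} (h : Same d m m') {i : ℕ} (hi : i < d) :
    m' (tmp i) = m (tmp i) := h _ fun j hj => by simp; omega

theorem Same.trans {d e : ℕ} {m m' m'' : Memory} (h : Same d m m') (h' : Same e m' m'')
    (hd : d ≤ e) : Same d m m'' :=
  fun z hz => (h' z fun i hi => hz i (hd.trans hi)).trans (h z hz)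

theorem Same.exec {d : ℕ} {m m' : Memory} (h : Same d m m') (l : List Instr)
    (hl : ∀ z, (∀ i, d ≤ i → z ≠ RAM.tmp i) → execList l m' z = m' z) :
    Same d m (execList l m') :=
  fun z hz => (hl z hz).trans (h z hz)

theorem Rep.of_same {m m' : Memory} {s : State} (h : Rep m s) {d : ℕ} (hm : Same d m m') :
    Rep m' s := h.of_eq hm

/-- Code at depth `d` touches only auxiliary registers from `d` on, so intermediate results below
`d` survive the evaluation of subexpressions. A bounded sum uses `d` to `d + 3` for its loop and `d
+ 4` for the accumulator, and evaluates its body at depth `d + 5`. -/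
theorem Exp.halts_compile {P : ℕ} {b : Bool} {B : ℕ} (e : Exp) (he : e.ok P b = true) (d : ℕ)
    (s : State) (hs : s.Bounded P b B) (m : Memory) (hm : Rep m s) :
    Halts (e.compile d) m (e.bound.eval B) (fun m' => m' (tmp d) = e.eval s ∧ Same d m m') := by
  induction e generalizing d s m with
  | const c =>
    refine halts_block _ _ (by simp [Exp.bound]) ⟨by simp [Instr.exec, Exp.eval], fun z hz => ?_⟩
    simp [Instr.exec, hz d le_rfl]
  | var x =>
    refine halts_block _ _ (by simp [Exp.bound, move])
      ⟨by simp [Instr.exec, move, hm.1, Exp.eval], fun z hz => ?_⟩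
    simp [Instr.exec, move, hz d le_rfl]
  | arr a i ih =>
    refine Halts.mono ((ih he d s hs m hm).seq fun m₁ h₁ => (halts_toCell a d m₁).seq
      fun m₂ h₂ => halts_block _ _ le_rfl (Q := fun m' => m' (tmp d) = (Exp.arr a i).eval s ∧
        Same d m m') ?_) ?_ (fun _ h => h)
    · have h3 : Same d m m₂ := fun z hz => by
        rw [h₂.2 z (hz d le_rfl) (hz (d + 1) (by omega)), h₁.2 z hz]
      refine ⟨?_, h3.exec _ fun z hz => ?_⟩
      · simp [Instr.exec, h₂.1, h₁.1, (hm.of_same h3).2, Exp.eval]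
      · simp [Instr.exec, hz d le_rfl]
    · simp [Exp.bound]
  | add e f ihe ihf =>
    simp only [Exp.ok, Bool.and_eq_true] at he
    refine Halts.mono ((ihe he.1 d s hs m hm).seq fun m₁ h₁ =>
      (ihf he.2 (d + 1) s hs m₁ (hm.of_same h₁.2)).seq
      fun m₂ h₂ => halts_block _ _ le_rfl (Q := fun m' => m' (tmp d) = (Exp.add e f).eval s ∧
        Same d m m') ?_) ?_ (fun _ h => h)
    · refine ⟨?_, (h₁.2.trans h₂.2 (by omega)).exec _ fun z hz => ?_⟩
      · simp [Instr.exec, h₂.1, h₁.1, Exp.eval, h₂.2.tmp (Nat.lt_succ_self d)]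
      · simp [Instr.exec, hz d le_rfl]
    · simp [Exp.bound]; omega
  | sub e f ihe ihf =>
    simp only [Exp.ok, Bool.and_eq_true] at he
    refine Halts.mono ((ihe he.1 d s hs m hm).seq fun m₁ h₁ =>
      (ihf he.2 (d + 1) s hs m₁ (hm.of_same h₁.2)).seq
      fun m₂ h₂ => halts_block _ _ le_rfl (Q := fun m' => m' (tmp d) = (Exp.sub e f).eval s ∧
        Same d m m') ?_) ?_ (fun _ h => h)
    · refine ⟨?_, (h₁.2.trans h₂.2 (by omega)).exec _ fun z hz => ?_⟩
      · simp [Instr.exec, h₂.1, h₁.1, Exp.eval, h₂.2.tmp (Nat.lt_succ_self d)]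
      · simp [Instr.exec, hz d le_rfl]
    · simp [Exp.bound]; omega
  | half e ih =>
    refine Halts.mono ((ih he d s hs m hm).seq fun m₁ h₁ =>
      halts_block _ _ le_rfl (Q := fun m' => m' (tmp d) = (Exp.half e).eval s ∧
        Same d m m') ?_) ?_ (fun _ h => h)
    · refine ⟨?_, h₁.2.exec _ fun z hz => ?_⟩
      · simp [Instr.exec, h₁.1, Exp.eval]
      · simp [Instr.exec, hz d le_rfl]
    · simp [Exp.bound]
  | ite c e f ihc ihe ihf =>
    simp only [Exp.ok, Bool.and_eq_true] at he
    refine Halts.mono ((ihc he.1 d s hs m hm).seq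
      (R := fun m' => m' (tmp d) = (Exp.ite c e f).eval s ∧ Same d m m') fun m₁ h₁ => Halts.ite
      (fun hx => (ihe he.2.1 d s hs m₁ (hm.of_same h₁.2)).mono le_rfl fun m₂ h₂ => ?_)
      (fun hx => (ihf he.2.2 d s hs m₁ (hm.of_same h₁.2)).mono le_rfl fun m₂ h₂ => ?_)) ?_
      (fun _ h => h)
    · rw [h₁.1] at hx
      exact ⟨by simp [Exp.eval, hx, h₂.1], h₁.2.trans h₂.2 le_rfl⟩
    · rw [h₁.1] at hx
      exact ⟨by simp [Exp.eval, hx, h₂.1], h₁.2.trans h₂.2 le_rfl⟩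
    · simp [Exp.bound]; omega
  | sum x n e ih =>
    simp only [Exp.ok, Bool.and_eq_true, decide_eq_true_eq] at he
    have hN : (s.v n).toNat ≤ B := hs.1 n he.1
    refine Halts.mono ((halts_block [.const (tmp (d + 4)) 0] m le_rfl
      (Q := fun m' => m' (tmp (d + 4)) = 0 ∧ Same d m m') ⟨?_, fun z hz => ?_⟩).seq
      fun m₁ h₁ => (halts_forLoop (N := (s.v n).toNat) (T := e.bound.eval B + 2)
        (fun i m' => m' (tmp (d + 4)) = ∑ j ∈ range i, e.eval (s.setv x j) ∧
          ∀ z, z ≠ RAM.var x → (∀ i, d ≤ i → z ≠ tmp i) → m' z = m z) ?_ ?_ ?_ ?_).seq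
      fun m₂ h₂ => halts_block _ _ le_rfl (Q := fun m' => m' (tmp d) = (Exp.sum x n e).eval s ∧
        Same d m m') ⟨?_, fun z hz => ?_⟩) ?_ (fun _ h => h)
    · simp [Instr.exec]
    · simp [Instr.exec, hz (d + 4) (by omega)]
    · rw [(hm.of_same h₁.2).1]
    · rintro i m' m'' ⟨g1, g2⟩ g3
      refine ⟨?_, fun z hz hz' => ?_⟩
      · rw [g3 _ (by simp) (by simp) (by simp) (by simp) (by simp), g1]
      · rw [g3 z hz (hz' _ (by omega)) (hz' _ (by omega)) (hz' _ (by omega)) (hz' _ (by omega)),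
          g2 z hz hz']
    · exact ⟨by simp [h₁.1], fun z _ hz => h₁.2 z hz⟩
    · rintro i hi m' ⟨g1, g2⟩ g3
      -- During a round the memory represents the state in which `x` is the summation index.
      have hr : Rep m' (s.setv x i) := by
        refine ⟨fun y => ?_, fun a j => ?_⟩
        · rw [State.setv_v]
          split_ifs with hy
          · rw [hy, g3]
          · rw [g2 _ (by simpa using hy) (by simp), hm.1]
        · rw [g2 _ (by simp) (by simp), hm.2, State.setv_a]
      refine Halts.seq (ih he.2.2 (d + 5) _ (hs.setv he.2.1 _) m' hr) ?_
      rintro m'' ⟨k1, k2⟩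
      refine halts_block _ _ (by simp) ⟨⟨?_, fun z hz hz' => ?_⟩, ?_, ?_, ?_⟩
      · simp [Instr.exec, k1, k2.tmp (show d + 4 < d + 5 by omega), g1, sum_range_succ]
      · simp [Instr.exec, hz' (d + 4) (by omega)]
        rw [k2 z fun j hj => hz' j (by omega), g2 z hz hz']
      · simp [Instr.exec, k2.tmp (show d < d + 5 by omega)]
      · simp [Instr.exec, k2.tmp (show d + 1 < d + 5 by omega)]
      · simp [Instr.exec, k2.tmp (show d + 2 < d + 5 by omega)]
    · simp [Instr.exec, move, h₂.1.1, Exp.eval]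
    · simp [Instr.exec, move, hz d le_rfl]
      by_cases hx : z = RAM.var x
      · rw [hx, h₂.2, h₁.2 _ (by simp)]
      · exact h₂.1.2 z hx hz
    · simp only [Exp.bound, Polynomial.eval_add, Polynomial.eval_mul, Polynomial.eval_X,
        Polynomial.eval_ofNat, move, List.length_cons, List.length_nil]
      have := Nat.mul_le_mul_right (e.bound.eval B + 2 + 8) hN
      ring_nf at this ⊢
      omega
  | blen i ih =>
    simp only [Exp.ok, Bool.and_eq_true] at he
    have hB := hs.2 he.1 (i.eval s).toNat
    refine Halts.mono ((ih he.2 d s hs m hm).seq fun m₁ h₁ => (halts_toCell 0 d m₁).seq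
      fun m₂ h₂ => (halts_block _ _ le_rfl (Q := fun m' =>
        m' (tmp d) = s.a 0 (i.eval s).toNat ∧ Same d m m') ?_).seq fun m₃ h₃ =>
      (Halts.ite (Q := fun m' => m' (tmp d) = (s.a 0 (i.eval s).toNat).natAbs ∧ Same d m m')
        (fun hx => ⟨1, _, .skip _, le_rfl, ?_⟩) (fun hx => halts_block _ _ le_rfl ?_)).seq
      fun m₄ h₄ => (halts_block _ _ le_rfl (Q := fun m' =>
        m' (tmp d) = (s.a 0 (i.eval s).toNat).natAbs ∧ m' (tmp (d + 1)) = 0 ∧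
        m' (tmp (d + 2)) = 1 ∧ Same d m m') ?_).seq fun m₅ h₅ =>
      (halts_blen_loop d m₅ _ h₅.1 h₅.2.1 h₅.2.2.1).seq fun m₆ h₆ =>
      halts_block _ _ le_rfl (Q := fun m' => m' (tmp d) = (Exp.blen i).eval s ∧ Same d m m') ?_) ?_
      (fun _ h => h)
    · have h3 : Same d m m₂ := fun z hz => by
        rw [h₂.2 z (hz d le_rfl) (hz (d + 1) (by omega)), h₁.2 z hz]
      refine ⟨?_, h3.exec _ fun z hz => ?_⟩
      · simp [Instr.exec, h₂.1, h₁.1, (hm.of_same h3).2]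
      · simp [Instr.exec, hz d le_rfl]
    · rw [h₃.1] at hx
      exact ⟨by rw [h₃.1]; omega, h₃.2⟩
    · rw [h₃.1] at hx
      refine ⟨?_, h₃.2.exec _ fun z hz => ?_⟩
      · simp only [execList_cons, execList_nil, Instr.exec, Function.update_apply, h₃.1]
        simp only [if_true, tmp_inj]
        split_ifs <;> omega
      · simp [Instr.exec, hz d le_rfl, hz (d + 1) (by omega)]
    · refine ⟨?_, ?_, ?_, h₄.2.exec _ fun z hz => ?_⟩
      · simp [Instr.exec, h₄.1]
      · simp [Instr.exec]
      · simp [Instr.exec]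
      · simp [Instr.exec, hz (d + 1) (by omega), hz (d + 2) (by omega)]
    · refine ⟨?_, (h₅.2.2.2.trans h₆.2 le_rfl).exec _ fun z hz => ?_⟩
      · simp [Instr.exec, move, h₆.1, Exp.eval]
      · simp [Instr.exec, move, hz d le_rfl]
    · simp [Exp.bound, move]; omega

/-- Induction on the command. The time bound depends on the state only through `B`, and the
untouched registers below `d` include the counters of all enclosing loops. -/
theorem Cmd.halts_compile {P : ℕ} {b : Bool} {B : ℕ} (c : Cmd) (hc : c.ok P b = true) (d : ℕ)
    (s : State) (hs : s.Bounded P b B) (m : Memory) (hm : Rep m s) :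
    Halts (c.compile d) m (c.bound.eval B)
      (fun m' => Rep m' (c.eval s) ∧ ∀ i < d, m' (tmp i) = m (tmp i)) := by
  induction c generalizing d s m with
  | assign x e =>
    simp only [Cmd.ok, Bool.and_eq_true, decide_eq_true_eq] at hc
    refine Halts.mono ((e.halts_compile hc.2 d s hs m hm).seq fun m₁ h₁ =>
      halts_block _ _ le_rfl ⟨⟨fun y => ?_, fun a j => ?_⟩, fun i hi => ?_⟩)
      (by simp [Cmd.bound, move]) (fun _ h => h)
    · simp [move, Instr.exec, Function.update_apply, h₁.1, Cmd.eval, (hm.of_same h₁.2).1]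
    · simp [move, Instr.exec, Cmd.eval, (hm.of_same h₁.2).2]
    · simp [move, Instr.exec, h₁.2.tmp hi]
  | setc a j c =>
    refine halts_block _ _ (by simp [Cmd.bound]) ⟨⟨fun y => ?_, fun a' j' => ?_⟩, fun i hi => ?_⟩
    · simp [Instr.exec, Cmd.eval, hm.1]
    · simp only [execList_cons, execList_nil, Instr.exec, Function.update_apply, cell_inj,
        Cmd.eval, State.seta_a]
      by_cases h : a' = a
      · subst h; simp [Function.update_apply, hm.2]
      · simp [h, hm.2]
    · simp [Instr.exec]
  | gen a x n e =>
    simp only [Cmd.ok, Bool.and_eq_true, decide_eq_true_eq] at hc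
    have hN : (s.v n).toNat ≤ B := hs.1 n hc.2.1
    -- Two passes: `e` may read the array `a`, so all values are first collected in the buffer and
    -- only then copied into `a`. This makes the assignment simultaneous.
    refine Halts.mono ((halts_forLoop (N := (s.v n).toNat) (T := e.bound.eval B + (3 + (10 + 2)))
        (fun i m' => (∀ j < i, m' (buf j) = e.eval (s.setv x j)) ∧
          ∀ z, z ≠ var x → (∀ j, z ≠ buf j) → (∀ i, d ≤ i → z ≠ tmp i) → m' z = m z)
        ?_ ?_ ?_ ?_).seq fun m₁ h₁ =>
      (halts_forLoop (N := (s.v n).toNat) (T := 3 + (10 + (4 + (13 + 2))))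
        (fun i m' => (∀ j, m' (buf j) = m₁ (buf j)) ∧
          (∀ j, m' (cell a j) = if j < i then e.eval (s.setv x j) else s.a a j) ∧
          ∀ z, z ≠ var x → (∀ j, z ≠ buf j) → (∀ j, z ≠ cell a j) → (∀ i, d ≤ i → z ≠ tmp i) →
            m' z = m z) ?_ ?_ ?_ ?_).mono le_rfl fun m₂ h₂ =>
      ⟨⟨fun y => ?_, fun a' j => ?_⟩, fun i hi => ?_⟩) ?_ (fun _ h => h)
    · rw [hm.1]
    · rintro i m' m'' ⟨g1, g2⟩ g3
      refine ⟨fun j hj => ?_, fun z hz hz'' hz' => ?_⟩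
      · rw [g3 _ (by simp) (by simp) (by simp) (by simp) (by simp), g1 j hj]
      · rw [g3 z hz (hz' _ (by omega)) (hz' _ (by omega)) (hz' _ (by omega)) (hz' _ (by omega)),
          g2 z hz hz'' hz']
    · exact ⟨by simp, fun _ _ _ _ => rfl⟩
    · rintro i hi m' ⟨g1, g2⟩ g3
      have hr : Rep m' (s.setv x i) := by
        refine ⟨fun y => ?_, fun a j => ?_⟩
        · rw [State.setv_v]
          split_ifs with hy
          · rw [hy, g3]
          · rw [g2 _ (by simpa using hy) (by simp) (by simp), hm.1]
        · rw [g2 _ (by simp) (by simp) (by simp), hm.2, State.setv_a]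
      refine Halts.seq (e.halts_compile hc.2.2.2 (d + 4) _ (hs.setv hc.2.2.1 _) m' hr) ?_
      rintro m₂ ⟨k1, k2⟩
      refine Halts.seq (halts_block _ _ le_rfl (Q := fun m₃ => m₃ (tmp (d + 5)) = i ∧
        ∀ z, z ≠ tmp (d + 5) → m₃ z = m₂ z) ⟨?_, fun z hz => ?_⟩) ?_
      · simp [move, Instr.exec, k2 (var x) (by simp), g3]
      · simp [move, Instr.exec, hz]
      rintro m₃ ⟨l1, l2⟩
      refine Halts.seq (halts_toBuf (d + 5) i m₃ l1) ?_
      rintro m₄ ⟨n1, n2⟩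
      have hval : m₄ (tmp (d + 4)) = e.eval (s.setv x i) := by
        rw [n2 _ (by simp) (by simp), l2 _ (by simp), k1]
      have hsame : Same (d + 4) m' m₄ := fun z hz => by
        rw [n2 z (hz _ (by omega)) (hz _ (by omega)), l2 z (hz _ (by omega)), k2 z hz]
      refine halts_block _ _ (by simp) ⟨⟨fun j hj => ?_, fun z hz hz'' hz' => ?_⟩, ?_, ?_, ?_⟩
      · simp only [execList_cons, execList_nil, Instr.exec, n1, Function.update_apply, buf_inj]
        split_ifs with hji
        · rw [hji, hval]
        · rw [hsame _ (by simp), g1 j (by omega)]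
      · simp [Instr.exec, n1, hz'']
        rw [hsame z fun j hj => hz' j (by omega), g2 z hz hz'' hz']
      · simp [Instr.exec, n1, hsame.tmp (show d < d + 4 by omega)]
      · simp [Instr.exec, n1, hsame.tmp (show d + 1 < d + 4 by omega)]
      · simp [Instr.exec, n1, hsame.tmp (show d + 2 < d + 4 by omega)]
    · by_cases hx : n = x
      · rw [hx, h₁.2, hm.1]
      · rw [h₁.1.2 _ (by simpa using hx) (by simp) (by simp), hm.1]
    · rintro i m' m'' ⟨g0, g1, g2⟩ g3
      refine ⟨fun j => ?_, fun j => ?_, fun z hz hz'' hz₃ hz' => ?_⟩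
      · rw [g3 _ (by simp) (by simp) (by simp) (by simp) (by simp), g0]
      · rw [g3 _ (by simp) (by simp) (by simp) (by simp) (by simp), g1]
      · rw [g3 z hz (hz' _ (by omega)) (hz' _ (by omega)) (hz' _ (by omega)) (hz' _ (by omega)),
          g2 z hz hz'' hz₃ hz']
    · refine ⟨fun _ => rfl, fun j => ?_, fun z hz hz'' _ hz' => h₁.1.2 z hz hz'' hz'⟩
      rw [h₁.1.2 _ (by simp) (by simp) (by simp), hm.2]; simp
    · rintro i hi m' ⟨g0, g1, g2⟩ g3
      refine Halts.seq (halts_block _ _ le_rfl (Q := fun m₃ => m₃ (tmp (d + 4)) = i ∧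
        ∀ z, z ≠ tmp (d + 4) → m₃ z = m' z) ⟨?_, fun z hz => ?_⟩) ?_
      · simp [move, Instr.exec, g3]
      · simp [move, Instr.exec, hz]
      rintro m₃ ⟨l1, l2⟩
      refine Halts.seq (halts_toBuf (d + 4) i m₃ l1) ?_
      rintro m₄ ⟨n1, n2⟩
      have hsame : Same (d + 4) m' m₄ := fun z hz => by
        rw [n2 z (hz _ (by omega)) (hz _ (by omega)), l2 z (hz _ (by omega))]
      refine Halts.seq (halts_block _ _ le_rfl (Q := fun m₅ => m₅ (tmp (d + 5)) = i ∧
        m₅ (tmp (d + 4)) = e.eval (s.setv x i) ∧ Same (d + 4) m' m₅)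
        ⟨?_, ?_, hsame.exec _ fun z hz => ?_⟩) ?_
      · simp [move, Instr.exec, hsame (var x) (by simp), g3]
      · simp [move, Instr.exec, n1, hsame (buf i) (by simp), g0, h₁.1.1 i hi]
      · simp [move, Instr.exec, hz (d + 4) (by omega), hz (d + 5) (by omega)]
      rintro m₅ ⟨o1, o2, o3⟩
      refine Halts.seq (halts_toCell a (d + 5) m₅) ?_
      rintro m₆ ⟨p1, p2⟩
      have hval : m₆ (tmp (d + 4)) = e.eval (s.setv x i) := by
        rw [p2 _ (by simp) (by simp), o2]
      rw [o1, Int.toNat_natCast] at p1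
      have hsame : Same (d + 4) m' m₆ := fun z hz => by
        rw [p2 z (hz _ (by omega)) (hz _ (by omega)), o3 z hz]
      refine halts_block _ _ (by simp)
        ⟨⟨fun j => ?_, fun j => ?_, fun z hz hz'' hz₃ hz' => ?_⟩, ?_, ?_, ?_⟩
      · simp [Instr.exec, p1]
        rw [hsame _ (by simp), g0]
      · simp only [execList_cons, execList_nil, Instr.exec, p1, Function.update_apply, cell_inj,
          true_and]
        by_cases hji : j = i
        · simp [hji, hval]
        · rw [if_neg hji, hsame _ (by simp), g1]
          congr 1
          simp; omega
      · simp [Instr.exec, p1, hz₃]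
        rw [hsame z fun j hj => hz' j (by omega), g2 z hz hz'' hz₃ hz']
      · simp [Instr.exec, p1, hsame.tmp (show d < d + 4 by omega)]
      · simp [Instr.exec, p1, hsame.tmp (show d + 1 < d + 4 by omega)]
      · simp [Instr.exec, p1, hsame.tmp (show d + 2 < d + 4 by omega)]
    · simp only [Cmd.bound, Polynomial.eval_add, Polynomial.eval_mul, Polynomial.eval_X,
        Polynomial.eval_ofNat]
      have := Nat.mul_le_mul_right (e.bound.eval B + 70) hN
      ring_nf at this ⊢
      omega
    · by_cases hx : y = x
      · rw [hx, h₂.2, h₁.2, hm.1]; rfl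
      · rw [h₂.1.2.2 _ (by simpa using hx) (by simp) (by simp) (by simp), hm.1]; rfl
    · simp only [Cmd.eval, State.seta_a]
      by_cases ha : a' = a
      · rw [ha, h₂.1.2.1]; simp
      · rw [h₂.1.2.2 _ (by simp) (by simp) (by simp [ha]) (by simp), hm.2, if_neg ha]
    · exact h₂.1.2.2 _ (by simp) (by simp) (by simp) (by simp; omega)
  | seq c c' ih ih' =>
    simp only [Cmd.ok, Bool.and_eq_true] at hc
    refine Halts.mono ((ih hc.1 d s hs m hm).seq fun m₁ h₁ =>
      (ih' hc.2 d _ (c.eval_bounded hc.1 s hs) m₁ h₁.1).mono le_rfl fun m₂ h₂ =>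
        ⟨h₂.1, fun i hi => (h₂.2 i hi).trans (h₁.2 i hi)⟩) (by simp [Cmd.bound]) (fun _ h => h)
  | ite e c c' ih ih' =>
    simp only [Cmd.ok, Bool.and_eq_true] at hc
    refine Halts.mono ((e.halts_compile hc.1 d s hs m hm).seq fun m₁ h₁ => Halts.ite
      (fun hx => (ih hc.2.1 d s hs m₁ (hm.of_same h₁.2)).mono le_rfl fun m₂ h₂ => ?_)
      (fun hx => (ih' hc.2.2 d s hs m₁ (hm.of_same h₁.2)).mono le_rfl fun m₂ h₂ => ?_))
      (by simp [Cmd.bound]; omega) (fun _ h => h)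
    · rw [h₁.1] at hx
      exact ⟨by simpa [Cmd.eval, hx] using h₂.1, fun i hi => (h₂.2 i hi).trans (h₁.2.tmp hi)⟩
    · rw [h₁.1] at hx
      exact ⟨by simpa [Cmd.eval, hx] using h₂.1, fun i hi => (h₂.2 i hi).trans (h₁.2.tmp hi)⟩
  | loop x n c ih =>
    simp only [Cmd.ok, Bool.and_eq_true, decide_eq_true_eq] at hc
    have hN : (s.v n).toNat ≤ B := hs.1 n hc.1
    -- Every intermediate state is bounded, so the induction hypothesis applies in each round with
    -- the same time bound.
    have hb : ∀ i, (iter c.eval x s i).Bounded P b B := fun i =>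
      iter_induction (fun _ s => s.Bounded P b B) hs
        fun i _ t ht => c.eval_bounded hc.2.2 _ (ht.setv hc.2.1 _)
    refine Halts.mono (halts_forLoop (N := (s.v n).toNat) (T := c.bound.eval B)
        (fun i m' => (∀ y ≠ x, m' (var y) = (iter c.eval x s i).v y) ∧
          (∀ a j, m' (cell a j) = (iter c.eval x s i).a a j) ∧
          ∀ i < d, m' (tmp i) = m (tmp i)) ?_ ?_ ?_ ?_) ?_ ?_
    · rw [hm.1]
    · rintro i m' m'' ⟨g0, g1, g2⟩ g3
      refine ⟨fun y hy => ?_, fun a j => ?_, fun j hj => ?_⟩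
      · rw [g3 _ (by simpa using hy) (by simp) (by simp) (by simp) (by simp), g0 y hy]
      · rw [g3 _ (by simp) (by simp) (by simp) (by simp) (by simp), g1]
      · rw [g3 _ (by simp) (by simp; omega) (by simp; omega) (by simp; omega) (by simp; omega),
          g2 j hj]
    · exact ⟨fun y _ => hm.1 y, hm.2, fun _ _ => rfl⟩
    · rintro i hi m' ⟨g0, g1, g2⟩ g3
      have hr : Rep m' ((iter c.eval x s i).setv x i) := by
        refine ⟨fun y => ?_, fun a j => ?_⟩
        · rw [State.setv_v]
          split_ifs with hy
          · rw [hy, g3]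
          · rw [g0 y hy]
        · rw [g1, State.setv_a]
      refine (ih hc.2.2 (d + 4) _ ((hb i).setv hc.2.1 _) m' hr).mono le_rfl fun m₂ h₂ =>
        ⟨⟨fun y _ => h₂.1.1 y, h₂.1.2, fun j hj => ?_⟩, ?_, ?_, ?_⟩
      · rw [h₂.2 j (by omega), g2 j hj]
      · exact h₂.2 _ (by omega)
      · exact h₂.2 _ (by omega)
      · exact h₂.2 _ (by omega)
    · simp only [Cmd.bound, Polynomial.eval_add, Polynomial.eval_mul, Polynomial.eval_X,
        Polynomial.eval_ofNat]
      have := Nat.mul_le_mul_right (c.bound.eval B + 8) hN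
      omega
    · rintro m' ⟨⟨g0, g1, g2⟩, g3⟩
      refine ⟨⟨fun y => ?_, fun a j => ?_⟩, g2⟩
      · simp only [Cmd.eval, State.setv_v]
        split_ifs with hy
        · rw [hy, g3, hm.1]
        · exact g0 y hy
      · rw [g1]; rfl

end RAM
end MinHOM

namespace MinHOM

open Finset

/-! ### Acyclic connected locally semicomplete digraphs -/

section Ordering

variable {V : Type*} {H : Digraph V}

open Relation

/-- Go back along the path from `x`. If `z` dominates the current vertex `c`, then `z` and the
predecessor of `c` on the path are in-neighbours of `c`, hence equal or joined, and `z` slides to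
the predecessor. If `c` dominates `z`, then `x` reaches `z`. -/
theorem comparable_of_reflTransGen (hl : LocallySemicomplete H) {x y z : V}
    (hxy : ReflTransGen H.Adj x y) (hz : H.Adj y z ∨ H.Adj z y) :
    ReflTransGen H.Adj x z ∨ ReflTransGen H.Adj z x := by
  induction hxy with
  | refl =>
    rcases hz with hz | hz
    · exact .inl (.single hz)
    · exact .inr (.single hz)
  | @tail b c hxb hbc ih =>
    rcases hz with hz | hz
    · exact .inl ((hxb.tail hbc).tail hz)
    · by_cases h : b = z
      · exact .inl (h ▸ hxb)
      · exact ih ((hl c).1 b hbc z hz h)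

/-- The mirror image: `z` slides forward along the path, by the condition on out-neighbours. -/
theorem comparable_of_reflTransGen' (hl : LocallySemicomplete H) {x y z : V}
    (hxy : ReflTransGen H.Adj y x) (hz : H.Adj y z ∨ H.Adj z y) :
    ReflTransGen H.Adj x z ∨ ReflTransGen H.Adj z x := by
  induction hxy using ReflTransGen.head_induction_on with
  | refl =>
    rcases hz with hz | hz
    · exact .inl (.single hz)
    · exact .inr (.single hz)
  | @head c b hcb hbx ih =>
    rcases hz with hz | hz
    · by_cases h : b = z
      · exact .inr (h ▸ hbx)
      · exact ih ((hl c).2 b hcb z hz h)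
    · exact .inr ((hbx.head hcb).head hz)

/-- Induction along an undirected walk: comparability with its last vertex passes from each vertex
to the preceding one, by one of the two sliding lemmas. -/
theorem comparable (hc : Connected H) (hl : LocallySemicomplete H) (x z : V) :
    ReflTransGen H.Adj x z ∨ ReflTransGen H.Adj z x := by
  obtain ⟨p⟩ := hc.preconnected x z
  have h : ∀ {a b : V} (_ : H.toSimpleGraphInclusive.Walk a b),
      ReflTransGen H.Adj b a ∨ ReflTransGen H.Adj a b := by
    intro a b p
    induction p with
    | nil => exact .inl .refl
    | @cons a c b hac p ih =>
      have hz : H.Adj c a ∨ H.Adj a c := by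
        have := hac
        simp only [Digraph.toSimpleGraphInclusive, SimpleGraph.fromRel_adj] at this
        tauto
      rcases ih with ih | ih
      · exact comparable_of_reflTransGen hl ih hz
      · exact comparable_of_reflTransGen' hl ih hz
  exact (h p).symm

/-- Move the head of the arc from `c` back to `b` along the path. If `a` dominates the successor `d`
of `b`, then `a` and `b` are in-neighbours of `d`, so they are joined, and an arc from `b` to `a`
would close a directed cycle. -/
theorem adj_of_between (ha : Acyclic H) (hl : LocallySemicomplete H) {a b c : V}
    (hac : H.Adj a c) (hab : TransGen H.Adj a b) (hbc : ReflTransGen H.Adj b c) : H.Adj a b := by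
  induction hbc using ReflTransGen.head_induction_on with
  | refl => exact hac
  | @head b d hbd hdc ih =>
    have had := ih (hab.tail hbd)
    have hne : a ≠ b := fun h => ha b (h ▸ hab)
    exact ((hl d).1 a had b hbd hne).resolve_right fun h => ha b (.head h hab)

/-- The mirror image, which moves the tail forward by means of out-neighbours. -/
theorem adj_of_between' (ha : Acyclic H) (hl : LocallySemicomplete H) {a b c : V}
    (hac : H.Adj a c) (hab : ReflTransGen H.Adj a b) (hbc : TransGen H.Adj b c) : H.Adj b c := by
  induction hab with
  | refl => exact hac
  | @tail d b had hdb ih =>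
    have hdc := ih (hbc.head hdb)
    have hne : b ≠ c := fun h => ha b (h ▸ hbc)
    exact ((hl d).2 b hdb c hdc hne).resolve_right fun h => ha b (hbc.tail h)

/-- A connected acyclic locally semicomplete digraph has a linear ordering of its vertices in which
`x` dominates `y` if this holds for some arc with later tail and earlier head and for some arc with
earlier tail and later head. -/
theorem exists_ordering [Fintype V] (hc : Connected H) (hl : LocallySemicomplete H)
    (ha : Acyclic H) : ∃ e : V ≃ Fin (Fintype.card V), ∀ i j i' j' x y, H.Adj i j → H.Adj i' j' →
      e i' ≤ e x → e x ≤ e i → e j ≤ e y → e y ≤ e j' → H.Adj x y := by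
  classical
  -- The order is reachability: totality is `comparable`, antisymmetry is acyclicity.
  let _ : LinearOrder V :=
    { le := ReflTransGen H.Adj
      le_refl := fun _ => .refl
      le_trans := fun _ _ _ h h' => h.trans h'
      le_antisymm := fun a b h h' => by
        rcases reflTransGen_iff_eq_or_transGen.1 h with h | h
        · exact h.symm
        · exact (ha a (h.trans_left h')).elim
      le_total := comparable hc hl
      toDecidableLE := Classical.decRel _ }
  have hlt : ∀ {a b : V}, H.Adj a b → a < b := fun {a b} h =>
    lt_of_le_of_ne (show ReflTransGen H.Adj a b from .single h) fun h' => ha b (.single (h' ▸ h))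
  have htr : ∀ {a b : V}, a < b → TransGen H.Adj a b := fun {a b} h =>
    (reflTransGen_iff_eq_or_transGen.1 h.le).resolve_left h.ne'
  let e := Fintype.orderIsoFinOfCardEq V rfl
  refine ⟨e.symm.toEquiv, fun i j i' j' x y hij hij' h1 h2 h3 h4 => ?_⟩
  replace h1 : i' ≤ x := e.symm.le_iff_le.1 h1
  replace h2 : x ≤ i := e.symm.le_iff_le.1 h2
  replace h3 : j ≤ y := e.symm.le_iff_le.1 h3
  replace h4 : y ≤ j' := e.symm.le_iff_le.1 h4
  -- The inner arc `ij` serves only to separate `x` from `y`. The arc `xy` then arises from the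
  -- outer arc `i'j'` by moving its tail to `x` and afterwards its head to `y`.
  have hxy : x < y := h2.trans_lt ((hlt hij).trans_le h3)
  exact adj_of_between ha hl (adj_of_between' ha hl hij' h1 (htr (hxy.trans_le h4))) (htr hxy) h4

end Ordering

end MinHOM

namespace MinHOM

open Finset

namespace RAM

/-! ### Frames -/

/-- The variables that a command may change. -/
def Cmd.vars : Cmd → List ℕ
  | .assign x _ => [x]
  | .setc _ _ _ => []
  | .gen _ _ _ _ => []
  | .seq c c' => c.vars ++ c'.vars
  | .ite _ c c' => c.vars ++ c'.vars
  | .loop _ _ c => c.vars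

/-- The arrays that a command may change. -/
def Cmd.arrs : Cmd → List (Fin 16)
  | .assign _ _ => []
  | .setc a _ _ => [a]
  | .gen a _ _ _ => [a]
  | .seq c c' => c.arrs ++ c'.arrs
  | .ite _ c c' => c.arrs ++ c'.arrs
  | .loop _ _ c => c.arrs

theorem Cmd.eval_v (c : Cmd) (s : State) {x : ℕ} (hx : x ∉ c.vars) : (c.eval s).v x = s.v x := by
  induction c generalizing s with
  | assign y e =>
    simp only [Cmd.vars, List.mem_singleton] at hx
    simp [Cmd.eval, hx]
  | setc a j c => rfl
  | gen a y n e => rfl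
  | seq c c' ih ih' =>
    simp only [Cmd.vars, List.mem_append, not_or] at hx
    exact (ih' _ hx.2).trans (ih s hx.1)
  | ite e c c' ih ih' =>
    simp only [Cmd.vars, List.mem_append, not_or] at hx
    unfold Cmd.eval
    split_ifs
    · exact ih s hx.1
    · exact ih' s hx.2
  | loop y n c ih =>
    by_cases hxy : x = y
    · simp [Cmd.eval, hxy]
    · simp only [Cmd.eval, State.setv_v, if_neg hxy]
      refine iter_induction (fun _ t => t.v x = s.v x) rfl fun i _ t ht => ?_
      rw [ih _ hx]
      simp [hxy, ht]

theorem Cmd.eval_a (c : Cmd) (s : State) {a : Fin 16} (ha : a ∉ c.arrs) :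
    (c.eval s).a a = s.a a := by
  induction c generalizing s with
  | assign y e => rfl
  | setc b j c =>
    simp only [Cmd.arrs, List.mem_singleton] at ha
    simp [Cmd.eval, ha]
  | gen b y n e =>
    simp only [Cmd.arrs, List.mem_singleton] at ha
    simp [Cmd.eval, ha]
  | seq c c' ih ih' =>
    simp only [Cmd.arrs, List.mem_append, not_or] at ha
    exact (ih' _ ha.2).trans (ih s ha.1)
  | ite e c c' ih ih' =>
    simp only [Cmd.arrs, List.mem_append, not_or] at ha
    unfold Cmd.eval
    split_ifs
    · exact ih s ha.1
    · exact ih' s ha.2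
  | loop y n c ih =>
    simp only [Cmd.eval, State.setv_a]
    exact iter_induction (fun _ t => t.a a = s.a a) rfl fun i _ t ht => (ih _ ha).trans ht

/-- Induction along a loop, with a frame. -/
theorem Cmd.loop_induction {x n : ℕ} {c : Cmd} {s : State} (I : ℕ → State → Prop) {N : ℕ}
    (hN : (s.v n).toNat = N) (hI : ∀ i t z, I i t → I i (t.setv x z)) (h0 : I 0 s)
    (hs : ∀ i < N, ∀ t, (∀ y, y ≠ x → y ∉ c.vars → t.v y = s.v y) →
      (∀ a, a ∉ c.arrs → t.a a = s.a a) → t.v x = (i : ℤ) → I i t → I (i + 1) (c.eval t)) :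
    I N ((Cmd.loop x n c).eval s) := by
  subst hN
  -- The loop variable is set before each round and restored at the end, so the invariant must not
  -- depend on it.
  refine hI _ _ _ (iter_induction (fun i t => I i t ∧
    (∀ y, y ≠ x → y ∉ c.vars → t.v y = s.v y) ∧ (∀ a, a ∉ c.arrs → t.a a = s.a a))
    ⟨h0, fun _ _ _ => rfl, fun _ _ => rfl⟩ fun i hi t ht => ⟨?_, fun y hy hy' => ?_,
      fun a ha => ?_⟩).1
  · refine hs i hi _ (fun y hy hy' => ?_) (fun a ha => ht.2.2 a ha) (by simp) (hI _ _ _ ht.1)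
    rw [State.setv_v, if_neg hy, ht.2.1 y hy hy']
  · rw [c.eval_v _ hy', State.setv_v, if_neg hy, ht.2.1 y hy hy']
  · rw [c.eval_a _ ha, State.setv_a, ht.2.2 a ha]

/-! ### Notation for programs -/

instance : Add Exp := ⟨.add⟩
instance : Sub Exp := ⟨.sub⟩
instance (n : ℕ) : OfNat Exp n := ⟨.const n⟩

@[simp] theorem Exp.eval_add (e f : Exp) (s : State) : (e + f).eval s = e.eval s + f.eval s := rfl
@[simp] theorem Exp.eval_sub (e f : Exp) (s : State) : (e - f).eval s = e.eval s - f.eval s := rfl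
@[simp] theorem Exp.eval_zero (s : State) : (0 : Exp).eval s = 0 := rfl
@[simp] theorem Exp.eval_one (s : State) : (1 : Exp).eval s = 1 := rfl
@[simp] theorem Exp.eval_two (s : State) : (2 : Exp).eval s = 2 := rfl
@[simp] theorem Exp.eval_var (x : ℕ) (s : State) : (Exp.var x).eval s = s.v x := rfl
@[simp] theorem Exp.eval_const (c : ℤ) (s : State) : (Exp.const c).eval s = c := rfl
@[simp] theorem Exp.eval_arr (a : Fin 16) (i : Exp) (s : State) :
    (Exp.arr a i).eval s = s.a a (i.eval s).toNat := rfl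
@[simp] theorem Exp.eval_half (e : Exp) (s : State) : (Exp.half e).eval s = e.eval s / 2 := rfl
@[simp] theorem Exp.eval_ite (c e f : Exp) (s : State) :
    (Exp.ite c e f).eval s = if 0 < c.eval s then e.eval s else f.eval s := rfl
@[simp] theorem Exp.eval_sum (x n : ℕ) (e : Exp) (s : State) :
    (Exp.sum x n e).eval s = ∑ i ∈ range (s.v n).toNat, e.eval (s.setv x i) := rfl

/-- The truth value of `e < f`. -/
def Exp.lt (e f : Exp) : Exp := .ite (f - e) 1 0
/-- The truth value of `e ≤ f`. -/
def Exp.le (e f : Exp) : Exp := .ite (f - e + 1) 1 0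
/-- The truth value of `e = f`. -/
def Exp.eq (e f : Exp) : Exp := .ite (f - e) 0 (.ite (e - f) 0 1)
/-- The conjunction. -/
def Exp.and (e f : Exp) : Exp := .ite e (.ite f 1 0) 0
/-- The disjunction. -/
def Exp.or (e f : Exp) : Exp := .ite e 1 (.ite f 1 0)

@[simp] theorem Exp.pos_eval_lt (e f : Exp) (s : State) :
    0 < (e.lt f).eval s ↔ e.eval s < f.eval s := by
  simp only [Exp.lt, eval_ite, eval_sub, eval_zero, eval_one]
  split_ifs <;> omega
@[simp] theorem Exp.pos_eval_le (e f : Exp) (s : State) :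
    0 < (e.le f).eval s ↔ e.eval s ≤ f.eval s := by
  simp only [Exp.le, eval_ite, eval_sub, eval_add, eval_zero, eval_one]
  split_ifs <;> omega
@[simp] theorem Exp.pos_eval_eq (e f : Exp) (s : State) :
    0 < (e.eq f).eval s ↔ e.eval s = f.eval s := by
  simp only [Exp.eq, eval_ite, eval_sub, eval_zero, eval_one]
  split_ifs <;> omega
@[simp] theorem Exp.pos_eval_and (e f : Exp) (s : State) :
    0 < (e.and f).eval s ↔ 0 < e.eval s ∧ 0 < f.eval s := by
  simp only [Exp.and, eval_ite, eval_zero, eval_one]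
  split_ifs <;> simp_all
@[simp] theorem Exp.pos_eval_or (e f : Exp) (s : State) :
    0 < (e.or f).eval s ↔ 0 < e.eval s ∨ 0 < f.eval s := by
  simp only [Exp.or, eval_ite, eval_zero, eval_one]
  split_ifs <;> simp_all

@[simp] theorem Cmd.eval_assign (x : ℕ) (e : Exp) (s : State) :
    (Cmd.assign x e).eval s = s.setv x (e.eval s) := rfl
@[simp] theorem Cmd.eval_seq (c c' : Cmd) (s : State) :
    (Cmd.seq c c').eval s = c'.eval (c.eval s) := rfl
@[simp] theorem Cmd.eval_ite (e : Exp) (c c' : Cmd) (s : State) :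
    (Cmd.ite e c c').eval s = if 0 < e.eval s then c.eval s else c'.eval s := rfl
@[simp] theorem Cmd.eval_gen (a : Fin 16) (x n : ℕ) (e : Exp) (s : State) :
    (Cmd.gen a x n e).eval s =
      s.seta a (fun j => if j < (s.v n).toNat then e.eval (s.setv x j) else s.a a j) := rfl

/-! ### Auxiliary sums -/

theorem sum_range_mul_add (n m : ℕ) (f : ℕ → ℤ) :
    ∑ p ∈ range (n * m), f p = ∑ i ∈ range n, ∑ j ∈ range m, f (i * m + j) := by
  induction n with
  | zero => simp
  | succ n ih => rw [Nat.succ_mul, sum_range_add, ih, sum_range_succ]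

theorem mul_add_inj {m i j i' j' : ℕ} (hj : j < m) (hj' : j' < m) (h : i * m + j = i' * m + j') :
    i = i' ∧ j = j' := by
  have h1 := congrArg (· / m) h
  have h2 := congrArg (· % m) h
  simp only [mul_comm _ m, Nat.mul_add_mod, Nat.mod_eq_of_lt hj, Nat.mod_eq_of_lt hj',
    Nat.mul_add_div (show 0 < m by omega), Nat.div_eq_of_lt hj, Nat.div_eq_of_lt hj'] at h1 h2
  omega

theorem mul_add_lt {n m i j : ℕ} (hi : i < n) (hj : j < m) : i * m + j < n * m := by
  calc i * m + j < (i + 1) * m := by rw [Nat.succ_mul]; omega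
    _ ≤ n * m := Nat.mul_le_mul_right m hi

/-! ### Names of variables and arrays -/

/- The parameters of the input: the number of vertices of the input and of the target digraph,
products and successors of these, the number of nodes of the network and of pairs of nodes, and
bounds on bit lengths. -/
notation "Vn" => (0 : ℕ)
notation "Vk" => (1 : ℕ)
notation "Vnk" => (2 : ℕ)
notation "Vnn" => (3 : ℕ)
notation "Vk1" => (4 : ℕ)
notation "Vn1" => (5 : ℕ)
notation "VN" => (6 : ℕ)
notation "VK" => (7 : ℕ)
notation "VNN" => (8 : ℕ)
notation "VK2" => (9 : ℕ)

/- Working variables. -/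
notation "Vu" => (10 : ℕ)
notation "Vv" => (11 : ℕ)
notation "Va" => (12 : ℕ)
notation "Vb" => (13 : ℕ)
notation "Vp" => (14 : ℕ)
notation "Vi" => (15 : ℕ)
notation "Vz" => (16 : ℕ)
notation "Vw" => (17 : ℕ)
notation "Vy" => (18 : ℕ)
notation "Vshift" => (19 : ℕ)
notation "Vinf" => (20 : ℕ)
notation "Vpow" => (21 : ℕ)
notation "Vcur" => (22 : ℕ)
notation "Vprv" => (23 : ℕ)
notation "Vok" => (24 : ℕ)

/- Arrays. -/
notation "Ainp" => (0 : Fin 16)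
notation "Acost" => (1 : Fin 16)
notation "Atmp" => (2 : Fin 16)
notation "Aaux" => (3 : Fin 16)
notation "Aord" => (4 : Fin 16)
notation "Aadj" => (5 : Fin 16)
notation "Afwd" => (6 : Fin 16)
notation "Abwd" => (7 : Fin 16)
notation "Acap" => (8 : Fin 16)
notation "Ares" => (9 : Fin 16)
notation "Alev" => (10 : Fin 16)
notation "Asol" => (11 : Fin 16)
notation "Asrc" => (12 : Fin 16)
notation "Asnk" => (13 : Fin 16)
notation "Acomp" => (14 : Fin 16)
notation "Aoff" => (15 : Fin 16)

/-! ### Integral costs -/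

/-- `Atmp[p] := Vy * Aaux[p]`, by shifting and adding. -/
def mulLoop : Cmd :=
  .loop Vz VK (.seq
    (.gen Atmp Vp Vnk (.arr Atmp (.var Vp) +
      .ite (.var Vy - .half (.var Vy) - .half (.var Vy)) (.arr Aaux (.var Vp)) 0))
    (.seq (.gen Aaux Vp Vnk (.arr Aaux (.var Vp) + .arr Aaux (.var Vp)))
      (.assign Vy (.half (.var Vy)))))

theorem mulLoop_spec {s : State} {E K y : ℕ} (hE : (s.v Vnk).toNat = E) (hK : (s.v VK).toNat = K)
    (hy : s.v Vy = y) (hyK : y < 2 ^ K) (h0 : ∀ p < E, s.a Atmp p = 0) :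
    ∀ p < E, (mulLoop.eval s).a Atmp p = y * s.a Aaux p := by
  have h := Cmd.loop_induction (x := Vz) (n := VK) (s := s) (N := K)
    (c := .seq
    (.gen Atmp Vp Vnk (.arr Atmp (.var Vp) +
      .ite (.var Vy - .half (.var Vy) - .half (.var Vy)) (.arr Aaux (.var Vp)) 0))
    (.seq (.gen Aaux Vp Vnk (.arr Aaux (.var Vp) + .arr Aaux (.var Vp)))
      (.assign Vy (.half (.var Vy)))))
    -- Each round moves the last binary digit of `Vy` into the accumulator and doubles the
    -- multiplicand, which keeps accumulator plus `Vy` times multiplicand constant. After `K` rounds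
    -- `Vy` is zero.
    (fun i t => 0 ≤ t.v Vy ∧ t.v Vy < 2 ^ (K - i) ∧
      ∀ p < E, t.a Atmp p + t.v Vy * t.a Aaux p = y * s.a Aaux p) hK
    (by simp) (by
      refine ⟨by omega, by rw [hy]; exact_mod_cast hyK, fun p hp => ?_⟩
      rw [h0 p hp, hy, zero_add])
    (by
      rintro i hi t hv ha - ⟨h1, h2, h3⟩
      have hE' : (t.v Vnk).toNat = E := by rw [hv _ (by decide) (by decide), hE]
      rw [show K - i = K - (i + 1) + 1 by omega, pow_succ] at h2
      simp only [Cmd.eval_seq, Cmd.eval_gen, Cmd.eval_assign, State.setv_v, State.seta_v,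
        Exp.eval_half, Exp.eval_var, State.setv_a, State.seta_a, Exp.eval_add, Exp.eval_arr,
        Exp.eval_ite, Exp.eval_sub, Exp.eval_zero, hE']
      refine ⟨by simp; omega, by simp; omega, fun p hp => ?_⟩
      have := h3 p hp
      simp only [hp, if_true]
      simp only [Fin.reduceEq, if_false, Int.toNat_natCast, if_true, Nat.reduceEqDiff, hp]
      rw [← this]
      rcases Int.emod_two_eq_zero_or_one (t.v Vy) with hm | hm
      · rw [if_neg (by omega)]
        have : t.v Vy = 2 * (t.v Vy / 2) := by omega
        generalize t.v Vy / 2 = z at *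
        rw [this]; ring
      · rw [if_pos (by omega)]
        have : t.v Vy = 2 * (t.v Vy / 2) + 1 := by omega
        generalize t.v Vy / 2 = z at *
        rw [this]; ring)
  intro p hp
  obtain ⟨h1, h2, h3⟩ := h
  have := h3 p hp
  rw [Nat.sub_self, pow_zero] at h2
  have hz : (mulLoop.eval s).v Vy = 0 := by
    unfold mulLoop
    omega
  unfold mulLoop at hz ⊢
  rw [hz] at this
  simpa using this

/-- The costs, multiplied by the product of all denominators. -/
def scaleLoop : Cmd :=
  .loop Vi Vnk (.seq (.assign Vy (.arr Ainp (1 + .var Vnn + .var Vnk + .var Vi)))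
    (.seq (.gen Aaux Vp Vnk (.arr Acost (.var Vp)))
    (.seq (.gen Atmp Vp Vnk 0)
    (.seq mulLoop
    (.gen Acost Vp Vnk
      (.ite (.eq (.var Vp) (.var Vi)) (.arr Acost (.var Vp)) (.arr Atmp (.var Vp))))))))

/-- Clearing denominators without division: round `i` multiplies all entries except the `i`-th by
the `i`-th denominator, so each numerator collects exactly the other denominators. -/
theorem scaleLoop_spec {s : State} {E F K : ℕ} {den : ℕ → ℕ} (hE : s.v Vnk = E)
    (hF : s.v Vnn = F) (hK : (s.v VK).toNat = K)
    (hden : ∀ p < E, s.a Ainp (1 + F + E + p) = den p) (hlt : ∀ p < E, den p < 2 ^ K) :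
    ∀ p < E, (scaleLoop.eval s).a Acost p =
      s.a Acost p * ∏ q ∈ range E, if q = p then (1 : ℤ) else den q := by
  refine Cmd.loop_induction (x := Vi) (n := Vnk) (s := s) (N := E)
    (fun i t => ∀ p < E, t.a Acost p =
      s.a Acost p * ∏ q ∈ range i, if q = p then (1 : ℤ) else den q) (by simp [hE])
      (fun i t z h => h) (by simp) ?_
  intro i hi t hv ha hx h p hp
  have e1 : t.v Vnk = E := by rw [hv _ (by decide) (by decide), hE]
  have e2 : t.v Vnn = F := by rw [hv _ (by decide) (by decide), hF]
  have e3 : t.v VK = s.v VK := by rw [hv _ (by decide) (by decide)]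
  have e4 : t.a Ainp = s.a Ainp := ha _ (by decide)
  have e5 : (1 + (F : ℤ) + E + i).toNat = 1 + F + E + i := by omega
  simp only [Cmd.eval_seq, Cmd.eval_gen _ _ _ (.ite _ _ _)]
  generalize hu : Cmd.eval _ (Cmd.eval _ (Cmd.eval _ t)) = u
  have u0 : u.v Vy = den i := by
    rw [← hu]
    simp [e1, e2, hx, e4, e5, hden i hi]
  have u1 : u.v Vnk = E := by rw [← hu]; simp [e1]
  have u2 : u.v VK = s.v VK := by rw [← hu]; simp [e3]
  have u3 : u.v Vi = i := by rw [← hu]; simp [hx]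
  have u4 : u.a Acost = t.a Acost := by rw [← hu]; simp
  have u5 : ∀ p < E, u.a Atmp p = 0 := by
    intro p hp
    rw [← hu]; simp [e1, hp]
  have u6 : ∀ p < E, u.a Aaux p = t.a Acost p := by
    intro p hp
    rw [← hu]; simp [e1, hp]
  have hm := mulLoop_spec (s := u) (E := E) (by simp [u1]) (by rw [u2, hK]) u0 (hlt i hi) u5
  have w1 : (mulLoop.eval u).v Vnk = E := by rw [mulLoop.eval_v _ (by decide), u1]
  have w2 : (mulLoop.eval u).v Vi = i := by rw [mulLoop.eval_v _ (by decide), u3]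
  have w3 : (mulLoop.eval u).a Acost = t.a Acost := by rw [mulLoop.eval_a _ (by decide), u4]
  rw [prod_range_succ]
  simp [w1, hp, w2, w3, hm p hp, u6 p hp, h p hp, eq_comm (a := i)]
  split_ifs <;> ring

/-- Integral nonnegative costs, which order the mappings like the given costs, and a number larger
than the sum of all these. -/
def costCmd : Cmd :=
  .seq (.gen Acost Vp Vnk (.arr Ainp (1 + .var Vnn + .var Vp)))
  (.seq scaleLoop
  (.seq (.assign Vshift
    (.sum Vp Vnk (.ite (.arr Acost (.var Vp)) (.arr Acost (.var Vp)) (0 - .arr Acost (.var Vp)))))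
  (.seq (.gen Acost Vp Vnk (.arr Acost (.var Vp) + .var Vshift))
  (.assign Vinf (1 + .sum Vp Vnk (.arr Acost (.var Vp)))))))

theorem prod_ite_mul {E p : ℕ} (hp : p < E) (f : ℕ → ℤ) :
    (∏ q ∈ range E, if q = p then 1 else f q) * f p = ∏ q ∈ range E, f q := by
  have : ∀ q ∈ range E, f q = (if q = p then 1 else f q) * (if q = p then f q else 1) := by
    intro q _
    split_ifs <;> simp
  rw [prod_congr rfl this, prod_mul_distrib, prod_ite_eq' _ p f, if_pos (by simpa using hp)]

/-- Each factor is at most two to the power of its bit length, so the scaled costs have a number of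
digits that is linear in the input, although the product runs over all denominators. -/
theorem scaled_le {E p : ℕ} (hp : p < E) (num : ℕ → ℤ) (den : ℕ → ℕ) :
    |num p * ∏ q ∈ range E, if q = p then (1 : ℤ) else den q| ≤
      2 ^ ∑ p ∈ range E, (Nat.size (num p).natAbs + Nat.size (den p)) := by
  have h1 : |num p| ≤ 2 ^ ∑ q ∈ range E, Nat.size (num q).natAbs := by
    rw [Int.abs_eq_natAbs]
    calc ((num p).natAbs : ℤ) ≤ 2 ^ Nat.size (num p).natAbs := by
          exact_mod_cast (Nat.lt_size_self _).le
      _ ≤ _ := pow_le_pow_right₀ (by norm_num)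
          (single_le_sum (f := fun q => Nat.size (num q).natAbs) (fun _ _ => Nat.zero_le _)
            (by simpa using hp))
  have h2 : |∏ q ∈ range E, if q = p then (1 : ℤ) else den q| ≤
      2 ^ ∑ q ∈ range E, Nat.size (den q) := by
    rw [abs_prod, ← prod_pow_eq_pow_sum]
    refine prod_le_prod (fun _ _ => abs_nonneg _) fun q _ => ?_
    split_ifs
    · rw [abs_one]; exact one_le_pow₀ (by norm_num)
    · rw [Nat.abs_cast]; exact_mod_cast (Nat.lt_size_self _).le
  rw [abs_mul, sum_add_distrib, pow_add]
  exact mul_le_mul h1 h2 (abs_nonneg _) (by positivity)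

/-- Here `D` is the product of the denominators and `M` the sum of the absolute values of the scaled
costs. A map of `n` vertices pays the shift `M` exactly `n` times, so comparisons of total costs are
unaffected. `Vinf` exceeds the sum of all costs and serves as the prohibitive capacity. The last
bound limits the number of digits of the capacities. -/
theorem costCmd_spec {s : State} {E F K : ℕ} {num : ℕ → ℤ} {den : ℕ → ℕ} (hE : s.v Vnk = E)
    (hF : s.v Vnn = F) (hK : (s.v VK).toNat = K)
    (hnum : ∀ p < E, s.a Ainp (1 + F + p) = num p)
    (hden : ∀ p < E, s.a Ainp (1 + F + E + p) = den p) (hpos : ∀ p < E, 0 < den p)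
    (hsize : ∑ p ∈ range E, (Nat.size (num p).natAbs + Nat.size (den p)) = K) :
    (∃ D M : ℤ, 0 < D ∧ ∀ p < E, ((costCmd.eval s).a Acost p - M) * den p = num p * D) ∧
    (∀ p < E, 0 ≤ (costCmd.eval s).a Acost p) ∧
    (costCmd.eval s).v Vinf = 1 + ∑ p ∈ range E, (costCmd.eval s).a Acost p ∧
    2 * (costCmd.eval s).v Vinf ≤ 2 ^ (K + E + E + 2) := by
  unfold costCmd
  simp only [Cmd.eval_seq]
  generalize hu : Cmd.eval (.gen Acost Vp Vnk _) s = u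
  have u1 : u.v = s.v := by rw [← hu]; simp
  have u2 : u.a Ainp = s.a Ainp := by rw [← hu]; simp
  have u3 : ∀ p < E, u.a Acost p = num p := by
    intro p hp
    have : (1 + (F : ℤ) + p).toNat = 1 + F + p := by omega
    rw [← hu]; simp [hE, hp, hF, this, hnum p hp]
  have hlt : ∀ p < E, den p < 2 ^ K := by
    intro p hp
    refine (Nat.lt_size_self _).trans_le (Nat.pow_le_pow_right (by norm_num) ?_)
    rw [← hsize]
    exact (Nat.le_add_left _ _).trans
      (single_le_sum (f := fun p => Nat.size (num p).natAbs + Nat.size (den p))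
        (fun _ _ => Nat.zero_le _) (by simpa using hp))
  have hs := scaleLoop_spec (s := u) (E := E) (F := F) (K := K) (den := den) (by rw [u1, hE])
    (by rw [u1, hF]) (by rw [u1, hK]) (by rw [u2]; exact hden) hlt
  have w1 : (scaleLoop.eval u).v Vnk = E := by rw [scaleLoop.eval_v _ (by decide), u1, hE]
  generalize scaleLoop.eval u = w at hs w1
  have hA : ∀ p < E, w.a Acost p * den p = num p * ∏ q ∈ range E, (den q : ℤ) := by
    intro p hp
    rw [hs p hp, u3 p hp, mul_assoc, prod_ite_mul hp fun q => (den q : ℤ)]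
  have hAle : ∀ p < E, |w.a Acost p| ≤ 2 ^ K := by
    intro p hp
    rw [hs p hp, u3 p hp, ← hsize]
    exact scaled_le hp num den
  have habs : ∀ z : ℤ, (if 0 < z then z else -z) = |z| := by
    intro z
    split_ifs with h
    · exact (abs_of_pos h).symm
    · exact (abs_of_nonpos (not_lt.1 h)).symm
  simp only [Cmd.eval_assign, Cmd.eval_gen, State.setv_v, State.setv_a, State.seta_a, State.seta_v,
    Exp.eval_add, Exp.eval_sum, Exp.eval_ite, Exp.eval_arr, Exp.eval_var, Exp.eval_one,
    Exp.eval_sub, Exp.eval_zero, zero_sub, w1, habs, Nat.reduceEqDiff, if_true, if_false,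
    Int.toNat_natCast]
  generalize hM : ∑ p ∈ range E, |w.a Acost p| = M
  have hM0 : 0 ≤ M := by rw [← hM]; exact sum_nonneg fun _ _ => abs_nonneg _
  have hle : ∀ p < E, |w.a Acost p| ≤ M := by
    intro p hp
    rw [← hM]
    exact single_le_sum (f := fun p => |w.a Acost p|) (fun _ _ => abs_nonneg _) (by simpa using hp)
  refine ⟨⟨∏ q ∈ range E, (den q : ℤ), M, ?_, ?_⟩, ?_, ?_, ?_⟩
  · exact prod_pos fun q hq => by exact_mod_cast hpos q (by simpa using hq)
  · intro p hp
    simp [hp, hA p hp]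
  · intro p hp
    have := neg_abs_le (w.a Acost p)
    have := hle p hp
    simp [hp]; omega
  · trivial
  · have hME : M ≤ E * 2 ^ K := by
      rw [← hM]
      calc _ ≤ ∑ p ∈ range E, (2 : ℤ) ^ K := sum_le_sum fun p hp => hAle p (by simpa using hp)
        _ = _ := by simp
    have hsum : (∑ x ∈ range E, if x < E then w.a Acost x + M else w.a Acost x) ≤
        E * (2 ^ K + E * 2 ^ K) := by
      calc _ ≤ ∑ x ∈ range E, ((2 : ℤ) ^ K + E * 2 ^ K) := by
            refine sum_le_sum fun p hp => ?_
            have hp : p < E := by simpa using hp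
            rw [if_pos hp]
            exact add_le_add ((le_abs_self _).trans (hAle p hp)) hME
        _ = _ := by simp
    have hE1 : ((E : ℤ) + 1) ≤ 2 ^ E := by exact_mod_cast Nat.succ_le_of_lt (Nat.lt_two_pow_self)
    -- The shifted costs sum to at most `E * (E + 1) * 2 ^ K`. Bounding the two factors by powers of
    -- two yields the exponent `K + E + E`, and the final `+ 2` pays for the added 1 and for
    -- doubling.
    have hEE : (E : ℤ) * (E + 1) ≤ 2 ^ E * 2 ^ E :=
      mul_le_mul (by omega) hE1 (by positivity) (by positivity)
    have hKpos : (1 : ℤ) ≤ 2 ^ K := one_le_pow₀ (by norm_num)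
    have h3 : (E : ℤ) * (2 ^ K + E * 2 ^ K) ≤ 2 ^ K * (2 ^ E * 2 ^ E) := by
      calc (E : ℤ) * (2 ^ K + E * 2 ^ K) = 2 ^ K * (E * (E + 1)) := by ring
        _ ≤ _ := by gcongr
    have h4 : (1 : ℤ) ≤ 2 ^ K * (2 ^ E * 2 ^ E) := by
      have := one_le_pow₀ (M₀ := ℤ) (a := 2) (n := K + E + E) (by norm_num)
      rw [pow_add, pow_add] at this
      linarith
    have h5 : (2 : ℤ) ^ (K + E + E + 2) = 4 * (2 ^ K * (2 ^ E * 2 ^ E)) := by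
      rw [pow_add, pow_add, pow_add]; ring
    rw [h5]
    linarith

/-! ### Reachability in the residual network -/

/-- Some `x < n` makes `e` positive. -/
def Exp.ex (x n : ℕ) (e : Exp) : Exp := .sum x n (.ite e 1 0)

@[simp] theorem Exp.pos_eval_ex (x n : ℕ) (e : Exp) (s : State) :
    0 < (Exp.ex x n e).eval s ↔ ∃ i < (s.v n).toNat, 0 < e.eval (s.setv x i) := by
  have h : ∀ i ∈ range (s.v n).toNat, (0 : ℤ) ≤ if 0 < e.eval (s.setv x i) then 1 else 0 := by
    intro i _
    split_ifs <;> simp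
  simp only [Exp.ex, eval_sum, eval_ite, eval_one, eval_zero]
  rw [sum_pos_iff_of_nonneg h]
  simp only [mem_range]
  refine exists_congr fun i => and_congr_right fun _ => ?_
  split_ifs with h <;> simp [h]

/-- The number of the pair `(x, y)` of nodes of the network. -/
def Exp.pair (x y : ℕ) : Exp := .sum Vz VN (.var x) + .var y

theorem Exp.eval_pair {x y N i j : ℕ} {s : State} (hN : s.v VN = N) (hx : x ≠ Vz)
    (hi : s.v x = i) (hj : s.v y = j) : (Exp.pair x y).eval s = ((i * N + j : ℕ) : ℤ) := by
  simp [Exp.pair, hN, hx, hi, hj, mul_comm]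

/-- `L` assigns positive numbers to the nodes that can be reached from the sources along arcs with
positive residual capacities, which decrease along suitable paths back to the sources. -/
structure Levels (N : ℕ) (R : ℕ → ℕ → ℤ) (src L : ℕ → ℤ) : Prop where
  nonneg : ∀ x < N, 0 ≤ L x
  le : ∀ x < N, L x ≤ N + 1
  start : ∀ x < N, 0 < src x → 0 < L x
  one : ∀ x < N, L x = 1 → 0 < src x
  pred : ∀ y < N, 1 < L y → ∃ x < N, 0 < L x ∧ L x < L y ∧ 0 < R x y
  closed : ∀ x < N, ∀ y < N, 0 < L x → 0 < R x y → 0 < L y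

/-- The situation after `i` rounds of the search. -/
structure PartialLevels (N : ℕ) (R : ℕ → ℕ → ℤ) (src L : ℕ → ℤ) (i : ℕ) : Prop where
  nonneg : ∀ x < N, 0 ≤ L x
  le : ∀ x < N, L x ≤ i + 1
  start : ∀ x < N, 0 < src x → 0 < L x
  one : ∀ x < N, L x = 1 → 0 < src x
  pred : ∀ y < N, 1 < L y → ∃ x < N, 0 < L x ∧ L x < L y ∧ 0 < R x y
  closed : (∀ x < N, ∀ y < N, 0 < L x → 0 < R x y → 0 < L y) ∨
    i ≤ ((range N).filter fun x => 0 < L x).card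

/-- A round either labels nothing new, and then the labelled set is closed for good, or it adds at
least one node. New nodes get the label `i + 2`, which exceeds all earlier labels, so each has a
predecessor with a smaller label. -/
theorem PartialLevels.step {N : ℕ} {R : ℕ → ℕ → ℤ} {src L L' : ℕ → ℤ} {i : ℕ}
    (h : PartialLevels N R src L i)
    (hL' : ∀ y < N, L' y = if 0 < L y then L y else
      if ∃ x < N, 0 < L x ∧ 0 < R x y then (i : ℤ) + 2 else 0) :
    PartialLevels N R src L' (i + 1) := by
  have hpos : ∀ y < N, 0 < L y → L' y = L y := fun y hy h => by rw [hL' y hy, if_pos h]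
  refine ⟨fun y hy => ?_, fun y hy => ?_, fun y hy hs => ?_, fun y hy h1 => ?_,
    fun y hy h1 => ?_, ?_⟩
  · rw [hL' y hy]; split_ifs <;> omega
  · have := h.le y hy
    rw [hL' y hy]; push_cast; split_ifs <;> omega
  · rw [hpos y hy (h.start y hy hs)]; exact h.start y hy hs
  · rw [hL' y hy] at h1
    split_ifs at h1 <;> first | exact h.one y hy h1 | omega
  · rw [hL' y hy] at h1
    split_ifs at h1 with h2 h3
    · obtain ⟨x, hx, h4, h5, h6⟩ := h.pred y hy h1
      exact ⟨x, hx, by rwa [hpos x hx h4], by rwa [hpos x hx h4, hpos y hy h2], h6⟩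
    · obtain ⟨x, hx, h4, h5⟩ := h3
      refine ⟨x, hx, by rwa [hpos x hx h4], ?_, h5⟩
      rw [hpos x hx h4, hL' y hy, if_neg h2, if_pos ⟨x, hx, h4, h5⟩]
      have := h.le x hx
      omega
    · omega
  · by_cases hc : ∀ x < N, ∀ y < N, 0 < L x → 0 < R x y → 0 < L y
    · left
      have hneg : ∀ y < N, 0 < L' y → 0 < L y := by
        intro y hy h1
        rw [hL' y hy] at h1
        split_ifs at h1 with h2 h3
        · exact h1
        · obtain ⟨x, hx, h4, h5⟩ := h3
          exact hc x hx y hy h4 h5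
        · omega
      intro x hx y hy h1 h2
      have := hc x hx y hy (hneg x hx h1) h2
      rwa [hpos y hy this]
    · right
      have hcard := h.closed.resolve_left hc
      push Not at hc
      obtain ⟨x, hx, y, hy, h1, h2, h3⟩ := hc
      refine Nat.succ_le_of_lt (hcard.trans_lt (card_lt_card ?_))
      rw [ssubset_iff_of_subset]
      · refine ⟨y, ?_, ?_⟩
        · simp only [mem_filter, mem_range]
          refine ⟨hy, ?_⟩
          rw [hL' y hy, if_neg (not_lt.2 h3), if_pos ⟨x, hx, h1, h2⟩]
          omega
        · simp [h3]
      · intro z hz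
        simp only [mem_filter, mem_range] at hz ⊢
        exact ⟨hz.1, by rw [hpos z hz.1 hz.2]; exact hz.2⟩

/-- After `N` rounds a set that is not yet known to be closed has at least `N` nodes, so it is
everything. -/
theorem PartialLevels.levels {N : ℕ} {R : ℕ → ℕ → ℤ} {src L : ℕ → ℤ}
    (h : PartialLevels N R src L N) : Levels N R src L := by
  refine ⟨h.nonneg, h.le, h.start, h.one, h.pred, ?_⟩
  rcases h.closed with h' | h'
  · exact h'
  · intro x _ y hy _ _
    have h2 : (range N).filter (fun x => 0 < L x) = range N :=
      eq_of_subset_of_card_le (filter_subset _ _) (by simpa using h')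
    have : y ∈ (range N).filter (fun x => 0 < L x) := by rw [h2]; simpa using hy
    exact (mem_filter.1 this).2

/-- Search the nodes that can be reached from the sources. -/
def reachCmd : Cmd :=
  .seq (.gen Alev Vu VN (.arr Asrc (.var Vu)))
    (.loop Vi VN (.gen Alev Vv VN (.ite (.arr Alev (.var Vv)) (.arr Alev (.var Vv))
      (.ite (.ex Vu VN (.and (.arr Alev (.var Vu)) (.arr Ares (.pair Vu Vv)))) (.var Vi + 2) 0))))

/-- The initial labels are the source marks, so label 1 singles out sources. As `gen` assigns
simultaneously, a round sees only the labels of the previous one. -/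
theorem reachCmd_spec {s : State} {N : ℕ} (hN : s.v VN = N)
    (hsrc : ∀ x < N, s.a Asrc x = 0 ∨ s.a Asrc x = 1) :
    Levels N (fun x y => s.a Ares (x * N + y)) (s.a Asrc) ((reachCmd.eval s).a Alev) := by
  refine PartialLevels.levels ?_
  unfold reachCmd
  simp only [Cmd.eval_seq]
  generalize hu : Cmd.eval _ s = u
  have u1 : u.v = s.v := by rw [← hu]; simp
  have u2 : u.a Ares = s.a Ares := by rw [← hu]; simp
  have u3 : ∀ x < N, u.a Alev x = s.a Asrc x := by
    intro x hx
    rw [← hu]; simp [hN, hx]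
  refine Cmd.loop_induction (fun i t => PartialLevels N (fun x y => s.a Ares (x * N + y)) (s.a Asrc)
    (t.a Alev) i) (by simp [u1, hN]) (fun _ _ _ h => h) ?_ ?_
  · refine ⟨fun x hx => ?_, fun x hx => ?_, fun x hx h => by rwa [u3 x hx],
      fun x hx h => ?_, fun x hx h => ?_, .inr (Nat.zero_le _)⟩
    · rw [u3 x hx]; rcases hsrc x hx with h | h <;> omega
    · rw [u3 x hx]; rcases hsrc x hx with h | h <;> omega
    · rw [u3 x hx] at h; omega
    · rw [u3 x hx] at h; rcases hsrc x hx with h' | h' <;> omega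
  · intro i hi t hv ha hx h
    refine h.step fun y hy => ?_
    have e1 : t.v VN = N := by rw [hv _ (by decide) (by decide), u1, hN]
    have e2 : t.a Ares = s.a Ares := by rw [ha _ (by decide), u2]
    have e3 : ∀ x < N, (Exp.pair Vu Vv).eval ((t.setv Vv y).setv Vu x) = ((x * N + y : ℕ) : ℤ) :=
      fun x _ => Exp.eval_pair (by simp [e1]) (by decide) (by simp) (by simp)
    have e4 : (∃ x < N, 0 < t.a Alev x ∧ 0 < t.a Ares
        ((Exp.pair Vu Vv).eval ((t.setv Vv y).setv Vu x)).toNat) ↔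
        ∃ x < N, 0 < t.a Alev x ∧ 0 < s.a Ares (x * N + y) :=
      exists_congr fun x => and_congr_right fun hx => by rw [e3 x hx, e2, Int.toNat_natCast]
    simp [e1, hx, hy, e4]

/-! ### Cuts -/

/-- The capacity of the cut `T` with respect to the capacities `R`. -/
def cut (N : ℕ) (R : ℕ → ℕ → ℤ) (T : Finset ℕ) : ℤ :=
  ∑ x ∈ range N, ∑ y ∈ range N, if x ∈ T ∧ y ∉ T then R x y else 0

/-- The set `T` contains the sources and no sink. -/
structure Separates (N : ℕ) (src snk : ℕ → ℤ) (T : Finset ℕ) : Prop where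
  source : ∀ x < N, 0 < src x → x ∈ T
  sink : ∀ x < N, 0 < snk x → x ∉ T

theorem cut_congr {N : ℕ} {R R' : ℕ → ℕ → ℤ} (T : Finset ℕ)
    (h : ∀ x < N, ∀ y < N, x ∈ T → y ∉ T → R x y = R' x y) : cut N R T = cut N R' T := by
  refine sum_congr rfl fun x hx => sum_congr rfl fun y hy => ?_
  split_ifs with hT
  · exact h x (by simpa using hx) y (by simpa using hy) hT.1 hT.2
  · rfl

theorem cut_add (N : ℕ) (R R' : ℕ → ℕ → ℤ) (T : Finset ℕ) :
    cut N (fun x y => R x y + R' x y) T = cut N R T + cut N R' T := by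
  simp only [cut, ← sum_add_distrib]
  refine sum_congr rfl fun x _ => sum_congr rfl fun y _ => ?_
  split_ifs <;> simp

theorem cut_nonneg {N : ℕ} {R : ℕ → ℕ → ℤ} (h : ∀ x < N, ∀ y < N, 0 ≤ R x y) (T : Finset ℕ) :
    0 ≤ cut N R T := by
  refine sum_nonneg fun x hx => sum_nonneg fun y hy => ?_
  split_ifs
  · exact h x (by simpa using hx) y (by simpa using hy)
  · rfl

theorem cut_zero (N : ℕ) (T : Finset ℕ) : cut N (fun _ _ => 0) T = 0 := by
  simp [cut]

theorem cut_le_sq {N : ℕ} {R : ℕ → ℕ → ℤ} (h : ∀ x < N, ∀ y < N, R x y ≤ 1) (T : Finset ℕ) :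
    cut N R T ≤ N * N := by
  calc cut N R T ≤ ∑ x ∈ range N, ∑ y ∈ range N, (1 : ℤ) := by
        refine sum_le_sum fun x hx => sum_le_sum fun y hy => ?_
        split_ifs
        · exact h x (by simpa using hx) y (by simpa using hy)
        · norm_num
    _ = N * N := by simp

theorem cut_single {N a b : ℕ} (ha : a < N) (hb : b < N) (T : Finset ℕ) :
    cut N (fun x y => if x = a ∧ y = b then 1 else 0) T = if a ∈ T ∧ b ∉ T then 1 else 0 := by
  unfold cut
  rw [sum_eq_single_of_mem a (by simpa using ha), sum_eq_single_of_mem b (by simpa using hb)]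
  · simp
  · intro y _ hy
    simp [hy]
  · intro x _ hx
    simp [hx]

/-- Sending a unit along `ab` changes a cut only through the membership of the two ends, whatever
the position of the arc relative to `T`. Along a path these changes telescope. -/
theorem cut_exchange {N a b : ℕ} (ha : a < N) (hb : b < N) {R R' : ℕ → ℕ → ℤ} (T : Finset ℕ)
    (h : ∀ x < N, ∀ y < N, R' x y = R x y - (if x = a ∧ y = b then 1 else 0) +
      if x = b ∧ y = a then 1 else 0) :
    cut N R' T = cut N R T - (if a ∈ T then 1 else 0) + if b ∈ T then 1 else 0 := by
  have h1 : cut N (fun x y => R' x y + if x = a ∧ y = b then 1 else 0) T =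
      cut N (fun x y => R x y + if x = b ∧ y = a then 1 else 0) T :=
    cut_congr T fun x hx y hy _ _ => by rw [h x hx y hy]; ring
  rw [cut_add, cut_add, cut_single ha hb, cut_single hb ha] at h1
  by_cases hA : a ∈ T <;> by_cases hB : b ∈ T <;> simp [hA, hB] at h1 ⊢ <;> linarith

/-! ### Augmenting along a path -/

/-- If some `x < n` makes `e` positive, then assign such an `x` to `r`. -/
def pick (r x n : ℕ) (e : Exp) : Cmd := .loop x n (.assign r (.ite e (.var x) (.var r)))

/-- The hypothesis on `e` leaves the value of `r` free, because `r` may be overwritten before the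
test is evaluated again. The last successful index is kept. -/
theorem pick_spec {r x n N : ℕ} {e : Exp} {s : State} (hN : s.v n = N) (hrx : r ≠ x)
    (P : ℕ → Prop) (hP : ∀ i < N, ∀ t : State, (∀ y, y ≠ x → y ≠ r → t.v y = s.v y) →
      (∀ a, t.a a = s.a a) → t.v x = i → (0 < e.eval t ↔ P i)) :
    (∃ i < N, P i ∧ ((pick r x n e).eval s).v r = i) ∨
      (∀ i < N, ¬ P i) ∧ ((pick r x n e).eval s).v r = s.v r := by
  refine Cmd.loop_induction (N := N) (fun m t => (∃ i < N, P i ∧ t.v r = i) ∨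
    (∀ i < m, ¬ P i) ∧ t.v r = s.v r) (by simp [hN]) (fun i t z h => by simpa [hrx] using h)
    (by simp) ?_
  intro i hi t hv ha hx h
  have hP := hP i hi t (fun y hy hy' => hv y hy (by simpa [Cmd.vars] using hy'))
    (fun a => ha a (by simp [Cmd.arrs])) hx
  have hval : ((Cmd.assign r (.ite e (.var x) (.var r))).eval t).v r =
      if 0 < e.eval t then t.v x else t.v r := by simp
  by_cases hp : P i
  · exact .inl ⟨i, hi, hp, by rw [hval, if_pos (hP.2 hp), hx]⟩
  · rw [hval, if_neg (mt hP.1 hp)]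
    refine h.imp id fun h => ⟨fun j hj => ?_, h.2⟩
    rcases Nat.lt_succ_iff_lt_or_eq.1 hj with hj | rfl
    · exact h.1 j hj
    · exact hp

/-- Go back one step on an augmenting path. -/
def backCmd : Cmd :=
  .ite (.lt 1 (.arr Alev (.var Vcur)))
    (.seq (pick Vprv Vu VN (.and (.arr Alev (.var Vu))
      (.and (.lt (.arr Alev (.var Vu)) (.arr Alev (.var Vcur))) (.arr Ares (.pair Vu Vcur)))))
    (.seq (.gen Ares Vp VNN (.arr Ares (.var Vp) -
        .ite (.eq (.var Vp) (.pair Vprv Vcur)) 1 0 + .ite (.eq (.var Vp) (.pair Vcur Vprv)) 1 0))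
      (.assign Vcur (.var Vprv))))
    (.assign Vprv 0)

/-- The situation after `i` steps back on an augmenting path. -/
structure Walked (N : ℕ) (R₀ : ℕ → ℕ → ℤ) (src snk L : ℕ → ℤ) (R : ℕ → ℕ → ℤ) (c i : ℕ) :
    Prop where
  lt : c < N
  pos : 0 < L c
  le : L c = 1 ∨ L c + i ≤ N + 1
  nonneg : ∀ x < N, ∀ y < N, 0 ≤ R x y
  cut_eq : ∀ T, Separates N src snk T → cut N R T = cut N R₀ T - if c ∈ T then 1 else 0
  eq : ∀ x < N, ∀ y < N, L x ≤ L c → L y ≤ L c → R x y = R₀ x y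

/-- The unit is sent backwards from a sink. In the cut formula the correction moves from `c` to `x`
by `cut_exchange`. The two changed entries involve `c`, whose label exceeds that of `x`, so all
capacities still needed are those seen by the search. Labels drop at every step, hence the bound on
label plus steps. -/
theorem Walked.step {N : ℕ} {R₀ : ℕ → ℕ → ℤ} {src snk L : ℕ → ℤ} {R R' : ℕ → ℕ → ℤ} {c x i : ℕ}
    (h : Walked N R₀ src snk L R c i) (hx : x < N) (hLx : 0 < L x) (hxc : L x < L c)
    (hR : 0 < R x c)
    (hR' : ∀ u < N, ∀ v < N, R' u v = R u v - (if u = x ∧ v = c then 1 else 0) +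
      if u = c ∧ v = x then 1 else 0) : Walked N R₀ src snk L R' x (i + 1) := by
  refine ⟨hx, hLx, ?_, fun u hu v hv => ?_, fun T hT => ?_, fun u hu v hv h1 h2 => ?_⟩
  · have := h.le
    push_cast
    omega
  · rw [hR' u hu v hv]
    have := h.nonneg u hu v hv
    by_cases h1 : u = x ∧ v = c
    · rw [h1.1, h1.2]; split_ifs <;> simp <;> omega
    · rw [if_neg h1]; split_ifs <;> omega
  · rw [cut_exchange hx h.lt T hR', h.cut_eq T hT]
    ring
  · rw [hR' u hu v hv, if_neg, if_neg, h.eq u hu v hv (by omega) (by omega)]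
    · ring
    · rintro ⟨rfl, rfl⟩; omega
    · rintro ⟨rfl, rfl⟩; omega

theorem backCmd_spec {t : State} {N : ℕ} (hN : t.v VN = N) (hNN : (t.v VNN).toNat = N * N)
    {R₀ : ℕ → ℕ → ℤ} {src snk : ℕ → ℤ} (hL : Levels N R₀ src (t.a Alev)) {c i : ℕ}
    (hc : t.v Vcur = c)
    (h : Walked N R₀ src snk (t.a Alev) (fun x y => t.a Ares (x * N + y)) c i) :
    ∃ c' : ℕ, (backCmd.eval t).v Vcur = c' ∧ Walked N R₀ src snk (t.a Alev)
      (fun x y => (backCmd.eval t).a Ares (x * N + y)) c' (i + 1) := by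
  unfold backCmd
  simp only [Cmd.eval_ite, Exp.pos_eval_lt, Exp.eval_one, Exp.eval_arr, Exp.eval_var, hc,
    Int.toNat_natCast]
  split_ifs with h1
  · obtain ⟨x, hx, hx1, hx2, hx3⟩ := hL.pred c h.lt h1
    -- The levels refer to the capacities at the time of the search, and this entry has not changed
    -- since.
    rw [← h.eq x hx c h.lt hx2.le le_rfl] at hx3
    simp only [Cmd.eval_seq]
    generalize hu : (pick _ _ _ _).eval t = u
    have hp := pick_spec (s := t) (r := Vprv) (x := Vu) (n := VN) (e := .and (.arr Alev (.var Vu))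
      (.and (.lt (.arr Alev (.var Vu)) (.arr Alev (.var Vcur))) (.arr Ares (.pair Vu Vcur)))) hN
      (by decide) (fun x => 0 < t.a Alev x ∧ t.a Alev x < t.a Alev c ∧ 0 < t.a Ares (x * N + c)) (by
        intro i hi t' hv ha hi'
        have e1 : ((Exp.pair Vu Vcur).eval t').toNat = i * N + c := by
          rw [← Int.toNat_natCast (i * N + c)]
          congr 1
          exact Exp.eval_pair (by rw [hv _ (by decide) (by decide), hN]) (by decide) hi'
            (by rw [hv _ (by decide) (by decide), hc])
        have e2 : t'.v Vcur = c := by rw [hv _ (by decide) (by decide), hc]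
        simp [ha, hi', e2, e1])
    have u1 : ∀ y, y ≠ Vprv → u.v y = t.v y := by
      intro y hy
      rw [← hu]
      exact Cmd.eval_v _ _ (by simpa [pick, Cmd.vars] using hy)
    have u2 : u.a Ares = t.a Ares := by
      rw [← hu]
      exact Cmd.eval_a _ _ (by simp [pick, Cmd.arrs])
    rw [hu] at hp
    obtain ⟨x, hx, ⟨hx1, hx2, hx3⟩, hx4⟩ := hp.resolve_right fun h => h.1 x hx ⟨hx1, hx2, hx3⟩
    refine ⟨x, by simp [hx4], h.step hx hx1 hx2 hx3 fun a ha b hb => ?_⟩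
    have e1 : ∀ p : ℕ, (Exp.pair Vprv Vcur).eval (u.setv Vp p) = ((x * N + c : ℕ) : ℤ) :=
      fun p => Exp.eval_pair (by simp [u1, hN]) (by decide) (by simp [hx4]) (by simp [u1, hc])
    have e2 : ∀ p : ℕ, (Exp.pair Vcur Vprv).eval (u.setv Vp p) = ((c * N + x : ℕ) : ℤ) :=
      fun p => Exp.eval_pair (by simp [u1, hN]) (by decide) (by simp [u1, hc]) (by simp [hx4])
    have e3 : (u.v VNN).toNat = N * N := by rw [u1 _ (by decide), hNN]
    have e4 : a * N + b < N * N := mul_add_lt ha hb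
    have e5 : ∀ z < N, ∀ w < N, (a * N + b = z * N + w ↔ a = z ∧ b = w) := fun z _ w hw =>
      ⟨fun h => mul_add_inj hb hw h, by rintro ⟨rfl, rfl⟩; rfl⟩
    simp only [Cmd.eval_assign, Cmd.eval_gen, State.setv_a, State.seta_a, if_true, e3, e4,
      Exp.eval_add, Exp.eval_sub, Exp.eval_ite, Exp.pos_eval_eq, e1, e2, Exp.eval_var,
      State.setv_v, Nat.cast_inj, e5 x hx c h.lt, e5 c h.lt x hx, Exp.eval_arr,
      Int.toNat_natCast, u2, Exp.eval_one, Exp.eval_zero]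
  · refine ⟨c, by simp [hc], ?_⟩
    have := h.pos
    exact ⟨h.lt, h.pos, .inl (by omega), h.nonneg, h.cut_eq, h.eq⟩

/-- Search an augmenting path and send one unit of flow along it. -/
def augmentCmd : Cmd :=
  .seq reachCmd (.seq (.assign Vcur (0 - 1))
    (.seq (pick Vcur Vu VN (.and (.arr Alev (.var Vu)) (.arr Asnk (.var Vu))))
      (.ite (.le 0 (.var Vcur)) (.loop Vw VN backCmd) (.assign Vprv 0))))

/-- No arc of positive residual capacity leaves a set that is closed under reachability. -/
theorem Levels.separates {N : ℕ} {R : ℕ → ℕ → ℤ} {src snk L : ℕ → ℤ} (h : Levels N R src L)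
    (hR : ∀ x < N, ∀ y < N, 0 ≤ R x y) (hsnk : ∀ x < N, 0 < snk x → ¬ 0 < L x) :
    Separates N src snk ((range N).filter fun x => 0 < L x) ∧
      cut N R ((range N).filter fun x => 0 < L x) = 0 := by
  refine ⟨⟨fun x hx hs => ?_, fun x hx hs => ?_⟩, ?_⟩
  · simpa [hx] using h.start x hx hs
  · simpa [hx] using hsnk x hx hs
  · refine (cut_congr _ fun x hx y hy h1 h2 => ?_).trans (cut_zero N _)
    simp only [mem_filter, mem_range, hx, hy, true_and] at h1 h2
    have := hR x hx y hy
    have := mt (h.closed x hx y hy h1) h2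
    omega

/-- The correction in `Walked.cut_eq` is 0 at the starting sink, which lies outside `T`, and 1 at
the final source, which lies inside. So every separating cut loses exactly one unit. If no sink is
labelled, the labelled set has residual cut zero. -/
theorem augmentCmd_spec {s : State} {N : ℕ} (hN : s.v VN = N) (hNN : (s.v VNN).toNat = N * N)
    (hsrc : ∀ x < N, s.a Asrc x = 0 ∨ s.a Asrc x = 1)
    (hR : ∀ x < N, ∀ y < N, 0 ≤ s.a Ares (x * N + y)) :
    (∀ x < N, ∀ y < N, 0 ≤ (augmentCmd.eval s).a Ares (x * N + y)) ∧
    ((∀ T, Separates N (s.a Asrc) (s.a Asnk) T →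
        cut N (fun x y => (augmentCmd.eval s).a Ares (x * N + y)) T =
          cut N (fun x y => s.a Ares (x * N + y)) T - 1) ∨
      (augmentCmd.eval s).a Ares = s.a Ares ∧ ∃ T, Separates N (s.a Asrc) (s.a Asnk) T ∧
        cut N (fun x y => s.a Ares (x * N + y)) T = 0) := by
  have hL := reachCmd_spec hN hsrc
  unfold augmentCmd
  simp only [Cmd.eval_seq]
  have w1 : ∀ y, y ∉ reachCmd.vars → (reachCmd.eval s).v y = s.v y :=
    fun y hy => reachCmd.eval_v s hy
  have w2 : ∀ a, a ≠ Alev → (reachCmd.eval s).a a = s.a a := fun a ha =>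
    reachCmd.eval_a s (by simpa [reachCmd, Cmd.arrs] using ha)
  generalize reachCmd.eval s = w at hL w1 w2
  -- The value `-1` means that no labelled sink was found, since nodes are numbered from 0.
  generalize hw' : (Cmd.assign Vcur (0 - 1)).eval w = w'
  have w3 : ∀ y, y ≠ Vcur → w'.v y = w.v y := fun y hy => by rw [← hw']; simp [hy]
  have w4 : w'.a = w.a := by rw [← hw']; rfl
  have w5 : w'.v Vcur = -1 := by rw [← hw']; simp
  have hp := pick_spec (s := w') (N := N) (r := Vcur) (x := Vu) (n := VN)
    (e := .and (.arr Alev (.var Vu)) (.arr Asnk (.var Vu)))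
    (by rw [w3 _ (by decide), w1 _ (by decide), hN]) (by decide)
    (fun x => 0 < w.a Alev x ∧ 0 < s.a Asnk x) (by
      intro i hi t hv ha hi'
      simp [ha, hi', w4, w2])
  generalize hu : (pick _ _ _ _).eval w' = u at hp
  have u1 : ∀ y, y ≠ Vcur → u.v y = w'.v y := by
    intro y hy
    rw [← hu]
    exact Cmd.eval_v _ _ (by simpa [pick, Cmd.vars] using hy)
  have u2 : ∀ a, u.a a = w.a a := by
    intro a
    rw [← hu, ← w4]
    exact Cmd.eval_a _ _ (by simp [pick, Cmd.arrs])
  have hR' : (fun x y => u.a Ares (x * N + y)) = fun x y => s.a Ares (x * N + y) := by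
    rw [u2, w2 _ (by decide)]
  simp only [Cmd.eval_ite, Exp.pos_eval_le, Exp.eval_zero, Exp.eval_var]
  rcases hp with ⟨c, hc, ⟨hc1, hc2⟩, hc3⟩ | ⟨hnone, hcur⟩
  · rw [if_pos (by omega)]
    have e1 : u.v VN = N := by
      rw [u1 _ (by decide), w3 _ (by decide), w1 _ (by decide), hN]
    have e2 : (u.v VNN).toNat = N * N := by
      rw [u1 _ (by decide), w3 _ (by decide), w1 _ (by decide), hNN]
    have hwalk := Cmd.loop_induction (x := Vw) (n := VN) (c := backCmd) (s := u) (N := N)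
      (fun i t => ∃ c : ℕ, t.v Vcur = c ∧
        Walked N (fun x y => s.a Ares (x * N + y)) (s.a Asrc) (s.a Asnk) (w.a Alev)
          (fun x y => t.a Ares (x * N + y)) c i) (by simp [e1]) (by simp)
      (by
        refine ⟨c, hc3, hc, hc1, .inr (by simpa using hL.le c hc), ?_, fun T hT => ?_,
          fun _ _ _ _ _ _ => ?_⟩
        · rw [u2, w2 _ (by decide)]; exact hR
        · rw [hR', if_neg (hT.sink c hc hc2), sub_zero]
        · rw [u2, w2 _ (by decide)])
      (by
        rintro i hi t hv ha - ⟨c, hc, h⟩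
        have e3 : t.a Alev = w.a Alev := by rw [ha _ (by decide), u2]
        rw [← e3] at h hL ⊢
        exact backCmd_spec (by rw [hv _ (by decide) (by decide), e1])
          (by rw [hv _ (by decide) (by decide), e2]) hL hc h)
    obtain ⟨c, -, h⟩ := hwalk
    refine ⟨h.nonneg, .inl fun T hT => ?_⟩
    -- After `N` steps back, label plus `N` is at most `N + 1` unless the label is already 1.
    have h1 : w.a Alev c = 1 := by
      have := h.pos
      have := h.le
      omega
    rw [h.cut_eq T hT, if_pos (hT.source c h.lt (hL.one c h.lt h1))]
  · rw [if_neg (by omega)]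
    have e1 : ((Cmd.assign Vprv 0).eval u).a Ares = s.a Ares := by
      rw [Cmd.eval_assign, State.setv_a, u2, w2 _ (by decide)]
    rw [e1]
    refine ⟨hR, .inr ⟨rfl, _, hL.separates hR fun x hx h1 h2 => hnone x hx ⟨h2, h1⟩⟩⟩

/-! ### Minimum cuts by scaling -/

/-- Augment as often as there are pairs of nodes. -/
def augmentLoop : Cmd := .loop Vy VNN augmentCmd

/-- The cut of `T₀` starts at no more than `N * N` and loses a unit in each successful round, so `N
* N` rounds exhaust it unless some separating set reaches residual cut zero earlier. -/
theorem augmentLoop_spec {s : State} {N : ℕ} (hN : s.v VN = N) (hNN : (s.v VNN).toNat = N * N)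
    (hsrc : ∀ x < N, s.a Asrc x = 0 ∨ s.a Asrc x = 1)
    (hR : ∀ x < N, ∀ y < N, 0 ≤ s.a Ares (x * N + y)) {T₀ : Finset ℕ}
    (hT₀ : Separates N (s.a Asrc) (s.a Asnk) T₀)
    (hcut : cut N (fun x y => s.a Ares (x * N + y)) T₀ ≤ N * N) :
    (∀ x < N, ∀ y < N, 0 ≤ (augmentLoop.eval s).a Ares (x * N + y)) ∧
    (∃ F, ∀ T, Separates N (s.a Asrc) (s.a Asnk) T →
      cut N (fun x y => (augmentLoop.eval s).a Ares (x * N + y)) T =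
        cut N (fun x y => s.a Ares (x * N + y)) T - F) ∧
    ∃ T, Separates N (s.a Asrc) (s.a Asnk) T ∧
      cut N (fun x y => (augmentLoop.eval s).a Ares (x * N + y)) T = 0 := by
  have h := Cmd.loop_induction (x := Vy) (n := VNN) (c := augmentCmd) (s := s) (N := N * N)
    (fun m t => (∀ x < N, ∀ y < N, 0 ≤ t.a Ares (x * N + y)) ∧
      (∃ F, ∀ T, Separates N (s.a Asrc) (s.a Asnk) T →
        cut N (fun x y => t.a Ares (x * N + y)) T =
          cut N (fun x y => s.a Ares (x * N + y)) T - F) ∧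
      ((∃ T, Separates N (s.a Asrc) (s.a Asnk) T ∧
        cut N (fun x y => t.a Ares (x * N + y)) T = 0) ∨
        cut N (fun x y => t.a Ares (x * N + y)) T₀ ≤ N * N - m)) hNN (fun _ _ _ h => h)
    ⟨hR, ⟨0, fun T _ => by simp⟩, .inr (by simpa using hcut)⟩ (by
      rintro m hm t hv ha - ⟨h1, ⟨F, h2⟩, h3⟩
      have e1 : t.a Asrc = s.a Asrc := ha _ (by decide)
      have e2 : t.a Asnk = s.a Asnk := ha _ (by decide)
      have h := augmentCmd_spec (s := t) (by rw [hv _ (by decide) (by decide), hN])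
        (by rw [hv _ (by decide) (by decide), hNN]) (by rw [e1]; exact hsrc) h1
      rw [e1, e2] at h
      obtain ⟨h4, h5 | ⟨h5, h6⟩⟩ := h
      · refine ⟨h4, ⟨F + 1, fun T hT => by rw [h5 T hT, h2 T hT]; ring⟩, ?_⟩
        rcases h3 with ⟨T, hT, h3⟩ | h3
        -- With a zero cut present, a further augmentation would make it negative.
        · have := cut_nonneg h4 T
          rw [h5 T hT, h3] at this
          omega
        · right
          rw [h5 T₀ hT₀]
          push_cast
          linarith
      · rw [h5]
        exact ⟨h1, ⟨F, h2⟩, .inl h6⟩)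
  obtain ⟨h1, h2, h3⟩ := h
  refine ⟨h1, h2, h3.elim id fun h => ⟨T₀, hT₀, le_antisymm ?_ (cut_nonneg h1 T₀)⟩⟩
  push_cast at h
  rwa [sub_self] at h

/-- Double the flow, read another digit of the capacities, and augment. -/
def phaseCmd : Cmd :=
  .seq (.gen Ares Vp VNN (.arr Ares (.var Vp) + .arr Ares (.var Vp) +
      .ite (.le (.var Vpow) (.arr Acap (.var Vp))) 1 0))
  (.seq (.gen Acap Vp VNN (.ite (.le (.var Vpow) (.arr Acap (.var Vp)))
      (.arr Acap (.var Vp) - .var Vpow) (.arr Acap (.var Vp))))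
  (.seq (.assign Vpow (.half (.var Vpow))) augmentLoop))

/-- The situation when all but the last `j` binary digits of the capacities `C` have been read:
`S` are the capacities without their last `j` digits, `D` the rests, and `R` the residual
capacities. -/
structure Scaled (N : ℕ) (src snk : ℕ → ℤ) (C S D R : ℕ → ℕ → ℤ) (j : ℕ) : Prop where
  eq : ∀ x < N, ∀ y < N, C x y = S x y * 2 ^ j + D x y
  rest_nonneg : ∀ x < N, ∀ y < N, 0 ≤ D x y
  rest_lt : ∀ x < N, ∀ y < N, D x y < 2 ^ j
  nonneg : ∀ x < N, ∀ y < N, 0 ≤ R x y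
  flow : ∃ F, ∀ T, Separates N src snk T → cut N R T = cut N S T - F
  tight : ∃ T, Separates N src snk T ∧ cut N R T = 0

/-- Doubling all residual capacities keeps the tight cut at zero, and the new digits add at most one
for each pair of nodes. The tight set of the last phase thus satisfies the hypothesis of
`augmentLoop_spec`. -/
theorem phaseCmd_spec {s : State} {N : ℕ} (hN : s.v VN = N) (hNN : (s.v VNN).toNat = N * N)
    (hsrc : ∀ x < N, s.a Asrc x = 0 ∨ s.a Asrc x = 1) {j : ℕ} (hpow : s.v Vpow = 2 ^ j)
    {C : ℕ → ℕ → ℤ} (h : ∃ S, Scaled N (s.a Asrc) (s.a Asnk) C S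
      (fun x y => s.a Acap (x * N + y)) (fun x y => s.a Ares (x * N + y)) (j + 1)) :
    (∃ S, Scaled N (s.a Asrc) (s.a Asnk) C S
      (fun x y => (phaseCmd.eval s).a Acap (x * N + y))
      (fun x y => (phaseCmd.eval s).a Ares (x * N + y)) j) ∧
    (phaseCmd.eval s).v Vpow = 2 ^ j / 2 := by
  obtain ⟨S, h⟩ := h
  unfold phaseCmd
  simp only [Cmd.eval_seq]
  generalize hu : Cmd.eval (.assign _ _) _ = u
  have e4 : ∀ x < N, ∀ y < N, x * N + y < N * N := fun x hx y hy => mul_add_lt hx hy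
  have u1 : ∀ y, y ≠ Vpow → u.v y = s.v y := fun y hy => by rw [← hu]; simp [hy]
  have u2 : u.v Vpow = 2 ^ j / 2 := by rw [← hu]; simp [hpow]
  have u3 : ∀ x < N, ∀ y < N, u.a Ares (x * N + y) = s.a Ares (x * N + y) + s.a Ares (x * N + y) +
      if 2 ^ j ≤ s.a Acap (x * N + y) then 1 else 0 := fun x hx y hy => by
    rw [← hu]; simp [hNN, e4 x hx y hy, hpow]
  have u4 : ∀ x < N, ∀ y < N, u.a Acap (x * N + y) = if 2 ^ j ≤ s.a Acap (x * N + y) then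
      s.a Acap (x * N + y) - 2 ^ j else s.a Acap (x * N + y) := fun x hx y hy => by
    rw [← hu]; simp [hNN, e4 x hx y hy, hpow]
  have u5 : u.a Asrc = s.a Asrc := by rw [← hu]; simp
  have u6 : u.a Asnk = s.a Asnk := by rw [← hu]; simp
  have hcut : ∀ T, cut N (fun x y => u.a Ares (x * N + y)) T =
      cut N (fun x y => s.a Ares (x * N + y)) T + cut N (fun x y => s.a Ares (x * N + y)) T +
      cut N (fun x y => if 2 ^ j ≤ s.a Acap (x * N + y) then 1 else 0) T := by
    intro T
    rw [← cut_add, ← cut_add]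
    exact cut_congr T fun x hx y hy _ _ => u3 x hx y hy
  have hbit : ∀ T, cut N (fun x y => if 2 ^ j ≤ s.a Acap (x * N + y) then 1 else 0) T ≤ N * N :=
    cut_le_sq fun x _ y _ => by split_ifs <;> norm_num
  obtain ⟨T₀, hT₀, htight⟩ := h.tight
  obtain ⟨F, hF⟩ := h.flow
  have haug := augmentLoop_spec (s := u) (N := N) (by rw [u1 _ (by decide), hN])
    (by rw [u1 _ (by decide), hNN]) (by rw [u5]; exact hsrc) (fun x hx y hy => by
      rw [u3 x hx y hy]
      have := h.nonneg x hx y hy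
      split_ifs <;> omega) (T₀ := T₀) (by rw [u5, u6]; exact hT₀) (by
      rw [hcut, htight]
      simpa using hbit T₀)
  rw [u5, u6] at haug
  obtain ⟨h1, ⟨F', h2⟩, h3⟩ := haug
  have v1 : (augmentLoop.eval u).a Acap = u.a Acap := augmentLoop.eval_a _ (by decide)
  have v2 : (augmentLoop.eval u).v Vpow = u.v Vpow := augmentLoop.eval_v _ (by decide)
  -- The flow value doubles together with the capacities, and `F'` is what this phase adds.
  refine ⟨⟨fun x y => S x y + S x y + if 2 ^ j ≤ s.a Acap (x * N + y) then 1 else 0,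
    fun x hx y hy => ?_, fun x hx y hy => ?_, fun x hx y hy => ?_, h1,
    ⟨F + F + F', fun T hT => ?_⟩, h3⟩, by rw [v2, u2]⟩
  · have := h.eq x hx y hy
    simp only [v1, u4 x hx y hy]
    rw [this, pow_succ]
    split_ifs <;> ring
  · have := h.rest_nonneg x hx y hy
    simp only [v1, u4 x hx y hy]
    split_ifs <;> omega
  · have := h.rest_lt x hx y hy
    rw [pow_succ] at this
    simp only [v1, u4 x hx y hy]
    split_ifs <;> omega
  · rw [h2 T hT, hcut, hF T hT, cut_add, cut_add]
    ring

/-- Compute a minimum cut for the capacities in `Acap`. -/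
def mincutCmd : Cmd :=
  .seq (.gen Ares Vp VNN 0)
  (.seq (.assign Vpow 1)
  (.seq (.loop Va VK2 (.assign Vpow (.var Vpow + .var Vpow)))
  (.seq (.assign Vpow (.half (.var Vpow)))
  (.seq (.loop Va VK2 phaseCmd) reachCmd))))

/-- At first no digit has been read: prefixes and residual capacities are zero, and any separating
set is tight. After `K` phases the prefixes are the capacities, and residual cuts differ from true
cuts by one constant, so a zero residual cut is minimum. -/
theorem mincutCmd_spec {s : State} {N K : ℕ} (hN : s.v VN = N) (hNN : (s.v VNN).toNat = N * N)
    (hK : s.v VK2 = K) (hsrc : ∀ x < N, s.a Asrc x = 0 ∨ s.a Asrc x = 1)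
    (hcap : ∀ x < N, ∀ y < N, 0 ≤ s.a Acap (x * N + y))
    (hlt : ∀ x < N, ∀ y < N, s.a Acap (x * N + y) < 2 ^ K)
    {T₀ : Finset ℕ} (hT₀ : Separates N (s.a Asrc) (s.a Asnk) T₀) :
    ∃ T, Separates N (s.a Asrc) (s.a Asnk) T ∧
      (∀ x < N, x ∈ T ↔ 0 < (mincutCmd.eval s).a Alev x) ∧
      ∀ T', Separates N (s.a Asrc) (s.a Asnk) T' →
        cut N (fun x y => s.a Acap (x * N + y)) T ≤ cut N (fun x y => s.a Acap (x * N + y)) T' := by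
  unfold mincutCmd
  simp only [Cmd.eval_seq]
  generalize hu : Cmd.eval (.assign Vpow 1) _ = u
  have u1 : ∀ y, y ≠ Vpow → u.v y = s.v y := fun y hy => by rw [← hu]; simp [hy]
  have u2 : u.v Vpow = 1 := by rw [← hu]; simp
  have u3 : ∀ a, a ≠ Ares → u.a a = s.a a := fun a ha => by rw [← hu]; simp [ha]
  have u4 : ∀ x < N, ∀ y < N, u.a Ares (x * N + y) = 0 := fun x hx y hy => by
    rw [← hu]; simp [hNN, mul_add_lt hx hy]
  have hw := Cmd.loop_induction (x := Va) (n := VK2) (s := u) (N := K)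
    (c := .assign Vpow (.var Vpow + .var Vpow)) (fun i t => t.v Vpow = 2 ^ i)
    (by rw [u1 _ (by decide), hK]; simp) (by simp) (by simp [u2]) (by
      intro i _ t _ _ _ h
      simp [h, pow_succ]; ring)
  have w1 : ∀ y, y ≠ Vpow → (Cmd.eval (.loop Va VK2 (.assign Vpow (.var Vpow + .var Vpow))) u).v y =
      u.v y := fun y hy => Cmd.eval_v _ _ (by simpa [Cmd.vars] using hy)
  have w2 : (Cmd.eval (.loop Va VK2 (.assign Vpow (.var Vpow + .var Vpow))) u).a = u.a := by
    funext a
    exact Cmd.eval_a _ _ (by simp [Cmd.arrs])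
  generalize Cmd.eval (.loop Va VK2 (.assign _ _)) u = w at hw w1 w2
  generalize hw' : Cmd.eval (.assign _ _) w = w'
  have x1 : ∀ y, y ≠ Vpow → w'.v y = s.v y := fun y hy => by
    rw [← hw']; simp [hy, w1 y hy, u1 y hy]
  have x2 : w'.v Vpow = 2 ^ K / 2 := by rw [← hw']; simp [hw]
  have x3 : w'.a = u.a := by rw [← hw', ← w2]; simp
  have hph := Cmd.loop_induction (x := Va) (n := VK2) (s := w') (N := K) (c := phaseCmd)
    (fun i t => (∃ S, Scaled N (s.a Asrc) (s.a Asnk) (fun x y => s.a Acap (x * N + y)) S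
      (fun x y => t.a Acap (x * N + y)) (fun x y => t.a Ares (x * N + y)) (K - i)) ∧
      -- The weight of the next digit, written with a division so that it also covers the value 0
      -- after the last phase.
      t.v Vpow = 2 ^ (K - i) / 2) (by rw [x1 _ (by decide), hK]; simp) (by simp)
    (by
      refine ⟨⟨fun _ _ => 0, ?_⟩, by simp [x2]⟩
      rw [x3, u3 _ (by decide)]
      refine ⟨fun _ _ _ _ => by simp, hcap, by simpa using hlt, fun x hx y hy => (u4 x hx y hy).ge,
        ⟨0, fun T _ => ?_⟩, T₀, hT₀, ?_⟩
      · rw [sub_zero]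
        exact cut_congr T fun x hx y hy _ _ => u4 x hx y hy
      · rw [← cut_zero N T₀]
        exact cut_congr T₀ fun x hx y hy _ _ => u4 x hx y hy)
    (by
      rintro i hi t hv ha - ⟨h1, h2⟩
      have e1 : t.a Asrc = s.a Asrc := by rw [ha _ (by decide), x3, u3 _ (by decide)]
      have e2 : t.a Asnk = s.a Asnk := by rw [ha _ (by decide), x3, u3 _ (by decide)]
      rw [show K - i = K - (i + 1) + 1 by omega] at h1 h2
      have := phaseCmd_spec (s := t) (N := N) (j := K - (i + 1))
        (C := fun x y => s.a Acap (x * N + y))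
        (by rw [hv _ (by decide) (by decide), x1 _ (by decide), hN])
        (by rw [hv _ (by decide) (by decide), x1 _ (by decide), hNN])
        (by rw [e1]; exact hsrc) (by rw [h2, pow_succ]; simp) (by rw [e1, e2]; exact h1)
      rwa [e1, e2] at this)
  obtain ⟨⟨S, h⟩, -⟩ := hph
  rw [Nat.sub_self] at h
  have y1 : (Cmd.eval (.loop Va VK2 phaseCmd) w').v VN = N := by
    rw [Cmd.eval_v _ _ (by decide), x1 _ (by decide), hN]
  have y2 : (Cmd.eval (.loop Va VK2 phaseCmd) w').a Asrc = s.a Asrc := by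
    rw [Cmd.eval_a _ _ (by decide), x3, u3 _ (by decide)]
  generalize Cmd.eval (.loop Va VK2 phaseCmd) w' = z at h y1 y2
  have hL := reachCmd_spec y1 (by rw [y2]; exact hsrc)
  rw [y2] at hL
  obtain ⟨F, hF⟩ := h.flow
  have hSC : ∀ T, cut N S T = cut N (fun x y => s.a Acap (x * N + y)) T := fun T =>
    cut_congr T fun x hx y hy _ _ => by
      have h1 := h.eq x hx y hy
      have h2 := h.rest_nonneg x hx y hy
      have h3 := h.rest_lt x hx y hy
      rw [pow_zero] at h1 h3
      omega
  obtain ⟨T₁, hT₁, htight⟩ := h.tight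
  -- The tight set `T₁` is only known to exist. The set computed is that of the reachable nodes,
  -- which lies inside `T₁` because no residual arc leaves `T₁`; hence it contains no sink.
  have hreach : ∀ n : ℕ, ∀ x < N, (reachCmd.eval z).a Alev x ≤ n →
      0 < (reachCmd.eval z).a Alev x → x ∈ T₁ := by
    intro n
    induction n with
    | zero => intro x _ h1 h2; push_cast at h1; omega
    | succ n ih =>
      intro x hx h1 h2
      by_cases h3 : (reachCmd.eval z).a Alev x = 1
      · exact hT₁.source x hx (hL.one x hx h3)
      · obtain ⟨y, hy, h4, h5, h6⟩ := hL.pred x hx (by omega)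
        have hyT := ih y hy (by push_cast at h1; omega) h4
        by_contra hxT
        have hle : z.a Ares (y * N + x) ≤ cut N (fun x y => z.a Ares (x * N + y)) T₁ := by
          have h7 : ∀ a < N, ∀ b < N,
              (0 : ℤ) ≤ if a ∈ T₁ ∧ b ∉ T₁ then z.a Ares (a * N + b) else 0 := by
            intro a ha b hb
            split_ifs
            · exact h.nonneg a ha b hb
            · rfl
          unfold cut
          refine le_trans ?_ (single_le_sum (f := fun a => ∑ b ∈ range N,
            if a ∈ T₁ ∧ b ∉ T₁ then z.a Ares (a * N + b) else 0)
            (fun a ha => sum_nonneg fun b hb => h7 a (by simpa using ha) b (by simpa using hb))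
            (mem_range.2 hy))
          refine le_trans ?_ (single_le_sum (f := fun b =>
            if y ∈ T₁ ∧ b ∉ T₁ then z.a Ares (y * N + b) else 0)
            (fun b hb => h7 y hy b (by simpa using hb)) (mem_range.2 hx))
          simp [hyT, hxT]
        rw [htight] at hle
        exact absurd h6 (not_lt.2 hle)
  obtain ⟨hsep, hcut⟩ := hL.separates (snk := s.a Asnk) h.nonneg fun x hx h1 h2 =>
    hT₁.sink x hx h1 (hreach (N + 1) x hx (by exact_mod_cast hL.le x hx) h2)
  refine ⟨_, hsep, fun x hx => by simp [hx], fun T' hT' => ?_⟩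
  have h1 := hF _ hsep
  rw [hcut] at h1
  have h2 := hF _ hT'
  have h3 := cut_nonneg h.nonneg T'
  rw [← hSC, ← hSC]
  linarith

/-! ### Homomorphisms and cuts -/

/-- `h` is a homomorphism of the digraph `g` on `0, …, n - 1` to the digraph `H` on
`0, …, k - 1`. -/
def HomOn (n k : ℕ) (g H : ℕ → ℕ → Prop) (h : ℕ → ℕ) : Prop :=
  (∀ u < n, h u < k) ∧ ∀ u < n, ∀ v < n, g u v → H (h u) (h v)

/-- The mapping `f` is a homomorphism of minimum cost, provided that there is a homomorphism. -/
def Solves (n k : ℕ) (g H : ℕ → ℕ → Prop) (c : ℕ → ℕ → ℤ) (f : ℕ → ℕ) : Prop :=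
  (∀ u < n, f u < k) ∧ ∀ h, HomOn n k g H h →
    HomOn n k g H f ∧ ∑ u ∈ range n, c u (f u) ≤ ∑ u ∈ range n, c u (h u)

/-- If the tail of an arc is mapped to `a` or a larger vertex, then its head is mapped to `b` or
a larger vertex. -/
def Forward (H : ℕ → ℕ → Prop) (a b : ℕ) : Prop := ∀ i j, H i j → a ≤ i → b ≤ j

/-- If the head of an arc is mapped to `a` or a larger vertex, then its tail is mapped to `b` or
a larger vertex. -/
def Backward (H : ℕ → ℕ → Prop) (a b : ℕ) : Prop := ∀ i j, H i j → a ≤ j → b ≤ i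

/-- If `u` is mapped to `a` or a larger vertex, then `v` has to be mapped to `b` or a larger
vertex. -/
def Forced (g H : ℕ → ℕ → Prop) (u a v b : ℕ) : Prop :=
  (u = v ∧ b < a) ∨ (g u v ∧ Forward H a b) ∨ (g v u ∧ Backward H a b)

open Classical in
/-- The capacity of the arc from the node `(u, a)` to the node `(v, b)` of the network. -/
noncomputable def capacity (g H : ℕ → ℕ → Prop) (c : ℕ → ℕ → ℤ) (M : ℤ) (u a v b : ℕ) : ℤ :=
  (if u = v ∧ b = a + 1 then c u a else 0) + if Forced g H u a v b then M else 0

/-- `R` is the matrix of the capacities of the network with nodes `(u, a)` numbered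
`u * (k + 1) + a`. -/
def IsNetwork (n k : ℕ) (g H : ℕ → ℕ → Prop) (c : ℕ → ℕ → ℤ) (M : ℤ) (R : ℕ → ℕ → ℤ) : Prop :=
  ∀ u < n, ∀ a < k + 1, ∀ v < n, ∀ b < k + 1,
    R (u * (k + 1) + a) (v * (k + 1) + b) = capacity g H c M u a v b

theorem Forced.le_of_homOn {n k : ℕ} {g H : ℕ → ℕ → Prop} {h : ℕ → ℕ} (hh : HomOn n k g H h)
    {u a v b : ℕ} (hu : u < n) (hv : v < n) (hf : Forced g H u a v b) (ha : a ≤ h u) : b ≤ h v := by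
  rcases hf with ⟨rfl, h1⟩ | ⟨h1, h2⟩ | ⟨h1, h2⟩
  · omega
  · exact h2 _ _ (hh.2 u hu v hv h1) ha
  · exact h2 _ _ (hh.2 v hv u hu h1) ha

/-- For an arc `uv`, the threshold `f v + 1` is not implied by `f u`, so some arc of `H` starts at
or above `f u` and ends at or below `f v`. Dually, some arc starts at or below `f u` and ends at or
above `f v`. The interval property turns these two into the arc from `f u` to `f v`. -/
theorem homOn_of_forced {n k : ℕ} {g H : ℕ → ℕ → Prop} {f : ℕ → ℕ}
    (hH : ∀ i j i' j' x y, H i j → H i' j' → i' ≤ x → x ≤ i → j ≤ y → y ≤ j' → H x y)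
    (hf : ∀ u < n, f u < k)
    (hforced : ∀ u < n, ∀ a < k + 1, ∀ v < n, ∀ b < k + 1, Forced g H u a v b → a ≤ f u →
      b ≤ f v) : HomOn n k g H f := by
  refine ⟨hf, fun u hu v hv huv => ?_⟩
  have h1 : ¬ Forward H (f u) (f v + 1) := fun h => by
    -- As `f v < k`, the threshold `f v + 1` is still a node of the network.
    have := hforced u hu (f u) (by have := hf u hu; omega) v hv (f v + 1)
      (by have := hf v hv; omega) (.inr (.inl ⟨huv, h⟩)) le_rfl
    omega
  have h2 : ¬ Backward H (f v) (f u + 1) := fun h => by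
    have := hforced v hv (f v) (by have := hf v hv; omega) u hu (f u + 1)
      (by have := hf u hu; omega) (.inr (.inr ⟨huv, h⟩)) le_rfl
    omega
  simp only [Forward, Backward] at h1 h2
  push Not at h1 h2
  obtain ⟨i, j, hij, h3, h4⟩ := h1
  obtain ⟨i', j', hij', h5, h6⟩ := h2
  exact hH i j i' j' _ _ hij hij' (by omega) h3 (by omega) h5

theorem cut_eq_sum {n m : ℕ} (R : ℕ → ℕ → ℤ) (T : Finset ℕ) :
    cut (n * m) R T = ∑ u ∈ range n, ∑ a ∈ range m, ∑ v ∈ range n, ∑ b ∈ range m,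
      if u * m + a ∈ T ∧ v * m + b ∉ T then R (u * m + a) (v * m + b) else 0 := by
  unfold cut
  rw [sum_range_mul_add]
  refine sum_congr rfl fun u _ => sum_congr rfl fun a _ => ?_
  rw [sum_range_mul_add]

/-- No forced arc leaves `T`, so for each `u` the only contribution is the cost arc from `(u, f u)`
to `(u, f u + 1)`. -/
theorem cut_eq_cost {n k : ℕ} {g H : ℕ → ℕ → Prop} {c : ℕ → ℕ → ℤ} {M : ℤ} {R : ℕ → ℕ → ℤ}
    (hR : IsNetwork n k g H c M R) {f : ℕ → ℕ} (hf : ∀ u < n, f u < k)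
    (hforced : ∀ u < n, ∀ a < k + 1, ∀ v < n, ∀ b < k + 1, Forced g H u a v b → a ≤ f u →
      b ≤ f v) {T : Finset ℕ} (hT : ∀ u < n, ∀ a < k + 1, (u * (k + 1) + a ∈ T ↔ a ≤ f u)) :
    cut (n * (k + 1)) R T = ∑ u ∈ range n, c u (f u) := by
  rw [cut_eq_sum]
  refine sum_congr rfl fun u hu => ?_
  rw [mem_range] at hu
  have hfu := hf u hu
  have key : ∀ a < k + 1, ∀ v < n, ∀ b < k + 1,
      (if u * (k + 1) + a ∈ T ∧ v * (k + 1) + b ∉ T then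
        R (u * (k + 1) + a) (v * (k + 1) + b) else 0) =
      if u = v ∧ a = f u ∧ b = f u + 1 then c u (f u) else 0 := by
    intro a ha v hv b hb
    simp only [hT u hu a ha, hT v hv b hb]
    rw [hR u hu a ha v hv b hb, capacity]
    by_cases h : a ≤ f u ∧ ¬ b ≤ f v
    · rw [if_pos h, if_neg fun h' => h.2 (hforced u hu a ha v hv b hb h' h.1), add_zero]
      by_cases h1 : u = v ∧ b = a + 1
      · obtain ⟨rfl, rfl⟩ := h1
        have : a = f u := by omega
        rw [if_pos ⟨rfl, rfl⟩, if_pos ⟨rfl, this, by omega⟩, this]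
      · rw [if_neg h1, if_neg]
        rintro ⟨rfl, rfl, rfl⟩
        exact h1 ⟨rfl, rfl⟩
    · rw [if_neg h, if_neg]
      rintro ⟨rfl, rfl, rfl⟩
      exact h ⟨le_rfl, by omega⟩
  rw [sum_eq_single_of_mem (f u) (by simp; omega), sum_eq_single_of_mem u (by simpa using hu),
    sum_eq_single_of_mem (f u + 1) (by simp; omega)]
  · rw [key _ (by omega) u hu _ (by omega), if_pos ⟨rfl, rfl, rfl⟩]
  · intro b hb hne
    rw [key _ (by omega) u hu _ (by simpa using hb), if_neg fun h => hne h.2.2]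
  · intro v hv hne
    refine sum_eq_zero fun b hb => ?_
    rw [key _ (by omega) v (by simpa using hv) _ (by simpa using hb), if_neg fun h => hne h.1.symm]
  · intro a ha hne
    refine sum_eq_zero fun v hv => sum_eq_zero fun b hb => ?_
    rw [key _ (by simpa using ha) v (by simpa using hv) _ (by simpa using hb),
      if_neg fun h => hne h.2.1]

theorem capacity_nonneg {g H : ℕ → ℕ → Prop} {c : ℕ → ℕ → ℤ} {M : ℤ} {n k : ℕ}
    (hc : ∀ u < n, ∀ a < k, 0 ≤ c u a) (hM : 0 ≤ M) {u a v b : ℕ} (hu : u < n) (hb : b < k + 1) :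
    0 ≤ capacity g H c M u a v b := by
  unfold capacity
  refine add_nonneg ?_ ?_
  · split_ifs with h
    · exact hc u hu a (by omega)
    · rfl
  · split_ifs <;> omega

theorem exists_decode {n m x : ℕ} (hx : x < n * m) : ∃ u < n, ∃ a < m, x = u * m + a := by
  have hm : 0 < m := Nat.pos_of_ne_zero fun h => by simp [h] at hx
  exact ⟨x / m, Nat.div_lt_of_lt_mul (by rwa [mul_comm]), x % m, Nat.mod_lt _ hm,
    by rw [mul_comm, Nat.div_add_mod]⟩

theorem exists_threshold (P : ℕ → Prop) [DecidablePred P] {k : ℕ} (h0 : P 0) (hk : ¬ P k) :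
    1 ≤ ((range (k + 1)).filter P).card ∧ ((range (k + 1)).filter P).card ≤ k := by
  constructor
  · exact card_pos.2 ⟨0, by simpa using h0⟩
  · calc _ ≤ (range k).card := card_le_card fun a ha => ?_
      _ = k := card_range k
    simp only [mem_filter, mem_range] at ha ⊢
    have : a ≠ k := fun h => hk (h ▸ ha.2)
    omega

/-- A downward closed set is an initial segment, so its threshold can be found by counting. -/
theorem threshold_iff (P : ℕ → Prop) [DecidablePred P] {k : ℕ} (hk : ¬ P k)
    (hP : ∀ a < k + 1, ∀ b < a, P a → P b) :
    ∀ a < k + 1, P a ↔ a < ((range (k + 1)).filter P).card := by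
  have hex : ∃ m, ¬ P m := ⟨k, hk⟩
  have h1 : ∀ a < k + 1, P a ↔ a < Nat.find hex := fun a ha => by
    refine ⟨fun h => ?_, fun h => not_not.1 (Nat.find_min hex h)⟩
    by_contra hlt
    rcases (not_lt.1 hlt).lt_or_eq with h2 | h2
    · exact Nat.find_spec hex (hP a ha _ h2 h)
    · exact Nat.find_spec hex (h2 ▸ h)
  have h2 : (range (k + 1)).filter P = range (Nat.find hex) := by
    ext a
    simp only [mem_filter, mem_range]
    refine ⟨fun h => (h1 a h.1).1 h.2, fun h => ?_⟩
    have : a < k + 1 := h.trans_le ((Nat.find_min' hex hk).trans (Nat.le_succ k))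
    exact ⟨this, (h1 a this).2 h⟩
  rw [h2, card_range]
  exact h1

/-- A minimum cut of the network yields a homomorphism of minimum cost. -/
theorem solves_of_mincut {n k : ℕ} {g H : ℕ → ℕ → Prop} {c : ℕ → ℕ → ℤ} {M : ℤ} {R : ℕ → ℕ → ℤ}
    (hH : ∀ i j i' j' x y, H i j → H i' j' → i' ≤ x → x ≤ i → j ≤ y → y ≤ j' → H x y)
    (hR : IsNetwork n k g H c M R) (hc : ∀ u < n, ∀ a < k, 0 ≤ c u a)
    (hM : ∀ h : ℕ → ℕ, (∀ u < n, h u < k) → ∑ u ∈ range n, c u (h u) < M) {src snk : ℕ → ℤ}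
    (hsrc : ∀ u < n, ∀ a < k + 1, src (u * (k + 1) + a) = if a = 0 then 1 else 0)
    (hsnk : ∀ u < n, ∀ a < k + 1, snk (u * (k + 1) + a) = if a = k then 1 else 0) {T : Finset ℕ}
    (hT : Separates (n * (k + 1)) src snk T)
    (hmin : ∀ T', Separates (n * (k + 1)) src snk T' →
      cut (n * (k + 1)) R T ≤ cut (n * (k + 1)) R T') {f : ℕ → ℕ}
    (hf : ∀ u < n, f u + 1 = ((range (k + 1)).filter fun a => u * (k + 1) + a ∈ T).card) :
    Solves n k g H c f := by
  have h0 : ∀ u < n, u * (k + 1) + 0 ∈ T := fun u hu =>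
    hT.source _ (mul_add_lt hu (by omega)) (by rw [hsrc u hu 0 (by omega)]; simp)
  have hk : ∀ u < n, u * (k + 1) + k ∉ T := fun u hu =>
    hT.sink _ (mul_add_lt hu (by omega)) (by rw [hsnk u hu k (by omega)]; simp)
  have hfk : ∀ u < n, f u < k := fun u hu => by
    have := (exists_threshold (fun a => u * (k + 1) + a ∈ T) (h0 u hu) (hk u hu)).2
    rw [← hf u hu] at this
    omega
  refine ⟨hfk, fun h hh => ?_⟩
  -- The cut that encodes the competing homomorphism `h`; its capacity is the cost of `h`.
  let T' := (range (n * (k + 1))).filter fun x => x % (k + 1) ≤ h (x / (k + 1))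
  have hT' : ∀ u < n, ∀ a < k + 1, (u * (k + 1) + a ∈ T' ↔ a ≤ h u) := by
    intro u hu a ha
    have h1 : (u * (k + 1) + a) % (k + 1) = a := by
      rw [mul_comm, Nat.mul_add_mod, Nat.mod_eq_of_lt ha]
    have h2 : (u * (k + 1) + a) / (k + 1) = u := by
      rw [mul_comm, Nat.mul_add_div (by omega), Nat.div_eq_of_lt ha, add_zero]
    simp [T', h1, h2, mul_add_lt hu ha]
  have hsep : Separates (n * (k + 1)) src snk T' := by
    refine ⟨fun x hx hs => ?_, fun x hx hs => ?_⟩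
    · obtain ⟨u, hu, a, ha, rfl⟩ := exists_decode hx
      rw [hsrc u hu a ha] at hs
      rw [hT' u hu a ha]
      split_ifs at hs with h1
      · omega
      · omega
    · obtain ⟨u, hu, a, ha, rfl⟩ := exists_decode hx
      rw [hsnk u hu a ha] at hs
      rw [hT' u hu a ha]
      split_ifs at hs with h1
      · have := hh.1 u hu
        omega
      · omega
  have hcut' := cut_eq_cost hR hh.1
    (fun u hu a _ v hv b _ hf ha => hf.le_of_homOn hh hu hv ha) hT'
  have hM0 : 0 ≤ M := (sum_nonneg fun u hu =>
    hc u (by simpa using hu) _ (hh.1 u (by simpa using hu))).trans (hM h hh.1).le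
  have hlt : cut (n * (k + 1)) R T < M := (hmin T' hsep).trans_lt (by rw [hcut']; exact hM h hh.1)
  have hnn : ∀ u < n, ∀ a < k + 1, ∀ v < n, ∀ b < k + 1,
      0 ≤ if u * (k + 1) + a ∈ T ∧ v * (k + 1) + b ∉ T then
        R (u * (k + 1) + a) (v * (k + 1) + b) else 0 := by
    intro u hu a ha v hv b hb
    split_ifs
    · rw [hR u hu a ha v hv b hb]
      exact capacity_nonneg hc hM0 hu hb
    · rfl
  -- A single forced arc leaving `T` would cost at least `M`, more than the cut of `h`. This applies
  -- also to the arcs from `(u, a)` to lower thresholds, so `T` is downward closed for each `u`.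
  have hforced : ∀ u < n, ∀ a < k + 1, ∀ v < n, ∀ b < k + 1, Forced g H u a v b →
      u * (k + 1) + a ∈ T → v * (k + 1) + b ∈ T := by
    intro u hu a ha v hv b hb hF haT
    by_contra hbT
    refine absurd hlt (not_lt.2 ?_)
    have h1 : M ≤ if u * (k + 1) + a ∈ T ∧ v * (k + 1) + b ∉ T then
        R (u * (k + 1) + a) (v * (k + 1) + b) else 0 := by
      rw [if_pos ⟨haT, hbT⟩, hR u hu a ha v hv b hb, capacity, if_pos hF]
      refine le_add_of_nonneg_left ?_
      split_ifs with h
      · exact hc u hu a (by omega)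
      · rfl
    rw [cut_eq_sum]
    refine h1.trans ?_
    refine le_trans ?_ (single_le_sum (fun u hu => sum_nonneg fun a ha => sum_nonneg fun v hv =>
      sum_nonneg fun b hb => hnn u (by simpa using hu) a (by simpa using ha) v (by simpa using hv)
        b (by simpa using hb)) (mem_range.2 hu))
    refine le_trans ?_ (single_le_sum (fun a ha => sum_nonneg fun v hv =>
      sum_nonneg fun b hb => hnn u hu a (by simpa using ha) v (by simpa using hv)
        b (by simpa using hb)) (mem_range.2 ha))
    refine le_trans ?_ (single_le_sum (fun v hv =>
      sum_nonneg fun b hb => hnn u hu a ha v (by simpa using hv)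
        b (by simpa using hb)) (mem_range.2 hv))
    exact single_le_sum (f := fun b => if u * (k + 1) + a ∈ T ∧ v * (k + 1) + b ∉ T then
        R (u * (k + 1) + a) (v * (k + 1) + b) else 0)
      (fun b hb => hnn u hu a ha v hv b (by simpa using hb)) (mem_range.2 hb)
  have hTf : ∀ u < n, ∀ a < k + 1, (u * (k + 1) + a ∈ T ↔ a ≤ f u) := by
    intro u hu a ha
    rw [threshold_iff (fun a => u * (k + 1) + a ∈ T) (hk u hu)
      (fun a ha b hb h => hforced u hu a ha u hu b (hb.trans ha) (.inl ⟨rfl, hb⟩) h) a ha,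
      ← hf u hu]
    omega
  have hforced' : ∀ u < n, ∀ a < k + 1, ∀ v < n, ∀ b < k + 1, Forced g H u a v b → a ≤ f u →
      b ≤ f v := fun u hu a ha v hv b hb hF h =>
    (hTf v hv b hb).1 (hforced u hu a ha v hv b hb hF ((hTf u hu a ha).2 h))
  refine ⟨homOn_of_forced hH hfk hforced', ?_⟩
  rw [← hcut', ← cut_eq_cost hR hfk hforced' hTf]
  exact hmin T' hsep

/-! ### Solving the problem by a minimum cut -/

/-- The state `s` holds the digraph `g`, the parameters, an enumeration `o` of the vertices of the
target digraph, and integral costs. -/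
structure Prepared (s : State) (n k : ℕ) (g : ℕ → ℕ → Prop) (o : ℕ → ℕ) : Prop where
  n_eq : s.v Vn = n
  k_eq : s.v Vk = k
  nk_eq : s.v Vnk = (n * k : ℕ)
  nn_eq : s.v Vnn = (n * n : ℕ)
  k1_eq : s.v Vk1 = (k + 1 : ℕ)
  n1_eq : s.v Vn1 = (n + 1 : ℕ)
  N_eq : s.v VN = (n * (k + 1) : ℕ)
  NN_eq : s.v VNN = (n * (k + 1) * (n * (k + 1)) : ℕ)
  adj : ∀ u < n, ∀ v < n, (0 < s.a Ainp (1 + (u * n + v)) ↔ g u v)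
  ord : ∀ i < k, s.a Aord i = o i
  ord_lt : ∀ i < k, o i < k
  cost_nonneg : ∀ p < n * k, 0 ≤ s.a Acost p

theorem Prepared.congr {s t : State} {n k : ℕ} {g : ℕ → ℕ → Prop} {o : ℕ → ℕ}
    (h : Prepared s n k g o) (hv : ∀ x < 10, t.v x = s.v x) (h0 : t.a Ainp = s.a Ainp)
    (h1 : t.a Acost = s.a Acost) (h4 : t.a Aord = s.a Aord) : Prepared t n k g o := by
  refine ⟨?_, ?_, ?_, ?_, ?_, ?_, ?_, ?_, ?_, ?_, h.ord_lt, ?_⟩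
  · rw [hv _ (by norm_num), h.n_eq]
  · rw [hv _ (by norm_num), h.k_eq]
  · rw [hv _ (by norm_num), h.nk_eq]
  · rw [hv _ (by norm_num), h.nn_eq]
  · rw [hv _ (by norm_num), h.k1_eq]
  · rw [hv _ (by norm_num), h.n1_eq]
  · rw [hv _ (by norm_num), h.N_eq]
  · rw [hv _ (by norm_num), h.NN_eq]
  · rw [h0]; exact h.adj
  · rw [h4]; exact h.ord
  · rw [h1]; exact h.cost_nonneg

/-- The number `x * m + y`, where `m` is the value of the variable `n`. -/
def Exp.index (n : ℕ) (x y : Exp) : Exp := .sum Vz n x + y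

theorem Exp.eval_index {n m i j : ℕ} {x y : Exp} {s : State} (hm : s.v n = m)
    (hx : ∀ z : ℕ, x.eval (s.setv Vz z) = i) (hy : y.eval s = j) :
    (Exp.index n x y).eval s = ((i * m + j : ℕ) : ℤ) := by
  simp [Exp.index, hm, hx, hy, mul_comm]

/-- The truth value of `u = v ∧ b < a ∨ …`, see `Forced`. -/
def forcedExp : Exp :=
  .or (.and (.eq (.var Vu) (.var Vv)) (.lt (.var Vb) (.var Va)))
    (.or (.and (.arr Ainp (1 + .index Vn (.var Vu) (.var Vv)))
        (.arr Afwd (.index Vk1 (.var Va) (.var Vb))))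
      (.and (.arr Ainp (1 + .index Vn (.var Vv) (.var Vu)))
        (.arr Abwd (.index Vk1 (.var Va) (.var Vb)))))

/-- The capacity of the arc from `(u, a)` to `(v, b)`, see `capacity`. -/
def capacityExp : Exp :=
  .ite (.and (.eq (.var Vu) (.var Vv)) (.eq (.var Vb) (.var Va + 1)))
    (.arr Acost (.index Vk (.var Vu) (.arr Aord (.var Va)))) 0 + .ite forcedExp (.var Vinf) 0

/-- Build the network. -/
def networkCmd : Cmd :=
  .seq (.gen Asrc Vp VN (.ex Vu Vn (.eq (.var Vp) (.index Vk1 (.var Vu) 0))))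
  (.seq (.gen Asnk Vp VN (.ex Vu Vn (.eq (.var Vp) (.index Vk1 (.var Vu) (.var Vk)))))
  (.gen Acap Vp VNN (.sum Vu Vn (.sum Va Vk1 (.sum Vv Vn (.sum Vb Vk1
    (.ite (.eq (.var Vp) (.sum Vw VN (.index Vk1 (.var Vu) (.var Va)) +
      .index Vk1 (.var Vv) (.var Vb))) capacityExp 0)))))))

theorem Exp.eval_ex (x n : ℕ) (e : Exp) (s : State)
    (h : ∀ i < (s.v n).toNat, ∀ j < (s.v n).toNat, 0 < e.eval (s.setv x i) →
      0 < e.eval (s.setv x j) → i = j) :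
    (Exp.ex x n e).eval s = 0 ∨ (Exp.ex x n e).eval s = 1 := by
  simp only [Exp.ex, eval_sum, eval_ite, eval_one, eval_zero]
  by_cases hex : ∃ i < (s.v n).toNat, 0 < e.eval (s.setv x i)
  · obtain ⟨i, hi, hpos⟩ := hex
    right
    rw [sum_eq_single_of_mem i (by simpa using hi), if_pos hpos]
    intro j hj hne
    rw [if_neg]
    intro h'
    exact hne (h j (by simpa using hj) i hi h' hpos)
  · left
    push Not at hex
    exact sum_eq_zero fun i hi => if_neg (not_lt.2 (hex i (by simpa using hi)))

/-- At most one `u` passes the test, so the count of witnesses is exactly 0 or 1, as `reachCmd_spec`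
demands of the source marks. -/
theorem marks_spec {s : State} {n k j : ℕ} (hn : s.v Vn = n) (hk1 : s.v Vk1 = (k + 1 : ℕ))
    (hj : j < k + 1) (e : Exp) (he : ∀ p u : ℕ, e.eval ((s.setv Vp p).setv Vu u) = j) :
    ∀ u < n, ∀ a < k + 1, (Exp.ex Vu Vn (.eq (.var Vp) (.index Vk1 (.var Vu) e))).eval
      (s.setv Vp (u * (k + 1) + a : ℕ)) = if a = j then 1 else 0 := by
  intro u hu a ha
  have h1 : ∀ p v : ℕ, (Exp.index Vk1 (.var Vu) e).eval ((s.setv Vp p).setv Vu v) =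
      ((v * (k + 1) + j : ℕ) : ℤ) := fun p v =>
    Exp.eval_index (by simp [hk1]) (by simp) (he p v)
  have h2 : ∀ p v : ℕ, (0 < (Exp.eq (.var Vp) (.index Vk1 (.var Vu) e)).eval
      ((s.setv Vp p).setv Vu v)) ↔ p = v * (k + 1) + j := fun p v => by
    rw [Exp.pos_eval_eq, h1, ← Nat.cast_inj (R := ℤ)]
    simp
  have h3 := Exp.eval_ex Vu Vn (.eq (.var Vp) (.index Vk1 (.var Vu) e))
    (s.setv Vp (u * (k + 1) + a : ℕ)) (by
      intro v _ w _ hv hw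
      rw [h2] at hv hw
      exact (mul_add_inj hj hj (hv.symm.trans hw)).1)
  have h4 := Exp.pos_eval_ex Vu Vn (.eq (.var Vp) (.index Vk1 (.var Vu) e))
    (s.setv Vp (u * (k + 1) + a : ℕ))
  simp only [h2] at h4
  split_ifs with h
  · have : 0 < (Exp.ex Vu Vn (.eq (.var Vp) (.index Vk1 (.var Vu) e))).eval
        (s.setv Vp (u * (k + 1) + a : ℕ)) := h4.2 ⟨u, by simp [hn, hu], by rw [h]⟩
    omega
  · have : ¬ 0 < (Exp.ex Vu Vn (.eq (.var Vp) (.index Vk1 (.var Vu) e))).eval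
        (s.setv Vp (u * (k + 1) + a : ℕ)) := fun h' => by
      obtain ⟨v, -, hv⟩ := h4.1 h'
      exact h (mul_add_inj ha hj hv).2
    omega

theorem capacityExp_spec {s : State} {n k : ℕ} {g : ℕ → ℕ → Prop} {o : ℕ → ℕ}
    (hs : Prepared s n k g o) {H : ℕ → ℕ → Prop}
    (hfwd : ∀ a < k + 1, ∀ b < k + 1, (0 < s.a Afwd (a * (k + 1) + b) ↔ Forward H a b))
    (hbwd : ∀ a < k + 1, ∀ b < k + 1, (0 < s.a Abwd (a * (k + 1) + b) ↔ Backward H a b))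
    {u a v b : ℕ} (hu : u < n) (ha : a < k + 1) (hv : v < n) (hb : b < k + 1)
    (eu : s.v Vu = u) (ea : s.v Va = a) (ev : s.v Vv = v) (eb : s.v Vb = b) :
    capacityExp.eval s =
      capacity g H (fun u i => s.a Acost (u * k + o i)) (s.v Vinf) u a v b := by
  have h1 : (Exp.index Vn (.var Vu) (.var Vv)).eval s = ((u * n + v : ℕ) : ℤ) :=
    Exp.eval_index hs.n_eq (by simp [eu]) (by simp [ev])
  have h2 : (Exp.index Vn (.var Vv) (.var Vu)).eval s = ((v * n + u : ℕ) : ℤ) :=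
    Exp.eval_index hs.n_eq (by simp [ev]) (by simp [eu])
  have h3 : (Exp.index Vk1 (.var Va) (.var Vb)).eval s = ((a * (k + 1) + b : ℕ) : ℤ) :=
    Exp.eval_index hs.k1_eq (by simp [ea]) (by simp [eb])
  have h4 : ∀ z : ℕ, ((1 : ℤ) + (z : ℤ)).toNat = 1 + z := fun z => by omega
  have h5 : 0 < forcedExp.eval s ↔ Forced g H u a v b := by
    simp only [forcedExp, Exp.pos_eval_or, Exp.pos_eval_and, Exp.pos_eval_eq, Exp.pos_eval_lt,
      Exp.eval_arr, Exp.eval_add, Exp.eval_one, h1, h2, h3, h4, Int.toNat_natCast, Exp.eval_var,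
      eu, ev, ea, eb, hs.adj u hu v hv, hs.adj v hv u hu, hfwd a ha b hb, hbwd a ha b hb, Forced]
    norm_cast
  have h6 : 0 < (Exp.and (.eq (.var Vu) (.var Vv)) (.eq (.var Vb) (.var Va + 1))).eval s ↔
      u = v ∧ b = a + 1 := by
    simp only [Exp.pos_eval_and, Exp.pos_eval_eq, Exp.eval_add, Exp.eval_one, Exp.eval_var,
      eu, ev, ea, eb]
    norm_cast
  simp only [capacityExp, capacity, Exp.eval_add, Exp.eval_ite, h5, h6, Exp.eval_zero]
  congr 1
  · split_ifs with h
    · have h7 : (Exp.index Vk (.var Vu) (.arr Aord (.var Va))).eval s = ((u * k + o a : ℕ) : ℤ) :=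
        Exp.eval_index hs.k_eq (by simp [eu]) (by simp [ea, hs.ord a (by omega)])
      rw [Exp.eval_arr, h7, Int.toNat_natCast]
    · rfl
  · by_cases h : Forced g H u a v b
    · rw [if_pos (h5.2 h), if_pos h, Exp.eval_var]
    · rw [if_neg (mt h5.1 h), if_neg h]

/-- Instead of decoding an index into `(u, a, v, b)` by division, the program sums over all
quadruples. Uniqueness of the mixed radix representation leaves one nonzero term. -/
theorem networkCmd_spec {s : State} {n k : ℕ} {g : ℕ → ℕ → Prop} {o : ℕ → ℕ}
    (hs : Prepared s n k g o) {H : ℕ → ℕ → Prop}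
    (hfwd : ∀ a < k + 1, ∀ b < k + 1, (0 < s.a Afwd (a * (k + 1) + b) ↔ Forward H a b))
    (hbwd : ∀ a < k + 1, ∀ b < k + 1, (0 < s.a Abwd (a * (k + 1) + b) ↔ Backward H a b)) :
    IsNetwork n k g H (fun u i => s.a Acost (u * k + o i)) (s.v Vinf)
      (fun x y => (networkCmd.eval s).a Acap (x * (n * (k + 1)) + y)) ∧
    (∀ u < n, ∀ a < k + 1, (networkCmd.eval s).a Asrc (u * (k + 1) + a) =
      if a = 0 then 1 else 0) ∧
    (∀ u < n, ∀ a < k + 1, (networkCmd.eval s).a Asnk (u * (k + 1) + a) =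
      if a = k then 1 else 0) := by
  unfold networkCmd
  simp only [Cmd.eval_seq]
  rw [Cmd.eval_gen Asrc]
  generalize ht : State.seta s Asrc _ = t
  have t1 : t.v = s.v := by rw [← ht]; rfl
  have t2 : ∀ a, a ≠ Asrc → t.a a = s.a a := fun a ha => by rw [← ht]; simp [ha]
  have t3 : ∀ u < n, ∀ a < k + 1, t.a Asrc (u * (k + 1) + a) = if a = 0 then 1 else 0 := by
    intro u hu a ha
    rw [← marks_spec hs.n_eq hs.k1_eq (Nat.succ_pos k) 0 (by simp) u hu a ha, ← ht, State.seta_a,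
      if_pos rfl, if_pos (by rw [hs.N_eq, Int.toNat_natCast]; exact mul_add_lt hu ha)]
  rw [Cmd.eval_gen Asnk]
  generalize hw : State.seta t Asnk _ = w
  have w1 : w.v = s.v := by rw [← hw, ← t1]; rfl
  have w2 : ∀ a, a ≠ Asrc → a ≠ Asnk → w.a a = s.a a := fun a ha ha' => by
    rw [← hw, ← t2 a ha]; simp [ha']
  have w3 : w.a Asrc = t.a Asrc := by rw [← hw]; simp
  have w4 : ∀ u < n, ∀ a < k + 1, w.a Asnk (u * (k + 1) + a) = if a = k then 1 else 0 := by
    intro u hu a ha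
    rw [← marks_spec (s := t) (by rw [t1, hs.n_eq]) (by rw [t1, hs.k1_eq]) (Nat.lt_succ_self k)
      (.var Vk) (by simp [t1, hs.k_eq]) u hu a ha, ← hw, State.seta_a, if_pos rfl,
      if_pos (by rw [t1, hs.N_eq, Int.toNat_natCast]; exact mul_add_lt hu ha)]
  have hsw : Prepared w n k g o := hs.congr (fun x _ => by rw [w1]) (w2 _ (by decide) (by decide))
    (w2 _ (by decide) (by decide)) (w2 _ (by decide) (by decide))
  refine ⟨?_, by simpa [w3] using t3, by simpa using w4⟩
  intro u hu a ha v hv b hb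
  have hN := mul_add_lt (mul_add_lt hu ha) (mul_add_lt hv hb)
  rw [Cmd.eval_gen, State.seta_a, if_pos rfl]
  beta_reduce
  rw [if_pos (by rw [hsw.NN_eq, Int.toNat_natCast]; exact hN)]
  set p := (u * (k + 1) + a) * (n * (k + 1)) + (v * (k + 1) + b) with hp
  have key : ∀ u' < n, ∀ a' < k + 1, ∀ v' < n, ∀ b' < k + 1,
      (Exp.ite (.eq (.var Vp) (.sum Vw VN (.index Vk1 (.var Vu) (.var Va)) +
        .index Vk1 (.var Vv) (.var Vb))) capacityExp 0).eval
        (((((w.setv Vp p).setv Vu u').setv Va a').setv Vv v').setv Vb b') =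
      if u = u' ∧ a = a' ∧ v = v' ∧ b = b' then
        capacity g H (fun u i => s.a Acost (u * k + o i)) (s.v Vinf) u a v b else 0 := by
    intro u' hu' a' ha' v' hv' b' hb'
    generalize hz : (((((w.setv Vp p).setv Vu u').setv Va a').setv Vv v').setv Vb b') = z
    have hsz : Prepared z n k g o := hsw.congr
      (fun x hx => by rw [← hz]; simp only [State.setv_v]; rw [if_neg, if_neg, if_neg, if_neg,
        if_neg] <;> omega) (by rw [← hz]; simp) (by rw [← hz]; simp) (by rw [← hz]; simp)
    have z1 : z.v Vp = p := by rw [← hz]; simp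
    have z2 : z.v Vu = u' := by rw [← hz]; simp
    have z3 : z.v Va = a' := by rw [← hz]; simp
    have z4 : z.v Vv = v' := by rw [← hz]; simp
    have z5 : z.v Vb = b' := by rw [← hz]; simp
    have z6 : z.v Vinf = s.v Vinf := by rw [← hz]; simp [w1]
    have z7 : ∀ a, a ≠ Asrc → a ≠ Asnk → z.a a = s.a a := fun a ha ha' => by
      rw [← w2 a ha ha', ← hz]; simp
    have i1 : ∀ y : ℕ, (Exp.index Vk1 (.var Vu) (.var Va)).eval (z.setv Vw y) =
        ((u' * (k + 1) + a' : ℕ) : ℤ) := fun y =>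
      Exp.eval_index (by simp [hsz.k1_eq]) (by simp [z2]) (by simp [z3])
    have i2 : (Exp.index Vk1 (.var Vv) (.var Vb)).eval z = ((v' * (k + 1) + b' : ℕ) : ℤ) :=
      Exp.eval_index hsz.k1_eq (by simp [z4]) (by simp [z5])
    have i3 : (Exp.sum Vw VN (.index Vk1 (.var Vu) (.var Va)) +
        .index Vk1 (.var Vv) (.var Vb)).eval z =
        (((u' * (k + 1) + a') * (n * (k + 1)) + (v' * (k + 1) + b') : ℕ) : ℤ) := by
      simp only [Exp.eval_add, Exp.eval_sum, i1, i2, hsz.N_eq, Int.toNat_natCast, sum_const,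
        card_range, nsmul_eq_mul]
      push_cast
      ring
    have i4 : 0 < (Exp.eq (.var Vp) (.sum Vw VN (.index Vk1 (.var Vu) (.var Va)) +
        .index Vk1 (.var Vv) (.var Vb))).eval z ↔ u = u' ∧ a = a' ∧ v = v' ∧ b = b' := by
      rw [Exp.pos_eval_eq, i3, Exp.eval_var, z1, Nat.cast_inj, hp]
      constructor
      · intro h
        obtain ⟨h1, h2⟩ := mul_add_inj (mul_add_lt hv hb) (mul_add_lt hv' hb') h
        obtain ⟨h3, h4⟩ := mul_add_inj ha ha' h1
        obtain ⟨h5, h6⟩ := mul_add_inj hb hb' h2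
        exact ⟨h3, h4, h5, h6⟩
      · rintro ⟨rfl, rfl, rfl, rfl⟩
        rfl
    rw [Exp.eval_ite]
    simp only [i4, Exp.eval_zero]
    split_ifs with h
    · obtain ⟨rfl, rfl, rfl, rfl⟩ := h
      have := capacityExp_spec hsz (H := H) (by rw [z7 _ (by decide) (by decide)]; exact hfwd)
        (by rw [z7 _ (by decide) (by decide)]; exact hbwd) hu ha hv hb z2 z3 z4 z5
      rwa [z6, z7 _ (by decide) (by decide)] at this
    · rfl
  have hn : ∀ t : State, t.v Vn = s.v Vn → (t.v Vn).toNat = n := fun t h => by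
    rw [h, hs.n_eq]; simp
  have hk : ∀ t : State, t.v Vk1 = s.v Vk1 → (t.v Vk1).toNat = k + 1 := fun t h => by
    rw [h, hs.k1_eq]; simp
  rw [Exp.eval_sum, hn _ (by simp [w1]), sum_eq_single_of_mem u (by simpa using hu), Exp.eval_sum,
    hk _ (by simp [w1]), sum_eq_single_of_mem a (by simpa using ha), Exp.eval_sum,
    hn _ (by simp [w1]), sum_eq_single_of_mem v (by simpa using hv), Exp.eval_sum,
    hk _ (by simp [w1]), sum_eq_single_of_mem b (by simpa using hb),
    key u hu a ha v hv b hb, if_pos ⟨rfl, rfl, rfl, rfl⟩]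
  · intro b' hb' hne
    rw [key u hu a ha v hv b' (by simpa using hb'), if_neg fun h => hne h.2.2.2.symm]
  · intro v' hv' hne
    rw [Exp.eval_sum, hk _ (by simp [w1])]
    refine sum_eq_zero fun b' hb' => ?_
    rw [key u hu a ha v' (by simpa using hv') b' (by simpa using hb'),
      if_neg fun h => hne h.2.2.1.symm]
  · intro a' ha' hne
    rw [Exp.eval_sum, hn _ (by simp [w1])]
    refine sum_eq_zero fun v' hv' => ?_
    rw [Exp.eval_sum, hk _ (by simp [w1])]
    refine sum_eq_zero fun b' hb' => ?_
    rw [key u hu a' (by simpa using ha') v' (by simpa using hv') b' (by simpa using hb'),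
      if_neg fun h => hne h.2.1.symm]
  · intro u' hu' hne
    rw [Exp.eval_sum, hk _ (by simp [w1])]
    refine sum_eq_zero fun a' ha' => ?_
    rw [Exp.eval_sum, hn _ (by simp [w1])]
    refine sum_eq_zero fun v' hv' => ?_
    rw [Exp.eval_sum, hk _ (by simp [w1])]
    refine sum_eq_zero fun b' hb' => ?_
    rw [key u' (by simpa using hu') a' (by simpa using ha') v' (by simpa using hv') b'
      (by simpa using hb'), if_neg fun h => hne h.1.symm]

/-- Solve the problem for a target digraph with an ordering as in `exists_ordering`. -/
def acyclicCmd : Cmd :=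
  .seq networkCmd (.seq mincutCmd
    (.gen Asol Vu Vn (.sum Va Vk1 (.ite (.arr Alev (.index Vk1 (.var Vu) (.var Va))) 1 0) - 1)))

theorem acyclicCmd_spec {s : State} {n k K : ℕ} {g : ℕ → ℕ → Prop} {o : ℕ → ℕ} (hk : 0 < k)
    (hs : Prepared s n k g o) (hK : s.v VK2 = K) {H : ℕ → ℕ → Prop}
    (hH : ∀ i j i' j' x y, H i j → H i' j' → i' ≤ x → x ≤ i → j ≤ y → y ≤ j' → H x y)
    (hfwd : ∀ a < k + 1, ∀ b < k + 1, (0 < s.a Afwd (a * (k + 1) + b) ↔ Forward H a b))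
    (hbwd : ∀ a < k + 1, ∀ b < k + 1, (0 < s.a Abwd (a * (k + 1) + b) ↔ Backward H a b))
    (hinf : s.v Vinf = 1 + ∑ p ∈ range (n * k), s.a Acost p) (hinfK : 2 * s.v Vinf ≤ 2 ^ K) :
    ∃ f : ℕ → ℕ, (∀ u < n, (acyclicCmd.eval s).a Asol u = f u) ∧
      Solves n k g H (fun u i => s.a Acost (u * k + o i)) f := by
  obtain ⟨h1, h2, h3⟩ := networkCmd_spec hs hfwd hbwd
  unfold acyclicCmd
  simp only [Cmd.eval_seq]
  have t1 : ∀ x, (networkCmd.eval s).v x = s.v x := fun x => networkCmd.eval_v s (by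
    simp [networkCmd, Cmd.vars])
  have t2 : (networkCmd.eval s).a Acost = s.a Acost := networkCmd.eval_a s (by decide)
  generalize networkCmd.eval s = t at h1 h2 h3 t1 t2
  have hc0 : ∀ u < n, ∀ i < k, 0 ≤ s.a Acost (u * k + o i) := fun u hu i hi =>
    hs.cost_nonneg _ (mul_add_lt hu (hs.ord_lt i hi))
  have hsum0 : 0 ≤ ∑ p ∈ range (n * k), s.a Acost p :=
    sum_nonneg fun p hp => hs.cost_nonneg p (by simpa using hp)
  have hcM : ∀ u < n, ∀ i < k, s.a Acost (u * k + o i) < s.v Vinf := fun u hu i hi => by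
    have := single_le_sum (f := s.a Acost) (fun p hp => hs.cost_nonneg p (by simpa using hp))
      (mem_range.2 (mul_add_lt hu (hs.ord_lt i hi)))
    omega
  have hM0 : 0 < s.v Vinf := by omega
  have hcap : ∀ x < n * (k + 1), ∀ y < n * (k + 1), 0 ≤ t.a Acap (x * (n * (k + 1)) + y) ∧
      t.a Acap (x * (n * (k + 1)) + y) < 2 ^ K := by
    intro x hx y hy
    obtain ⟨u, hu, a, ha, rfl⟩ := exists_decode hx
    obtain ⟨v, hv, b, hb, rfl⟩ := exists_decode hy
    have := h1 u hu a ha v hv b hb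
    simp only at this
    rw [this]
    refine ⟨capacity_nonneg hc0 hM0.le hu hb, ?_⟩
    refine lt_of_lt_of_le ?_ hinfK
    rw [two_mul]
    unfold capacity
    -- The cost part is below `Vinf` and the forced part at most `Vinf`, whence the factor 2 in the
    -- bound on digits.
    refine add_lt_add_of_lt_of_le ?_ ?_
    · split_ifs with h
      · exact hcM u hu a (by omega)
      · exact hM0
    · split_ifs
      · exact le_rfl
      · exact hM0.le
  -- The sources alone form a separating set: they have level 0, the sinks level `k`, and `k` is
  -- positive.
  have hsep : Separates (n * (k + 1)) (t.a Asrc) (t.a Asnk)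
      ((range (n * (k + 1))).filter fun x => 0 < t.a Asrc x) := by
    refine ⟨fun x hx h => by simp [hx, h], fun x hx h h' => ?_⟩
    obtain ⟨u, hu, a, ha, rfl⟩ := exists_decode hx
    simp only [mem_filter] at h'
    rw [h2 u hu a ha] at h'
    rw [h3 u hu a ha] at h
    have ha0 : a = 0 := by
      by_contra h0
      simp [h0] at h'
    rw [if_neg (by omega)] at h
    omega
  obtain ⟨T, hT, hTlev, hmin⟩ := mincutCmd_spec (s := t) (N := n * (k + 1)) (K := K)
    (by rw [t1, hs.N_eq]) (by rw [t1, hs.NN_eq, Int.toNat_natCast]) (by rw [t1, hK])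
    (fun x hx => by
      obtain ⟨u, hu, a, ha, rfl⟩ := exists_decode hx
      rw [h2 u hu a ha]
      split_ifs <;> simp) (fun x hx y hy => (hcap x hx y hy).1) (fun x hx y hy => (hcap x hx y hy).2)
    hsep
  have w1 : ∀ x < 10, (mincutCmd.eval t).v x = s.v x := fun x hx => by
    rw [mincutCmd.eval_v, t1]
    intro hmem
    have : ∀ y ∈ mincutCmd.vars, ¬ y < 10 := by decide
    exact this x hmem hx
  generalize mincutCmd.eval t = w at hTlev w1
  let cnt : ℕ → ℕ := fun u => ((range (k + 1)).filter fun a => u * (k + 1) + a ∈ T).card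
  have hcnt : ∀ u < n, 1 ≤ cnt u := fun u hu => card_pos.2 ⟨0, by
    simp only [mem_filter, mem_range]
    exact ⟨Nat.succ_pos k, hT.source _ (mul_add_lt hu (Nat.succ_pos k))
      (by rw [h2 u hu 0 (Nat.succ_pos k)]; simp)⟩⟩
  -- The threshold set is `{0, …, f u}`, so its size exceeds `f u` by one. It contains 0, so the
  -- subtraction is not truncated.
  refine ⟨fun u => cnt u - 1, fun u hu => ?_, ?_⟩
  · have e1 : (w.v Vn).toNat = n := by rw [w1 _ (by norm_num), hs.n_eq]; simp
    have e2 : w.v Vk1 = (k + 1 : ℕ) := by rw [w1 _ (by norm_num), hs.k1_eq]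
    have e3 : ∀ a : ℕ, (Exp.index Vk1 (.var Vu) (.var Va)).eval ((w.setv Vu u).setv Va a) =
        ((u * (k + 1) + a : ℕ) : ℤ) := fun a =>
      Exp.eval_index (by simp [e2]) (by simp) (by simp)
    rw [Cmd.eval_gen, State.seta_a, if_pos rfl, e1, if_pos hu]
    simp only [Exp.eval_sub, Exp.eval_sum, Exp.eval_ite, Exp.eval_arr, e3, Exp.eval_one,
      Exp.eval_zero, State.setv_a, Int.toNat_natCast]
    have e4 : ((w.setv Vu u).v Vk1).toNat = k + 1 := by simp [e2]
    rw [e4, Nat.cast_sub (hcnt u hu)]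
    congr 1
    simp only [cnt, card_filter]
    push_cast
    refine sum_congr rfl fun a ha => ?_
    have := hTlev _ (mul_add_lt hu (by simpa using ha : a < k + 1))
    by_cases h : u * (k + 1) + a ∈ T
    · rw [if_pos (this.1 h), if_pos h]
    · rw [if_neg (mt this.2 h), if_neg h]
  · refine solves_of_mincut hH h1 hc0 (fun h hh => ?_) h2 h3 hT hmin fun u hu => ?_
    · rw [hinf, sum_range_mul_add, add_comm]
      refine Int.lt_add_one_iff.2 (sum_le_sum fun u hu => ?_)
      have hu : u < n := by simpa using hu
      exact single_le_sum (f := fun j => s.a Acost (u * k + j))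
        (fun j hj => hs.cost_nonneg _ (mul_add_lt hu (by simpa using hj)))
        (mem_range.2 (hs.ord_lt _ (hh u hu)))
    · have := hcnt u hu
      show cnt u - 1 + 1 = cnt u
      omega

/-! ### Homomorphisms to a directed cycle -/

/-- The arcs of the directed cycle on `0, …, k - 1`. -/
def CycleArc (k i j : ℕ) : Prop := i < k ∧ j < k ∧ (k : ℤ) ∣ i + 1 - j

/-- Reduction modulo `k` of a number between `-k` and `2 * k - 1`. -/
def reduce (k z : ℤ) : ℤ := if z < 0 then z + k else if z < k then z else z - k

theorem reduce_nonneg {k z : ℤ} (h : -k ≤ z) : 0 ≤ reduce k z := by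
  unfold reduce; split_ifs <;> omega

theorem reduce_lt {k z : ℤ} (h : z < 2 * k) : reduce k z < k := by
  unfold reduce; split_ifs <;> omega

theorem dvd_reduce_sub (k z : ℤ) : k ∣ reduce k z - z := by
  unfold reduce
  split_ifs
  · exact ⟨1, by ring⟩
  · exact ⟨0, by ring⟩
  · exact ⟨-1, by ring⟩

theorem eq_of_dvd_sub {k a b : ℤ} (ha : 0 ≤ a) (hak : a < k) (hb : 0 ≤ b) (hbk : b < k)
    (h : k ∣ a - b) : a = b := by
  have := Int.eq_zero_of_abs_lt_dvd h (abs_lt.2 ⟨by omega, by omega⟩)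
  omega

/-- `comp` and `off` describe a partition into classes on which every homomorphism to the directed
cycle is determined by its value on one vertex; the ends of the arcs in `g` that satisfy `P` are in
the same class. -/
structure Merged (n k : ℕ) (g : ℕ → ℕ → Prop) (P : ℕ → ℕ → Prop) (comp off : ℕ → ℤ) : Prop where
  comp_nonneg : ∀ w < n, 0 ≤ comp w
  comp_lt : ∀ w < n, comp w < n
  off_nonneg : ∀ w < n, 0 ≤ off w
  off_lt : ∀ w < n, off w < k
  shift : ∀ h, HomOn n k g (CycleArc k) h →
    ∃ τ : ℤ → ℤ, ∀ w < n, (k : ℤ) ∣ off w + τ (comp w) - h w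
  same : ∀ u < n, ∀ v < n, P u v → g u v → comp u = comp v

/-- Any homomorphism satisfies `h v ≡ h u + 1`, so the class of `v` can adopt the shift of the class
of `u` once its offsets are corrected by `off u + 1 - off v`; the same `τ` still works. An arc with
contradictory offsets inside one class needs no special treatment: it excludes homomorphisms, and
`shift` becomes vacuous. -/
theorem Merged.step {n k : ℕ} {g : ℕ → ℕ → Prop} {P : ℕ → ℕ → Prop} {comp off comp' off' : ℕ → ℤ}
    (h : Merged n k g P comp off) {u v : ℕ} (hu : u < n) (hv : v < n) (huv : g u v)
    (hcomp : ∀ w < n, comp' w = if comp w = comp v then comp u else comp w)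
    (hoff : ∀ w < n, off' w = if comp w = comp v then reduce k (off w + (off u + 1 - off v))
      else off w) :
    Merged n k g (fun x y => P x y ∨ (x = u ∧ y = v)) comp' off' := by
  have hu0 := h.off_nonneg u hu
  have hu1 := h.off_lt u hu
  have hv0 := h.off_nonneg v hv
  have hv1 := h.off_lt v hv
  refine ⟨fun w hw => ?_, fun w hw => ?_, fun w hw => ?_, fun w hw => ?_, fun f hf => ?_,
    fun x hx y hy hP hxy => ?_⟩
  · rw [hcomp w hw]; split_ifs
    · exact h.comp_nonneg u hu
    · exact h.comp_nonneg w hw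
  · rw [hcomp w hw]; split_ifs
    · exact h.comp_lt u hu
    · exact h.comp_lt w hw
  · have := h.off_nonneg w hw
    rw [hoff w hw]; split_ifs
    · exact reduce_nonneg (by omega)
    · exact this
  · have := h.off_lt w hw
    rw [hoff w hw]; split_ifs
    · exact reduce_lt (by omega)
    · exact this
  · obtain ⟨τ, hτ⟩ := h.shift f hf
    refine ⟨τ, fun w hw => ?_⟩
    rw [hcomp w hw, hoff w hw]
    split_ifs with hc
    · have h1 := hτ w hw
      have h2 := hτ u hu
      have h3 := hτ v hv
      have h4 := (hf.2 u hu v hv huv).2.2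
      have h5 := dvd_reduce_sub k (off w + (off u + 1 - off v))
      rw [hc] at h1
      rw [show reduce k (off w + (off u + 1 - off v)) + τ (comp u) - f w =
        (reduce k (off w + (off u + 1 - off v)) - (off w + (off u + 1 - off v)) +
          (off w + τ (comp v) - f w - (off v + τ (comp v) - f v))) +
          (off u + τ (comp u) - f u + (f u + 1 - f v)) by ring]
      exact dvd_add (dvd_add h5 (dvd_sub h1 h3)) (dvd_add h2 h4)
    · exact hτ w hw
  · rw [hcomp x hx, hcomp y hy]
    rcases hP with hP | ⟨rfl, rfl⟩
    · rw [h.same x hx y hy hP hxy]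
    · rw [if_pos rfl]
      split_ifs <;> rfl

/-- `reduce` as an expression. -/
def reduceExp (e : Exp) : Exp :=
  .ite (.lt e 0) (e + .var Vk) (.ite (.lt e (.var Vk)) e (e - .var Vk))

@[simp] theorem eval_reduceExp (e : Exp) (s : State) :
    (reduceExp e).eval s = reduce (s.v Vk) (e.eval s) := by
  simp [reduceExp, reduce]

/-- Merge the classes of `u` and `v`, where `uv` is an arc. -/
def mergeCmd : Cmd :=
  .seq (.assign Vcur (.arr Acomp (.var Vu)))
  (.seq (.assign Vprv (.arr Acomp (.var Vv)))
  (.seq (.assign Vy (.arr Aoff (.var Vu) + 1 - .arr Aoff (.var Vv)))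
  (.seq (.gen Aoff Vw Vn (.ite (.eq (.arr Acomp (.var Vw)) (.var Vprv))
    (reduceExp (.arr Aoff (.var Vw) + .var Vy)) (.arr Aoff (.var Vw))))
  (.gen Acomp Vw Vn (.ite (.eq (.arr Acomp (.var Vw)) (.var Vprv)) (.var Vcur)
    (.arr Acomp (.var Vw)))))))

theorem mergeCmd_spec {t : State} {n k : ℕ} (hn : t.v Vn = n) (hk : t.v Vk = k)
    {g : ℕ → ℕ → Prop} {P : ℕ → ℕ → Prop} (h : Merged n k g P (t.a Acomp) (t.a Aoff)) {u v : ℕ}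
    (hu : u < n) (hv : v < n) (eu : t.v Vu = u) (ev : t.v Vv = v) (huv : g u v) :
    Merged n k g (fun x y => P x y ∨ (x = u ∧ y = v)) ((mergeCmd.eval t).a Acomp)
      ((mergeCmd.eval t).a Aoff) := by
  refine h.step hu hv huv (fun w hw => ?_) (fun w hw => ?_)
  · simp [mergeCmd, hn, eu, ev, hw]
  · simp [mergeCmd, hn, hk, eu, ev, hw]

theorem Merged.mono {n k : ℕ} {g : ℕ → ℕ → Prop} {P Q : ℕ → ℕ → Prop} {comp off : ℕ → ℤ}
    (h : Merged n k g P comp off) (hPQ : ∀ u < n, ∀ v < n, g u v → Q u v → P u v) :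
    Merged n k g Q comp off :=
  ⟨h.comp_nonneg, h.comp_lt, h.off_nonneg, h.off_lt, h.shift,
    fun u hu v hv hQ huv => h.same u hu v hv (hPQ u hu v hv huv hQ) huv⟩

/-- Merge the classes of the ends of all arcs. -/
def classesCmd : Cmd :=
  .seq (.gen Acomp Vp Vn (.var Vp))
  (.seq (.gen Aoff Vp Vn 0)
  (.loop Vu Vn (.loop Vv Vn
    (.ite (.arr Ainp (1 + .index Vn (.var Vu) (.var Vv))) mergeCmd (.assign Vprv 0)))))

theorem classesCmd_spec {s : State} {n k : ℕ} {g : ℕ → ℕ → Prop} {o : ℕ → ℕ} (hk : 0 < k)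
    (hs : Prepared s n k g o) :
    Merged n k g (fun _ _ => True) ((classesCmd.eval s).a Acomp) ((classesCmd.eval s).a Aoff) := by
  unfold classesCmd
  simp only [Cmd.eval_seq]
  generalize ht : Cmd.eval (.gen Aoff Vp Vn 0) _ = t
  have t1 : t.v = s.v := by rw [← ht]; rfl
  have t2 : t.a Ainp = s.a Ainp := by rw [← ht]; simp
  have t3 : ∀ w < n, t.a Acomp w = w := fun w hw => by rw [← ht]; simp [hs.n_eq, hw]
  have t4 : ∀ w < n, t.a Aoff w = 0 := fun w hw => by rw [← ht]; simp [hs.n_eq, hw]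
  have h := Cmd.loop_induction (x := Vu) (n := Vn) (s := t) (N := n)
    (c := .loop Vv Vn
      (.ite (.arr Ainp (1 + .index Vn (.var Vu) (.var Vv))) mergeCmd (.assign Vprv 0)))
    (fun i r => Merged n k g (fun u _ => u < i) (r.a Acomp) (r.a Aoff))
    (by rw [t1, hs.n_eq]; simp) (fun _ _ _ h => h)
    (by
      refine ⟨fun w hw => ?_, fun w hw => ?_, fun w hw => ?_, fun w hw => ?_, fun f hf => ?_,
        fun u _ v _ h => absurd h (Nat.not_lt_zero u)⟩
      · rw [t3 w hw]; omega
      · rw [t3 w hw]; omega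
      · rw [t4 w hw]
      · rw [t4 w hw]; omega
      -- Initially each vertex is its own class with offset 0, and its shift is its image.
      · refine ⟨fun z => f z.toNat, fun w hw => ?_⟩
        rw [t3 w hw, t4 w hw]
        simp)
    (by
      intro u hu r hv ha hru hr
      refine (Cmd.loop_induction (x := Vv) (n := Vn) (s := r) (N := n)
        (fun j q => Merged n k g (fun x y => x < u ∨ (x = u ∧ y < j)) (q.a Acomp) (q.a Aoff))
        (by rw [hv _ (by decide) (by decide), t1, hs.n_eq]; simp) (fun _ _ _ h => h)
        (hr.mono fun x _ y _ _ h => by omega) ?_).mono (fun x _ y hy _ h => by omega)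
      intro v hvn q hv' ha' hqv hq
      have q1 : q.v Vu = u := by rw [hv' _ (by decide) (by decide), hru]
      have q2 : q.v Vn = n := by
        rw [hv' _ (by decide) (by decide), hv _ (by decide) (by decide), t1, hs.n_eq]
      have q3 : q.v Vk = k := by
        rw [hv' _ (by decide) (by decide), hv _ (by decide) (by decide), t1, hs.k_eq]
      have q4 : q.a Ainp = s.a Ainp := by
        rw [ha' _ (by decide), ha _ (by decide), t2]
      have q5 : (Exp.index Vn (.var Vu) (.var Vv)).eval q = ((u * n + v : ℕ) : ℤ) :=
        Exp.eval_index q2 (by simp [q1]) (by simp [hqv])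
      have q6 : ((1 : ℤ) + ((u * n + v : ℕ) : ℤ)).toNat = 1 + (u * n + v) := by omega
      have q7 : 0 < (Exp.arr Ainp (1 + .index Vn (.var Vu) (.var Vv))).eval q ↔ g u v := by
        rw [Exp.eval_arr, Exp.eval_add, Exp.eval_one, q5, q6, q4, hs.adj u hu v hvn]
      rw [Cmd.eval_ite]
      by_cases hg : g u v
      · rw [if_pos (q7.2 hg)]
        exact (mergeCmd_spec q2 q3 hq hu hvn q1 hqv hg).mono fun x _ y _ _ h => by omega
      · rw [if_neg (mt q7.1 hg), Cmd.eval_assign, State.setv_a]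
        refine hq.mono fun x _ y _ hxy h => ?_
        by_contra hne
        have h1 : x = u := by omega
        have h2 : y = v := by omega
        exact hg (h1 ▸ h2 ▸ hxy))
  exact h.mono fun x hx _ _ _ _ => hx

/-- The cost of the class `Vp` if it is shifted by `e`. -/
def shiftCost (e : Exp) : Exp :=
  .sum Vw Vn (.ite (.eq (.arr Acomp (.var Vw)) (.var Vp))
    (.arr Acost (.index Vk (.var Vw) (.arr Aord (reduceExp (.arr Aoff (.var Vw) + e))))) 0)

/-- Solve the problem for a directed cycle. -/
def cycleCmd : Cmd :=
  .seq classesCmd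
  (.seq (.gen Aaux Vp Vn 0)
  (.seq (.loop Vi Vk (.gen Aaux Vp Vn
    (.ite (.lt (shiftCost (.var Vi)) (shiftCost (.arr Aaux (.var Vp)))) (.var Vi)
      (.arr Aaux (.var Vp)))))
  (.gen Asol Vw Vn (reduceExp (.arr Aoff (.var Vw) + .arr Aaux (.arr Acomp (.var Vw)))))))

theorem shiftCost_spec {t : State} {n k : ℕ} {g : ℕ → ℕ → Prop} {o : ℕ → ℕ}
    (hs : Prepared t n k g o) (hoff : ∀ w < n, 0 ≤ t.a Aoff w) (hoffk : ∀ w < n, t.a Aoff w < k)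
    (e : Exp) {z : ℤ} (hz : 0 ≤ z) (hzk : z < k) (he : ∀ w : ℕ, e.eval (t.setv Vw w) = z) :
    (shiftCost e).eval t = ∑ w ∈ range n, if t.a Acomp w = t.v Vp then
      t.a Acost (w * k + o (reduce k (t.a Aoff w + z)).toNat) else 0 := by
  simp only [shiftCost, Exp.eval_sum, hs.n_eq, Int.toNat_natCast]
  refine sum_congr rfl fun w hw => ?_
  have hw : w < n := by simpa using hw
  have h0 := hoff w hw
  have h1 := hoffk w hw
  have hr0 : 0 ≤ reduce k (t.a Aoff w + z) := reduce_nonneg (by omega)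
  have hr1 : reduce k (t.a Aoff w + z) < k := reduce_lt (by omega)
  have h2 : (Exp.index Vk (.var Vw) (.arr Aord (reduceExp (.arr Aoff (.var Vw) + e)))).eval
      (t.setv Vw w) = ((w * k + o (reduce k (t.a Aoff w + z)).toNat : ℕ) : ℤ) :=
    Exp.eval_index (by simp [hs.k_eq]) (by simp)
      (by simp [hs.k_eq, he, hs.ord _ (show (reduce k (t.a Aoff w + z)).toNat < k by omega)])
  simp only [Exp.eval_ite, Exp.pos_eval_eq, Exp.eval_arr, h2, Int.toNat_natCast, Exp.eval_var,
    State.setv_v, State.setv_a, if_true, Nat.reduceEqDiff, if_false, Exp.eval_zero]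

/-- The total cost splits over the classes, and every homomorphism amounts to one shift per class,
so choosing the cheapest of the `k` shifts in each class is optimal. If some homomorphism exists,
any choice of shifts gives one. -/
theorem cycleCmd_spec {s : State} {n k : ℕ} {g : ℕ → ℕ → Prop} {o : ℕ → ℕ} (hk : 0 < k)
    (hs : Prepared s n k g o) :
    ∃ f : ℕ → ℕ, (∀ u < n, (cycleCmd.eval s).a Asol u = f u) ∧
      Solves n k g (CycleArc k) (fun u i => s.a Acost (u * k + o i)) f := by
  have hm := classesCmd_spec hk hs
  unfold cycleCmd
  simp only [Cmd.eval_seq]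
  generalize hu : Cmd.eval (.gen Aaux Vp Vn 0) _ = u
  have u1 : ∀ x, x < 10 → u.v x = s.v x := fun x hx => by
    rw [← hu, Cmd.eval_gen, State.seta_v]
    refine classesCmd.eval_v s fun hmem => ?_
    have : ∀ y ∈ classesCmd.vars, ¬ y < 10 := by decide
    exact this x hmem hx
  have u2 : ∀ a, a ∉ classesCmd.arrs → a ≠ Aaux → u.a a = s.a a := fun a ha ha' => by
    rw [← hu, Cmd.eval_gen, State.seta_a, if_neg ha', classesCmd.eval_a s ha]
  have u3 : u.a Acomp = (classesCmd.eval s).a Acomp := by rw [← hu]; simp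
  have u4 : u.a Aoff = (classesCmd.eval s).a Aoff := by rw [← hu]; simp
  have u5 : ∀ w < n, u.a Aaux w = 0 := fun w hw => by
    have : (classesCmd.eval s).v Vn = n := by rw [classesCmd.eval_v _ (by decide), hs.n_eq]
    rw [← hu]; simp [this, hw]
  rw [← u3, ← u4] at hm
  have hsu : Prepared u n k g o := hs.congr u1 (u2 _ (by decide) (by decide))
    (u2 _ (by decide) (by decide)) (u2 _ (by decide) (by decide))
  have u6 : u.a Acost = s.a Acost := u2 _ (by decide) (by decide)
  let cost : ℤ → ℤ → ℤ := fun r z => ∑ w ∈ range n, if u.a Acomp w = r then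
      s.a Acost (w * k + o (reduce k (u.a Aoff w + z)).toNat) else 0
  generalize hC : Cmd.loop _ _ _ = C
  have hloop : ∀ r < n, 0 ≤ (C.eval u).a Aaux r ∧ (C.eval u).a Aaux r < k ∧
      ∀ z : ℕ, z < k → cost r ((C.eval u).a Aaux r) ≤ cost r z := by
    rw [← hC]
    refine Cmd.loop_induction (N := k) (fun i t => ∀ r < n, 0 ≤ t.a Aaux r ∧ t.a Aaux r < k ∧
      ∀ z : ℕ, z < i → cost r (t.a Aaux r) ≤ cost r z) (by simp [hsu.k_eq]) (fun _ _ _ h => h)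
      (fun r hr => ?_) ?_
    · rw [u5 r hr]
      exact ⟨le_rfl, by exact_mod_cast hk, fun z hz => absurd hz (Nat.not_lt_zero z)⟩
    · intro i hi t hv ha ht h r hr
      have e1 : ∀ x < 10, (t.setv Vp r).v x = u.v x := fun x hx => by
        rw [State.setv_v, if_neg (by omega), hv x (by omega) (by simp [Cmd.vars])]
      have e2 : ∀ a, a ≠ Aaux → t.a a = u.a a := fun a ha' =>
        ha a (by simpa [Cmd.arrs] using ha')
      have hst : Prepared (t.setv Vp r) n k g o := hsu.congr e1 (e2 _ (by decide))
        (e2 _ (by decide)) (e2 _ (by decide))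
      obtain ⟨h1, h2, h3⟩ := h r hr
      have e3 := shiftCost_spec hst (by rw [State.setv_a, e2 _ (by decide)]; exact hm.off_nonneg)
        (by rw [State.setv_a, e2 _ (by decide)]; exact hm.off_lt) (.var Vi) (z := i) (by omega)
        (by omega) (fun w => by simp [ht])
      have e4 := shiftCost_spec hst (by rw [State.setv_a, e2 _ (by decide)]; exact hm.off_nonneg)
        (by rw [State.setv_a, e2 _ (by decide)]; exact hm.off_lt) (.arr Aaux (.var Vp)) h1 h2
        (fun w => by simp)
      have e5 : (shiftCost (.var Vi)).eval (t.setv Vp r) = cost r i := by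
        rw [e3]
        simp only [State.setv_a, State.setv_v, if_true, e2 Acomp (by decide),
          e2 Aoff (by decide), e2 Acost (by decide), u6, cost]
      have e6 : (shiftCost (.arr Aaux (.var Vp))).eval (t.setv Vp r) = cost r (t.a Aaux r) := by
        rw [e4]
        simp only [State.setv_a, State.setv_v, if_true, e2 Acomp (by decide),
          e2 Aoff (by decide), e2 Acost (by decide), u6, cost]
      have e7 : (t.v Vn).toNat = n := by
        have := hst.n_eq
        rw [State.setv_v, if_neg (by decide)] at this
        rw [this, Int.toNat_natCast]
      have e8 : (Cmd.eval (.gen Aaux Vp Vn (.ite (.lt (shiftCost (.var Vi))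
          (shiftCost (.arr Aaux (.var Vp)))) (.var Vi) (.arr Aaux (.var Vp)))) t).a Aaux r =
          if cost r i < cost r (t.a Aaux r) then (i : ℤ) else t.a Aaux r := by
        rw [Cmd.eval_gen, State.seta_a, if_pos rfl, e7, if_pos hr, Exp.eval_ite]
        simp only [Exp.pos_eval_lt, e5, e6]
        simp [ht]
      rw [e8]
      split_ifs with hlt
      · refine ⟨by omega, by omega, fun z hz => ?_⟩
        rcases Nat.lt_succ_iff_lt_or_eq.1 hz with hz | rfl
        · exact hlt.le.trans (h3 z hz)
        · exact le_rfl
      · refine ⟨h1, h2, fun z hz => ?_⟩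
        rcases Nat.lt_succ_iff_lt_or_eq.1 hz with hz | rfl
        · exact h3 z hz
        · exact not_lt.1 hlt
  have w1 : ∀ x, (C.eval u).v x = u.v x := fun x => C.eval_v u (by rw [← hC]; simp [Cmd.vars])
  have w2 : ∀ a, a ≠ Aaux → (C.eval u).a a = u.a a := fun a ha =>
    C.eval_a u (by rw [← hC]; simpa [Cmd.arrs] using ha)
  generalize C.eval u = w at hloop w1 w2
  have hcl : ∀ x < n, (u.a Acomp x).toNat < n ∧ ((u.a Acomp x).toNat : ℤ) = u.a Acomp x :=
    fun x hx => by
      have := hm.comp_nonneg x hx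
      have := hm.comp_lt x hx
      omega
  have hS : ∀ x < n, 0 ≤ w.a Aaux (u.a Acomp x).toNat ∧ w.a Aaux (u.a Acomp x).toNat < k :=
    fun x hx => ⟨(hloop _ (hcl x hx).1).1, (hloop _ (hcl x hx).1).2.1⟩
  let F : ℕ → ℤ := fun x => reduce k (u.a Aoff x + w.a Aaux (u.a Acomp x).toNat)
  have hF : ∀ x < n, 0 ≤ F x ∧ F x < k := fun x hx => by
    have := hm.off_nonneg x hx
    have := hm.off_lt x hx
    have := hS x hx
    exact ⟨reduce_nonneg (by omega), reduce_lt (by omega)⟩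
  refine ⟨fun x => (F x).toNat, fun x hx => ?_, fun x hx => ?_, fun h hh => ⟨⟨fun x hx => ?_,
    fun x hx y hy hxy => ?_⟩, ?_⟩⟩
  · rw [Int.toNat_of_nonneg (hF x hx).1]
    simp [w1, hsu.n_eq, hsu.k_eq, hx, w2, F]
  · have := hF x hx
    show (F x).toNat < k
    omega
  · have := hF x hx
    show (F x).toNat < k
    omega
  · have h1 := hF x hx
    have h2 := hF y hy
    show CycleArc k (F x).toNat (F y).toNat
    refine ⟨by omega, by omega, ?_⟩
    rw [Int.toNat_of_nonneg h1.1, Int.toNat_of_nonneg h2.1]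
    -- The given homomorphism `h` certifies that the offsets grow by one modulo `k` along the arc;
    -- both ends are in the same class and receive the same shift.
    obtain ⟨τ, hτ⟩ := hm.shift h hh
    have h3 := hτ x hx
    have h4 := hτ y hy
    have h5 := (hh.2 x hx y hy hxy).2.2
    have h6 := dvd_reduce_sub k (u.a Aoff x + w.a Aaux (u.a Acomp x).toNat)
    have h7 := dvd_reduce_sub k (u.a Aoff y + w.a Aaux (u.a Acomp y).toNat)
    have h8 := hm.same x hx y hy trivial hxy
    rw [h8] at h3 h6
    simp only [F]
    rw [h8, show reduce k (u.a Aoff x + w.a Aaux (u.a Acomp y).toNat) + 1 -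
      reduce k (u.a Aoff y + w.a Aaux (u.a Acomp y).toNat) =
      ((reduce k (u.a Aoff x + w.a Aaux (u.a Acomp y).toNat) -
          (u.a Aoff x + w.a Aaux (u.a Acomp y).toNat)) -
        (reduce k (u.a Aoff y + w.a Aaux (u.a Acomp y).toNat) -
          (u.a Aoff y + w.a Aaux (u.a Acomp y).toNat))) +
      ((u.a Aoff x + τ (u.a Acomp y) - h x) - (u.a Aoff y + τ (u.a Acomp y) - h y) +
        (h x + 1 - h y)) by ring]
    exact dvd_add (dvd_sub h6 h7) (dvd_add (dvd_sub h3 h4) h5)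
  · obtain ⟨τ, hτ⟩ := hm.shift h hh
    -- Exchange the summations over vertices and classes: each vertex is charged to its own class
    -- only.
    have hexch : ∀ z : ℕ → ℤ, ∑ x ∈ range n, s.a Acost (x * k +
        o (reduce k (u.a Aoff x + z (u.a Acomp x).toNat)).toNat) =
        ∑ r ∈ range n, cost r (z r) := by
      intro z
      simp only [cost]
      rw [sum_comm]
      refine sum_congr rfl fun x hx => ?_
      have hx : x < n := by simpa using hx
      rw [sum_eq_single_of_mem (u.a Acomp x).toNat (by simpa using (hcl x hx).1)]
      · rw [if_pos (hcl x hx).2.symm]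
      · intro r _ hne
        rw [if_neg]
        intro h'
        exact hne (by omega)
    have hk' : (0 : ℤ) < k := by exact_mod_cast hk
    -- Reducing the shifts `τ` modulo `k` recovers `h` exactly, so its cost is among those compared.
    have hh' : ∀ x < n, reduce k (u.a Aoff x + τ ((u.a Acomp x).toNat : ℕ) % k) = h x := by
      intro x hx
      have h1 := hm.off_nonneg x hx
      have h2 := hm.off_lt x hx
      have h3 := Int.emod_nonneg (τ (u.a Acomp x)) hk'.ne'
      have h4 := Int.emod_lt_of_pos (τ (u.a Acomp x)) hk'
      rw [(hcl x hx).2]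
      refine eq_of_dvd_sub (k := k) (reduce_nonneg (by omega)) (reduce_lt (by omega)) (by omega)
        (by exact_mod_cast hh.1 x hx) ?_
      have h5 := dvd_reduce_sub k (u.a Aoff x + τ (u.a Acomp x) % k)
      have h6 : (k : ℤ) ∣ τ (u.a Acomp x) % k - τ (u.a Acomp x) :=
        ⟨-(τ (u.a Acomp x) / k), by rw [Int.emod_def]; ring⟩
      rw [show reduce k (u.a Aoff x + τ (u.a Acomp x) % k) - h x =
        (reduce k (u.a Aoff x + τ (u.a Acomp x) % k) - (u.a Aoff x + τ (u.a Acomp x) % k)) +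
        (τ (u.a Acomp x) % k - τ (u.a Acomp x)) + (u.a Aoff x + τ (u.a Acomp x) - h x) by ring]
      exact dvd_add (dvd_add h5 h6) (hτ x hx)
    have h1 := hexch fun r => w.a Aaux r
    have h2 := hexch fun r => τ r % k
    simp only [F]
    rw [h1]
    have h3 : ∑ x ∈ range n, s.a Acost (x * k + o (h x)) = ∑ r ∈ range n, cost r (τ r % k) := by
      rw [← h2]
      refine sum_congr rfl fun x hx => ?_
      rw [hh' x (by simpa using hx), Int.toNat_natCast]
    rw [h3]
    refine sum_le_sum fun r hr => ?_
    have h4 := Int.emod_nonneg (τ r) hk'.ne'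
    have h5 := Int.emod_lt_of_pos (τ r) hk'
    have h6 := (hloop r (by simpa using hr)).2.2 (τ r % k).toNat (by omega)
    rwa [Int.toNat_of_nonneg h4] at h6

/-! ### The whole program -/

/-- Write a table of constants into the entries `0, …, m` of an array. -/
def tableCmd (a : Fin 16) (f : ℕ → ℤ) : ℕ → Cmd
  | 0 => .setc a 0 (f 0)
  | m + 1 => .seq (tableCmd a f m) (.setc a (m + 1) (f (m + 1)))

theorem tableCmd_ok {P : ℕ} {b : Bool} {a : Fin 16} (ha : a ≠ 0) (f : ℕ → ℤ) (m : ℕ) :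
    (tableCmd a f m).ok P b = true := by
  induction m with
  | zero => simp [tableCmd, Cmd.ok, ha]
  | succ m ih => simp [tableCmd, Cmd.ok, ha, ih]

theorem tableCmd_eval_a_of_ne {a a' : Fin 16} (h : a' ≠ a) (f : ℕ → ℤ) (m : ℕ) (s : State) :
    ((tableCmd a f m).eval s).a a' = s.a a' := by
  induction m with
  | zero => simp [tableCmd, Cmd.eval, h]
  | succ m ih => simp [tableCmd, Cmd.eval, ih, h]

theorem tableCmd_eval_a (a : Fin 16) (f : ℕ → ℤ) (m : ℕ) (s : State) :
    ∀ j ≤ m, ((tableCmd a f m).eval s).a a j = f j := by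
  induction m with
  | zero => intro j hj; obtain rfl : j = 0 := by omega
            simp [tableCmd, Cmd.eval]
  | succ m ih =>
    intro j hj
    rcases Nat.lt_or_ge m j with h | h
    · obtain rfl : j = m + 1 := by omega
      simp [tableCmd, Cmd.eval]
    · simp only [tableCmd, Cmd.eval, State.seta_a, if_true]
      rw [Function.update_of_ne (by omega), ih j h]

/-- Write down the tables that describe the target digraph. -/
def initCmd (k : ℕ) (ord adj fwd bwd : ℕ → ℤ) : Cmd :=
  .seq (tableCmd Aord ord k) (.seq (tableCmd Aadj adj (k * k))
  (.seq (tableCmd Afwd fwd ((k + 1) * (k + 1))) (.seq (tableCmd Abwd bwd ((k + 1) * (k + 1)))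
  (.seq (.assign Vn (.arr Ainp 0)) (.assign Vk (.const k))))))

/-- Compute the parameters that are loop counts for `lengthCmd`. -/
def productCmd : Cmd :=
  .seq (.assign Vnk (.sum Vz Vn (.var Vk))) (.seq (.assign Vnn (.sum Vz Vn (.var Vn)))
  (.seq (.assign Vk1 (.var Vk + 1)) (.assign Vn1 (.var Vn + 1))))

/-- Compute the parameters that are loop counts for `networkSizeCmd`. -/
def lengthCmd : Cmd :=
  .seq (.assign VN (.sum Vz Vn (.var Vk1)))
    (.assign VK (.sum Vp Vnk (.blen (1 + .var Vnn + .var Vp) +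
      .blen (1 + .var Vnn + .var Vnk + .var Vp))))

/-- Compute the remaining parameters. -/
def networkSizeCmd : Cmd :=
  .seq (.assign VNN (.sum Vz VN (.var VN))) (.assign VK2 (.var VK + .var Vnk + .var Vnk + 2))

/-- Check whether the map that was found is a homomorphism. -/
def checkCmd : Cmd :=
  .ite (.ex Vu Vn (.ex Vv Vn (.and (.arr Ainp (1 + .index Vn (.var Vu) (.var Vv)))
    (.le (.arr Aadj (.index Vk (.arr Asol (.var Vu)) (.arr Asol (.var Vv)))) 0))))
    (.assign Vok 0) (.assign Vok 1)

/-- Solve the problem, once all parameters are computed. -/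
def mainCmd (solver : Cmd) : Cmd := .seq costCmd (.seq solver checkCmd)

/-- Write the answer. -/
def outputCmd : Cmd :=
  .gen Ainp Vp Vn1 (.ite (.var Vp) (.arr Aord (.arr Asol (.var Vp - 1))) (.var Vok))

/-- The array `w` holds the input: the number `n`, the adjacency matrix `g`, the numerators and the
denominators of the costs. -/
structure IsInput (w : ℕ → ℤ) (n k : ℕ) (g : ℕ → ℕ → Prop) (num : ℕ → ℤ) (den : ℕ → ℕ) : Prop where
  n_eq : w 0 = n
  adj : ∀ u < n, ∀ v < n, (0 < w (1 + (u * n + v)) ↔ g u v)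
  num_eq : ∀ p < n * k, w (1 + n * n + p) = num p
  den_eq : ∀ p < n * k, w (1 + n * n + n * k + p) = den p
  den_pos : ∀ p < n * k, 0 < den p

/-- The parameters and the tables are computed. -/
structure Initialized (s : State) (w : ℕ → ℤ) (n k K : ℕ) (ord adj fwd bwd : ℕ → ℤ) : Prop where
  inp : s.a Ainp = w
  n_eq : s.v Vn = n
  k_eq : s.v Vk = k
  nk_eq : s.v Vnk = (n * k : ℕ)
  nn_eq : s.v Vnn = (n * n : ℕ)
  k1_eq : s.v Vk1 = (k + 1 : ℕ)
  n1_eq : s.v Vn1 = (n + 1 : ℕ)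
  N_eq : s.v VN = (n * (k + 1) : ℕ)
  NN_eq : s.v VNN = (n * (k + 1) * (n * (k + 1)) : ℕ)
  K_eq : s.v VK = K
  K2_eq : s.v VK2 = (K + n * k + n * k + 2 : ℕ)
  ord_eq : ∀ j ≤ k, s.a Aord j = ord j
  adj_eq : ∀ j ≤ k * k, s.a Aadj j = adj j
  fwd_eq : ∀ j ≤ (k + 1) * (k + 1), s.a Afwd j = fwd j
  bwd_eq : ∀ j ≤ (k + 1) * (k + 1), s.a Abwd j = bwd j

/-- The program that computes the parameters and the tables. -/
def setupProgram (k : ℕ) (ord adj fwd bwd : ℕ → ℤ) : Program :=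
  .seq ((initCmd k ord adj fwd bwd).compile 0) (.seq (productCmd.compile 0)
    (.seq (lengthCmd.compile 0) (networkSizeCmd.compile 0)))

/-- The parameters are computed in stages because the loop counts of a command must be variables
that it does not assign. Each stage computes the counts for the next one, and the protected prefix
grows from 0 to 2, 6 and 8 variables. Products are bounded sums. -/
theorem halts_setupProgram {w : ℕ → ℤ} {n k K B : ℕ} (ord adj fwd bwd : ℕ → ℤ) (hn : w 0 = n)
    (hK : ∑ p ∈ range (n * k), (Nat.size (w (1 + n * n + p)).natAbs +
      Nat.size (w (1 + n * n + n * k + p)).natAbs) = K)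
    (hB : n * (k + 1) * (n * (k + 1)) + (K + n * k + n * k + 2) + n * n + n + k ≤ B)
    (hw : ∀ j, Nat.size (w j).natAbs ≤ B) {m : Memory} {s : State} (hm : Rep m s)
    (hs : s.a Ainp = w) :
    Halts (setupProgram k ord adj fwd bwd) m
      ((initCmd k ord adj fwd bwd).bound.eval B + (productCmd.bound.eval B +
        (lengthCmd.bound.eval B + networkSizeCmd.bound.eval B)))
      (fun m' => ∃ t, Rep m' t ∧ Initialized t w n k K ord adj fwd bwd) := by
  have hN := Nat.le_mul_self (n * (k + 1))
  unfold setupProgram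
  -- The tables are written by straight-line code, so no loop count has to be protected yet.
  have ok0 : (initCmd k ord adj fwd bwd).ok 0 true = true := by
    simp [initCmd, Cmd.ok, tableCmd_ok, Exp.ok]
  refine Halts.seq (Q := fun m' => Rep m' ((initCmd k ord adj fwd bwd).eval s))
    ((Cmd.halts_compile _ ok0 0 s ⟨by simp, fun _ j => by rw [hs]; exact hw j⟩ m hm).mono
      le_rfl fun _ h => h.1) fun m₁ hm₁ => ?_
  have a1 : ((initCmd k ord adj fwd bwd).eval s).a Ainp = w := by
    simp [initCmd, tableCmd_eval_a_of_ne, hs]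
  have a2 : ((initCmd k ord adj fwd bwd).eval s).v Vn = n := by
    simp [initCmd, tableCmd_eval_a_of_ne, hs, hn]
  have a3 : ((initCmd k ord adj fwd bwd).eval s).v Vk = k := by
    simp [initCmd]
  have a4 : ∀ j ≤ k, ((initCmd k ord adj fwd bwd).eval s).a Aord j = ord j := fun j hj => by
    simp [initCmd, tableCmd_eval_a_of_ne, tableCmd_eval_a _ _ _ _ j hj]
  have a5 : ∀ j ≤ k * k, ((initCmd k ord adj fwd bwd).eval s).a Aadj j = adj j := fun j hj => by
    simp [initCmd, tableCmd_eval_a_of_ne, tableCmd_eval_a _ _ _ _ j hj]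
  have a6 : ∀ j ≤ (k + 1) * (k + 1), ((initCmd k ord adj fwd bwd).eval s).a Afwd j = fwd j :=
    fun j hj => by simp [initCmd, tableCmd_eval_a_of_ne, tableCmd_eval_a _ _ _ _ j hj]
  have a7 : ∀ j ≤ (k + 1) * (k + 1), ((initCmd k ord adj fwd bwd).eval s).a Abwd j = bwd j :=
    fun j hj => by simp [initCmd, tableCmd_eval_a_of_ne, tableCmd_eval_a _ _ _ _ j hj]
  generalize (initCmd k ord adj fwd bwd).eval s = s₁ at *
  refine Halts.seq (Q := fun m' => Rep m' (productCmd.eval s₁))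
    ((Cmd.halts_compile (P := 2) (b := true) (B := B) _ (by decide) 0 s₁
      ⟨fun x hx => ?_, fun _ j => by rw [a1]; exact hw j⟩ m₁ hm₁).mono le_rfl fun _ h => h.1) fun m₂ hm₂ => ?_
  · interval_cases x <;> simp only [a2, a3] <;> omega
  have c1 : (productCmd.eval s₁).v Vnk = (n * k : ℕ) := by simp [productCmd, a2, a3]
  have c2 : (productCmd.eval s₁).v Vnn = (n * n : ℕ) := by simp [productCmd, a2]
  have c3 : (productCmd.eval s₁).v Vk1 = (k + 1 : ℕ) := by simp [productCmd, a3]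
  have c4 : (productCmd.eval s₁).v Vn1 = (n + 1 : ℕ) := by simp [productCmd, a2]
  have c5 : (productCmd.eval s₁).v Vn = n := by simp [productCmd, a2]
  have c6 : (productCmd.eval s₁).v Vk = k := by simp [productCmd, a3]
  have c7 : (productCmd.eval s₁).a = s₁.a := by simp [productCmd]
  generalize productCmd.eval s₁ = s₂ at *
  rw [← c7] at a1 a4 a5 a6 a7
  have hk0 : n * k ≤ B := by omega
  refine Halts.seq (Q := fun m' => Rep m' (lengthCmd.eval s₂))
    ((Cmd.halts_compile (P := 6) (b := true) (B := B) _ (by decide) 0 s₂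
      ⟨fun x hx => ?_, fun _ j => by rw [a1]; exact hw j⟩ m₂ hm₂).mono le_rfl fun _ h => h.1) fun m₃ hm₃ => ?_
  · interval_cases x <;> simp only [c1, c2, c3, c4, c5, c6, Int.toNat_natCast] <;> omega
  have d1 : (lengthCmd.eval s₂).v VN = (n * (k + 1) : ℕ) := by simp [lengthCmd, c5, c3]
  have d2 : (lengthCmd.eval s₂).v VK = K := by
    rw [← hK]
    simp only [lengthCmd, Cmd.eval_seq, Cmd.eval_assign, State.setv_v, if_true, Exp.eval,
      State.setv_a, a1, c1, c2, Nat.reduceEqDiff,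
      if_false, Int.toNat_natCast]
    push_cast
    refine sum_congr rfl fun p hp => ?_
    norm_cast
  have d3 : ∀ x < 6, (lengthCmd.eval s₂).v x = s₂.v x := fun x hx =>
    Cmd.eval_v _ _ (by interval_cases x <;> decide)
  have d4 : (lengthCmd.eval s₂).a = s₂.a := by simp [lengthCmd]
  generalize lengthCmd.eval s₂ = s₃ at *
  rw [← d4] at a1 a4 a5 a6 a7
  rw [← d3 _ (by norm_num)] at c1 c2 c3 c4 c5 c6
  refine (Cmd.halts_compile (P := 8) (b := true) (B := B) _ (by decide) 0 s₃
      ⟨fun x hx => ?_, fun _ j => by rw [a1]; exact hw j⟩ m₃ hm₃).mono le_rfl fun m₄ hm₄ => ⟨_, hm₄.1, ?_⟩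
  · interval_cases x <;> simp only [c1, c2, c3, c4, c5, c6, d1, d2, Int.toNat_natCast] <;> omega
  have e1 : ∀ x < 8, (networkSizeCmd.eval s₃).v x = s₃.v x := fun x hx =>
    Cmd.eval_v _ _ (by interval_cases x <;> decide)
  have e2 : (networkSizeCmd.eval s₃).a = s₃.a := by simp [networkSizeCmd]
  rw [← e2] at a1 a4 a5 a6 a7
  have e3 : (networkSizeCmd.eval s₃).v VNN = (n * (k + 1) * (n * (k + 1)) : ℕ) := by
    simp [networkSizeCmd, d1]
  have e4 : (networkSizeCmd.eval s₃).v VK2 = (K + n * k + n * k + 2 : ℕ) := by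
    simp [networkSizeCmd, d2, c1]
  rw [← e1 _ (by norm_num)] at c1 c2 c3 c4 c5 c6 d1 d2
  exact ⟨a1, c5, c6, c1, c2, c3, c4, d1, e3, d2, e4, a4, a5, a6, a7⟩

open Classical in
/-- A relation as a table, where the pair `(i, j)` is numbered `i * m + j`. -/
noncomputable def relTable (m : ℕ) (R : ℕ → ℕ → Prop) (p : ℕ) : ℤ :=
  if R (p / m) (p % m) then 1 else 0

theorem relTable_pos_iff {m i j : ℕ} (hj : j < m) (R : ℕ → ℕ → Prop) :
    0 < relTable m R (i * m + j) ↔ R i j := by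
  have h : (i * m + j) / m = i ∧ (i * m + j) % m = j := by
    rw [mul_comm, Nat.mul_add_div (by omega), Nat.div_eq_of_lt hj, Nat.mul_add_mod,
      Nat.mod_eq_of_lt hj]
    simp
  rw [relTable, h.1, h.2]
  split_ifs with h <;> simp [h]

/-- The command `c` solves the problem for the digraph `H` on `0, …, k - 1` and an enumeration `o`
of its vertices. -/
structure IsSolver (c : Cmd) (k : ℕ) (H : ℕ → ℕ → Prop) (o : ℕ → ℕ) : Prop where
  ok : c.ok 10 true = true
  vars : ∀ x < 10, x ∉ c.vars
  inp : Ainp ∉ c.arrs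
  ord : Aord ∉ c.arrs
  adj : Aadj ∉ c.arrs
  spec : ∀ (s : State) (n K : ℕ) (g : ℕ → ℕ → Prop), Prepared s n k g o → s.v VK2 = K →
    (∀ a < k + 1, ∀ b < k + 1, (0 < s.a Afwd (a * (k + 1) + b) ↔ Forward H a b)) →
    (∀ a < k + 1, ∀ b < k + 1, (0 < s.a Abwd (a * (k + 1) + b) ↔ Backward H a b)) →
    s.v Vinf = 1 + ∑ p ∈ range (n * k), s.a Acost p → 2 * s.v Vinf ≤ 2 ^ K →
    ∃ f : ℕ → ℕ, (∀ u < n, (c.eval s).a Asol u = f u) ∧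
      Solves n k g H (fun u i => s.a Acost (u * k + o i)) f

theorem isSolver_acyclicCmd {k : ℕ} (hk : 0 < k) {H : ℕ → ℕ → Prop}
    (hH : ∀ i j i' j' x y, H i j → H i' j' → i' ≤ x → x ≤ i → j ≤ y → y ≤ j' → H x y)
    (o : ℕ → ℕ) : IsSolver acyclicCmd k H o where
  ok := by decide
  vars x hx := by interval_cases x <;> decide
  inp := by decide
  ord := by decide
  adj := by decide
  spec _ _ _ _ hs hK hf hb hi hiK := acyclicCmd_spec hk hs hK hH hf hb hi hiK

theorem isSolver_cycleCmd {k : ℕ} (hk : 0 < k) (o : ℕ → ℕ) :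
    IsSolver cycleCmd k (CycleArc k) o where
  ok := by decide
  vars x hx := by interval_cases x <;> decide
  inp := by decide
  ord := by decide
  adj := by decide
  spec _ _ _ _ hs _ _ _ _ _ := cycleCmd_spec hk hs

/-- Tests the computed map against all arcs. By `Solves` the map is a homomorphism whenever one
exists, so the flag `Vok` also answers the decision problem. -/
theorem mainCmd_spec {c : Cmd} {k : ℕ} {H : ℕ → ℕ → Prop} {o : ℕ → ℕ} (hc : IsSolver c k H o)
    (ho : ∀ i < k, o i < k) {s : State} {w : ℕ → ℤ} {n K : ℕ} {g : ℕ → ℕ → Prop} {num : ℕ → ℤ}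
    {den : ℕ → ℕ} (hw : IsInput w n k g num den)
    (hK : ∑ p ∈ range (n * k), (Nat.size (num p).natAbs + Nat.size (den p)) = K)
    (hs : Initialized s w n k K (fun i => o i) (relTable k H) (relTable (k + 1) (Forward H))
      (relTable (k + 1) (Backward H))) :
    ∃ (A : ℕ → ℤ) (D M : ℤ) (f : ℕ → ℕ), 0 < D ∧
      (∀ p < n * k, (A p - M) * den p = num p * D) ∧
      Solves n k g H (fun u i => A (u * k + o i)) f ∧
      (∀ u < n, ((mainCmd c).eval s).a Asol u = f u) ∧
      (∀ i < k, ((mainCmd c).eval s).a Aord i = o i) ∧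
      (((mainCmd c).eval s).v Vn1 = (n + 1 : ℕ)) ∧
      ((HomOn n k g H f ∧ ((mainCmd c).eval s).v Vok = 1) ∨
        (¬ HomOn n k g H f ∧ ((mainCmd c).eval s).v Vok = 0)) := by
  obtain ⟨⟨D, M, hD, hA⟩, hA0, hinf, hinfK⟩ := costCmd_spec (s := s) (E := n * k) (F := n * n)
    (K := K) (num := num) (den := den) hs.nk_eq hs.nn_eq (by rw [hs.K_eq]; rfl)
    (fun p hp => by rw [hs.inp]; exact hw.num_eq p hp)
    (fun p hp => by rw [hs.inp]; exact hw.den_eq p hp) hw.den_pos hK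
  have t1 : ∀ x < 10, (costCmd.eval s).v x = s.v x := fun x hx =>
    Cmd.eval_v _ _ (by interval_cases x <;> decide)
  have t2 : (costCmd.eval s).a Ainp = w := by rw [Cmd.eval_a _ _ (by decide), hs.inp]
  have t3 : ∀ j ≤ k, (costCmd.eval s).a Aord j = o j := by
    rw [Cmd.eval_a _ _ (by decide)]; exact hs.ord_eq
  have t4 : ∀ j ≤ k * k, (costCmd.eval s).a Aadj j = relTable k H j := by
    rw [Cmd.eval_a _ _ (by decide)]; exact hs.adj_eq
  have t5 : ∀ j ≤ (k + 1) * (k + 1),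
      (costCmd.eval s).a Afwd j = relTable (k + 1) (Forward H) j := by
    rw [Cmd.eval_a _ _ (by decide)]; exact hs.fwd_eq
  have t6 : ∀ j ≤ (k + 1) * (k + 1),
      (costCmd.eval s).a Abwd j = relTable (k + 1) (Backward H) j := by
    rw [Cmd.eval_a _ _ (by decide)]; exact hs.bwd_eq
  have hmain : (mainCmd c).eval s = checkCmd.eval (c.eval (costCmd.eval s)) := rfl
  rw [hmain]
  generalize costCmd.eval s = t at *
  have hp : Prepared t n k g o := by
    refine ⟨?_, ?_, ?_, ?_, ?_, ?_, ?_, ?_, ?_, fun i hi => t3 i hi.le, ho, hA0⟩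
    · rw [t1 _ (by norm_num), hs.n_eq]
    · rw [t1 _ (by norm_num), hs.k_eq]
    · rw [t1 _ (by norm_num), hs.nk_eq]
    · rw [t1 _ (by norm_num), hs.nn_eq]
    · rw [t1 _ (by norm_num), hs.k1_eq]
    · rw [t1 _ (by norm_num), hs.n1_eq]
    · rw [t1 _ (by norm_num), hs.N_eq]
    · rw [t1 _ (by norm_num), hs.NN_eq]
    · rw [t2]; exact hw.adj
  obtain ⟨f, hf, hsol⟩ := hc.spec t n (K + n * k + n * k + 2) g hp
    (by rw [t1 _ (by norm_num), hs.K2_eq])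
    (fun a ha b hb => by rw [t5 _ (mul_add_lt ha hb).le, relTable_pos_iff hb])
    (fun a ha b hb => by rw [t6 _ (mul_add_lt ha hb).le, relTable_pos_iff hb]) hinf hinfK
  have u1 : ∀ x < 10, (c.eval t).v x = s.v x := fun x hx => by
    rw [Cmd.eval_v _ _ (hc.vars x hx), t1 x hx]
  have u2 : (c.eval t).a Ainp = w := by rw [Cmd.eval_a _ _ hc.inp, t2]
  have u3 : ∀ j ≤ k, (c.eval t).a Aord j = o j := by rw [Cmd.eval_a _ _ hc.ord]; exact t3
  have u4 : ∀ j ≤ k * k, (c.eval t).a Aadj j = relTable k H j := by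
    rw [Cmd.eval_a _ _ hc.adj]; exact t4
  generalize c.eval t = u at *
  have un : u.v Vn = n := by rw [u1 _ (by norm_num), hs.n_eq]
  have uk : u.v Vk = k := by rw [u1 _ (by norm_num), hs.k_eq]
  refine ⟨t.a Acost, D, M, f, hD, hA, hsol, fun x hx => ?_, fun i hi => ?_, ?_, ?_⟩
  · rw [Cmd.eval_a _ _ (by decide), hf x hx]
  · rw [Cmd.eval_a _ _ (by decide), u3 i hi.le]
  · rw [Cmd.eval_v _ _ (by decide), u1 _ (by norm_num), hs.n1_eq]
  · have hex : 0 < (Exp.ex Vu Vn (.ex Vv Vn (.and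
        (.arr Ainp (1 + .index Vn (.var Vu) (.var Vv)))
        (.le (.arr Aadj (.index Vk (.arr Asol (.var Vu)) (.arr Asol (.var Vv)))) 0)))).eval u ↔
        ∃ x < n, ∃ y < n, g x y ∧ ¬ H (f x) (f y) := by
      simp only [Exp.pos_eval_ex, Exp.pos_eval_and, Exp.pos_eval_le, Exp.eval_arr, Exp.eval_add,
        Exp.eval_one, Exp.eval_zero, State.setv_v, State.setv_a, un, Int.toNat_natCast,
        Nat.reduceEqDiff, if_false]
      refine exists_congr fun x => and_congr_right fun hx => exists_congr fun y =>
        and_congr_right fun hy => and_congr ?_ ?_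
      · rw [Exp.eval_index (m := n) (i := x) (j := y) (by simp [un]) (by simp) (by simp), u2,
          ← hw.adj x hx y hy]
        norm_cast
      · have h1 := hf x hx
        have h2 := hf y hy
        rw [Exp.eval_index (m := k) (i := f x) (j := f y) (by simp [uk]) (by simp [h1])
          (by simp [h2]), Int.toNat_natCast,
          u4 _ (mul_add_lt (hsol.1 x hx) (hsol.1 y hy)).le, ← not_lt,
          relTable_pos_iff (hsol.1 y hy)]
    simp only [checkCmd, Cmd.eval_ite]
    split_ifs with h <;> rw [hex] at h
    · right
      obtain ⟨x, hx, y, hy, hg, hH⟩ := h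
      exact ⟨fun hh => hH (hh.2 x hx y hy hg), by simp⟩
    · left
      push Not at h
      exact ⟨⟨hsol.1, h⟩, by simp⟩

/-- The whole program. -/
noncomputable def solveProgram (c : Cmd) (k : ℕ) (H : ℕ → ℕ → Prop) (o : ℕ → ℕ) : Program :=
  .seq (setupProgram k (fun i => o i) (relTable k H) (relTable (k + 1) (Forward H))
      (relTable (k + 1) (Backward H)))
    (.seq ((mainCmd c).compile 0) (outputCmd.compile 0))

/-- A bound on the running time of the whole program. -/
noncomputable def solveBound (c : Cmd) (k : ℕ) (H : ℕ → ℕ → Prop) (o : ℕ → ℕ) : Polynomial ℕ :=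
  ((initCmd k (fun i => o i) (relTable k H) (relTable (k + 1) (Forward H))
      (relTable (k + 1) (Backward H))).bound + (productCmd.bound + (lengthCmd.bound +
        networkSizeCmd.bound))) + ((mainCmd c).bound + outputCmd.bound)

theorem halts_solveProgram {c : Cmd} {k : ℕ} {H : ℕ → ℕ → Prop} {o : ℕ → ℕ}
    (hc : IsSolver c k H o) (ho : ∀ i < k, o i < k) {w : ℕ → ℤ} {n K B : ℕ} {g : ℕ → ℕ → Prop}
    {num : ℕ → ℤ} {den : ℕ → ℕ} (hw : IsInput w n k g num den)
    (hK : ∑ p ∈ range (n * k), (Nat.size (num p).natAbs + Nat.size (den p)) = K)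
    (hB : n * (k + 1) * (n * (k + 1)) + (K + n * k + n * k + 2) + n * n + n + k ≤ B)
    (hwB : ∀ j, Nat.size (w j).natAbs ≤ B) {m : Memory} {s : State} (hm : Rep m s)
    (hs : s.a Ainp = w) :
    Halts (solveProgram c k H o) m ((solveBound c k H o).eval B) (fun m' =>
      ∃ (A : ℕ → ℤ) (D M : ℤ) (f : ℕ → ℕ), 0 < D ∧
        (∀ p < n * k, (A p - M) * den p = num p * D) ∧
        Solves n k g H (fun u i => A (u * k + o i)) f ∧
        (∀ u < n, m' (1 + u) = o (f u)) ∧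
        ((HomOn n k g H f ∧ m' 0 = 1) ∨ (¬ HomOn n k g H f ∧ m' 0 = 0))) := by
  have hN := Nat.le_mul_self (n * (k + 1))
  rw [solveBound, Polynomial.eval_add, Polynomial.eval_add, Polynomial.eval_add,
    Polynomial.eval_add, Polynomial.eval_add]
  refine Halts.seq (halts_setupProgram _ _ _ _ hw.n_eq ?_ hB hwB hm hs) ?_
  · rw [← hK]
    refine sum_congr rfl fun p hp => ?_
    have hp := mem_range.1 hp
    rw [hw.num_eq p hp, hw.den_eq p hp, Int.natAbs_natCast]
  rintro m₁ ⟨t, hm₁, ht⟩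
  have okm : (mainCmd c).ok 10 true = true := by
    have h1 : costCmd.ok 10 true = true := by decide
    have h2 : checkCmd.ok 10 true = true := by decide
    simp [mainCmd, Cmd.ok, h1, h2, hc.ok]
  have hbd : t.Bounded 10 true B := by
    refine ⟨fun x hx => ?_, fun _ j => by rw [ht.inp]; exact hwB j⟩
    interval_cases x <;> simp only [ht.n_eq, ht.k_eq, ht.nk_eq, ht.nn_eq, ht.k1_eq, ht.n1_eq,
      ht.N_eq, ht.NN_eq, ht.K_eq, ht.K2_eq, Int.toNat_natCast] <;> omega
  refine Halts.seq (Q := fun m' => Rep m' ((mainCmd c).eval t))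
    ((Cmd.halts_compile _ okm 0 t hbd m₁ hm₁).mono le_rfl fun _ h => h.1) fun m₂ hm₂ => ?_
  obtain ⟨A, D, M, f, hD, hA, hsol, hf, hord, hn1, hok⟩ := mainCmd_spec hc ho hw hK ht
  have hbd' := Cmd.eval_bounded _ okm t hbd
  generalize (mainCmd c).eval t = u at *
  -- The output overwrites the input array, so bit lengths of its entries may no longer be taken,
  -- and `b` is `false`.
  refine (Cmd.halts_compile (P := 10) (b := false) (B := B) _ (by decide) 0 u
    ⟨hbd'.1, by simp⟩ m₂ hm₂).mono le_rfl fun m' hm' => ⟨A, D, M, f, hD, hA, hsol,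
      fun x hx => ?_, ?_⟩
  · have h := hm'.1.2 Ainp (1 + x)
    have hx' : f x < k := hsol.1 x hx
    rw [show cell Ainp (1 + x) = 1 + (x : ℤ) by simp [cell]] at h
    rw [h]
    simp only [outputCmd, Cmd.eval_gen, State.seta_a, if_true, hn1, Int.toNat_natCast]
    -- Entry 0 is reserved for the flag; the image of `x` stands at `1 + x`.
    rw [if_pos (by omega), Exp.eval_ite, if_pos (by simp; omega)]
    simp [hf x hx, hord _ hx']
  · have h := hm'.1.2 Ainp 0
    rw [show cell Ainp 0 = 0 by simp [cell]] at h
    have h' : m' 0 = u.v Vok := by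
      rw [h]
      simp [outputCmd, hn1]
    rw [h']
    exact hok

/-! ### The encoding of the input -/

theorem rep_initMemory (l : List ℤ) :
    Rep (initMemory l) ⟨fun _ => 0, fun a j => if a = 0 then l.getD j 0 else 0⟩ := by
  constructor
  · intro x
    rw [show var x = Int.negSucc (32 * x + 16) by rw [Int.negSucc_eq]; unfold var; push_cast; ring]
    rfl
  · intro a j
    unfold cell
    split_ifs with h
    · simp [h, initMemory]
    · rw [show -(32 * (j : ℤ) + ((a : ℕ) + 1)) = Int.negSucc (32 * j + a) by
        rw [Int.negSucc_eq]; push_cast; ring]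
      simp [h, initMemory]

theorem size_append (l l' : List ℤ) : size (l ++ l') = size l + size l' := by
  simp [size]

theorem size_ofFn {N : ℕ} (f : Fin N → ℤ) :
    size (List.ofFn f) = ∑ i, (Nat.size (f i).natAbs + 1) := by
  simp [size, List.map_ofFn, List.sum_ofFn]

theorem size_getD_le (l : List ℤ) (j : ℕ) : Nat.size (l.getD j 0).natAbs ≤ size l := by
  rcases lt_or_ge j l.length with h | h
  · rw [List.getD_eq_getElem _ _ h]
    have := List.single_le_sum (l := l.map fun a => Nat.size a.natAbs + 1) (by simp)
      (Nat.size (l[j]).natAbs + 1) (List.mem_map.2 ⟨l[j], List.getElem_mem h, rfl⟩)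
    unfold size
    omega
  · rw [List.getD_eq_default _ _ h]
    simp

theorem getD_ofFn {N : ℕ} (f : Fin N → ℤ) (i : Fin N) : (List.ofFn f).getD i 0 = f i := by
  rw [List.getD_eq_getElem _ _ (by simp)]
  simp

section blocks

variable {N₁ N₂ N₃ : ℕ} (x : ℤ) (f₁ : Fin N₁ → ℤ) (f₂ : Fin N₂ → ℤ) (f₃ : Fin N₃ → ℤ)

theorem getD_blocks_zero :
    ([x] ++ List.ofFn f₁ ++ List.ofFn f₂ ++ List.ofFn f₃).getD 0 0 = x := by
  simp

theorem getD_blocks_one (i : Fin N₁) :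
    ([x] ++ List.ofFn f₁ ++ List.ofFn f₂ ++ List.ofFn f₃).getD (1 + i) 0 = f₁ i := by
  have := i.isLt
  rw [List.append_assoc, List.getD_append _ _ _ _ (by simp; omega),
    List.getD_append_right _ _ _ _ (by simp)]
  simp

theorem getD_blocks_two (i : Fin N₂) :
    ([x] ++ List.ofFn f₁ ++ List.ofFn f₂ ++ List.ofFn f₃).getD (1 + N₁ + i) 0 = f₂ i := by
  have := i.isLt
  rw [List.getD_append _ _ _ _ (by simp; omega),
    List.getD_append_right _ _ _ _ (by simp; omega)]
  rw [show 1 + N₁ + (i : ℕ) - ([x] ++ List.ofFn f₁).length = i by simp; omega]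
  exact getD_ofFn f₂ i

theorem getD_blocks_three (i : Fin N₃) :
    ([x] ++ List.ofFn f₁ ++ List.ofFn f₂ ++ List.ofFn f₃).getD (1 + N₁ + N₂ + i) 0 = f₃ i := by
  rw [List.getD_append_right _ _ _ _ (by simp; omega)]
  rw [show 1 + N₁ + N₂ + (i : ℕ) - ([x] ++ List.ofFn f₁ ++ List.ofFn f₂).length = i by
    simp; omega]
  exact getD_ofFn f₃ i

end blocks

end RAM

open RAM

variable {V : Type*} {k : ℕ}

/-- The arcs of the input digraph, as a relation between natural numbers. -/
def Instance.arc (I : Instance V) (u v : ℕ) : Prop :=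
  ∃ (hu : u < I.n) (hv : v < I.n), I.G.Adj ⟨u, hu⟩ ⟨v, hv⟩

/-- The final estimate makes the time polynomial: `n` is written in binary, but the adjacency matrix
has `n * n` entries and each entry counts at least one symbol. -/
theorem Instance.exists_isInput (I : Instance V) (e : V ≃ Fin k) :
    ∃ (num : ℕ → ℤ) (den : ℕ → ℕ),
      IsInput (fun j => (I.encode e).getD j 0) I.n k I.arc num den ∧
      (∀ (u : Fin I.n) (v : V), num (u * k + e v) = (I.cost u v).num ∧
        den (u * k + e v) = (I.cost u v).den) ∧
      1 + I.n * I.n + (∑ p ∈ range (I.n * k), (Nat.size (num p).natAbs + Nat.size (den p))) +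
        I.n * k + I.n * k ≤ size (I.encode e) := by
  have hdiv : ∀ (u : Fin I.n) (m : ℕ) (i : Fin m) (h : (u : ℕ) * m + i < I.n * m),
      Fin.divNat (⟨u * m + i, h⟩ : Fin (I.n * m)) = u ∧
      Fin.modNat (⟨u * m + i, h⟩ : Fin (I.n * m)) = i := by
    intro u m i h
    have hm : 0 < m := by have := i.isLt; omega
    constructor <;> ext
    · rw [Fin.coe_divNat]
      show (u * m + i : ℕ) / m = u
      rw [mul_comm, Nat.mul_add_div hm, Nat.div_eq_of_lt i.isLt, add_zero]
    · rw [Fin.coe_modNat]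
      show (u * m + i : ℕ) % m = i
      rw [mul_comm, Nat.mul_add_mod, Nat.mod_eq_of_lt i.isLt]
  let num : ℕ → ℤ := fun p =>
    if h : p < I.n * k then
      (I.cost (⟨p, h⟩ : Fin (I.n * k)).divNat (e.symm (⟨p, h⟩ : Fin (I.n * k)).modNat)).num else 0
  let den : ℕ → ℕ := fun p =>
    if h : p < I.n * k then
      (I.cost (⟨p, h⟩ : Fin (I.n * k)).divNat (e.symm (⟨p, h⟩ : Fin (I.n * k)).modNat)).den else 0
  refine ⟨num, den, ⟨?_, ?_, ?_, ?_, ?_⟩, fun u v => ?_, ?_⟩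
  · exact getD_blocks_zero _ _ _ _
  · intro u hu v hv
    have h := mul_add_lt hu hv
    have h1 := hdiv ⟨u, hu⟩ I.n ⟨v, hv⟩ h
    simp only [Instance.encode]
    rw [getD_blocks_one _ _ _ _ ⟨u * I.n + v, h⟩]
    dsimp only at h1
    rw [h1.1, h1.2]
    unfold Instance.arc
    split_ifs with h2
    · exact ⟨fun _ => ⟨hu, hv, h2⟩, fun _ => by norm_num⟩
    · exact ⟨fun h => by norm_num at h, fun ⟨_, _, h⟩ => absurd h h2⟩
  · intro p hp
    simp only [Instance.encode, num, dif_pos hp]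
    exact getD_blocks_two _ _ _ _ ⟨p, hp⟩
  · intro p hp
    simp only [Instance.encode, den, dif_pos hp]
    exact getD_blocks_three _ _ _ _ ⟨p, hp⟩
  · intro p hp
    simp only [den, dif_pos hp]
    exact Rat.den_pos _
  · have h := mul_add_lt u.isLt (e v).isLt
    have h1 := hdiv u k (e v) h
    simp only [num, den, dif_pos h, h1.1, h1.2, Equiv.symm_apply_apply, and_self]
  · unfold Instance.encode
    rw [size_append, size_append, size_append, size_ofFn, size_ofFn, size_ofFn, sum_range,
      sum_add_distrib, sum_add_distrib, sum_add_distrib, sum_add_distrib]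
    have h1 : 1 ≤ size [(I.n : ℤ)] := by simp [size]
    simp only [num, den, Fin.is_lt, dif_pos, Fin.eta, Int.natAbs_natCast, sum_const, card_univ,
      Fintype.card_fin, smul_eq_mul, mul_one]
    omega

/-! ### From digraphs on natural numbers to digraphs -/

/-- Two numberings occur: `σ` suits the solver, `e` is prescribed for input and output. The map `o`
translates from the first to the second. -/
theorem polyTimeSolvable_of_isSolver [Fintype V] {H : Digraph V} {H' : ℕ → ℕ → Prop}
    (σ : V ≃ Fin (Fintype.card V)) (hσ : ∀ a b, H' (σ a) (σ b) ↔ H.Adj a b) {c : Cmd}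
    (hc : ∀ o, IsSolver c (Fintype.card V) H' o) : PolyTimeSolvable H := by
  intro e
  generalize hk : Fintype.card V = k at *
  let o : ℕ → ℕ := fun i => if h : i < k then e (σ.symm ⟨i, h⟩) else 0
  have ho : ∀ i < k, o i < k := fun i hi => by
    simp only [o, dif_pos hi]
    exact (e _).isLt
  have hoσ : ∀ v, o (σ v) = e v := fun v => by simp [o]
  -- The network has `n * (k + 1)` nodes, so the square of this number gives the factor `(k + 1) *
  -- (k + 1)`. The other parameters are covered by 5 times the input size and the constant `k + 2`.
  refine ⟨solveProgram c k H' o, (solveBound c k H' o).comp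
    (Polynomial.C ((k + 1) * (k + 1) + 5) * Polynomial.X + Polynomial.C (k + 2)), fun I => ?_⟩
  obtain ⟨num, den, hI, hcost, hS⟩ := I.exists_isInput e
  generalize hK : ∑ p ∈ range (I.n * k), (Nat.size (num p).natAbs + Nat.size (den p)) = K at hS
  have hn := Nat.le_mul_self I.n
  have h1 : I.n * (k + 1) * (I.n * (k + 1)) ≤ (k + 1) * (k + 1) * size (I.encode e) := by
    calc _ = (k + 1) * (k + 1) * (I.n * I.n) := by ring
      _ ≤ _ := Nat.mul_le_mul_left _ (by omega)
  obtain ⟨t, m, hrun, ht, A, D, M, f, hD, hA, hsol, hout, hans⟩ := halts_solveProgram (hc o) ho hI hK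
    (B := ((k + 1) * (k + 1) + 5) * size (I.encode e) + (k + 2)) (by rw [add_mul]; omega)
    (fun j => (size_getD_le (I.encode e) j).trans (by rw [add_mul]; omega))
    (rep_initMemory (I.encode e)) rfl
  refine ⟨t, m, hrun, by simpa using ht, ?_⟩
  let F : Fin I.n → V := fun u => σ.symm ⟨f u, hsol.1 u u.isLt⟩
  have hF : ∀ u : Fin I.n, f u = σ (F u) := fun u => by simp [F]
  -- Integral cost is `D` times the true cost plus `n * M`, and `D` is positive, so both have the
  -- same minimizers.
  have hlift : ∀ (h : ℕ → ℕ) (h' : Fin I.n → V), (∀ u : Fin I.n, h u = σ (h' u)) →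
      (HomOn I.n k I.arc H' h ↔ IsHom I.G H h') ∧
      ((∑ u ∈ range I.n, A (u * k + o (h u)) : ℤ) : ℚ) = D * I.totalCost h' + I.n * M := by
    intro h h' hh
    refine ⟨⟨fun hom u v huv => ?_, fun hom => ⟨fun u hu => ?_, ?_⟩⟩, ?_⟩
    · rw [← hσ, ← hh, ← hh]
      exact hom.2 u u.isLt v v.isLt ⟨u.isLt, v.isLt, huv⟩
    · rw [hh ⟨u, hu⟩]
      exact (σ _).isLt
    · rintro u hu v hv ⟨_, _, huv⟩
      rw [hh ⟨u, hu⟩, hh ⟨v, hv⟩, hσ]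
      exact hom _ _ huv
    · rw [sum_range, Instance.totalCost, mul_sum]
      push_cast
      rw [show (I.n : ℚ) * M = ∑ _u : Fin I.n, (M : ℚ) by simp, ← sum_add_distrib]
      refine sum_congr rfl fun u _ => ?_
      rw [hh u, hoσ]
      have h3 := hA _ (mul_add_lt u.isLt (e (h' u)).isLt)
      rw [(hcost u (h' u)).1, (hcost u (h' u)).2] at h3
      have h4 : ((A (u * k + e (h' u)) : ℚ) - M) * (I.cost u (h' u)).den =
        (I.cost u (h' u)).num * D := by exact_mod_cast h3
      have h5 : ((I.cost u (h' u)).den : ℚ) ≠ 0 := by exact_mod_cast (I.cost u (h' u)).den_nz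
      have h6 := Rat.mul_den_eq_num (I.cost u (h' u))
      rw [← h6] at h4
      have h7 : (A (u * k + e (h' u)) : ℚ) - M = D * I.cost u (h' u) :=
        mul_right_cancel₀ h5 (by rw [h4]; ring)
      linarith
  have hext : ∀ h' : Fin I.n → V, ∃ h : ℕ → ℕ, ∀ u : Fin I.n, h u = σ (h' u) := fun h' =>
    ⟨fun u => if hu : u < I.n then σ (h' ⟨u, hu⟩) else 0, fun u => by simp⟩
  rcases hans with ⟨hom, h0⟩ | ⟨hom, h0⟩
  · right
    refine ⟨h0, F, ⟨(hlift f F hF).1.1 hom, fun h' hh' => ?_⟩, fun u => ?_⟩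
    · obtain ⟨h, hh⟩ := hext h'
      have h3 := (hsol.2 h ((hlift h h' hh).1.2 hh')).2
      have h4 : (((∑ u ∈ range I.n, A (u * k + o (f u)) : ℤ)) : ℚ) ≤
        ((∑ u ∈ range I.n, A (u * k + o (h u)) : ℤ) : ℚ) := by exact_mod_cast h3
      rw [(hlift f F hF).2, (hlift h h' hh).2] at h4
      have hD' : (0 : ℚ) < D := by exact_mod_cast hD
      exact le_of_mul_le_mul_left (by linarith) hD'
    · rw [hout u u.isLt, hF, hoσ]
  · left
    refine ⟨h0, fun ⟨h', hh'⟩ => hom ?_⟩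
    obtain ⟨h, hh⟩ := hext h'
    exact (hsol.2 h ((hlift h h' hh).1.2 hh')).1

end MinHOM

/-! ### The acyclic case and the directed cycle -/

namespace MinHOM

open Finset RAM

theorem polyTimeSolvable_of_acyclic {V : Type*} [Fintype V] {H : Digraph V} (hc : Connected H)
    (hl : LocallySemicomplete H) (ha : Acyclic H) : PolyTimeSolvable H := by
  obtain ⟨σ, hσ⟩ := exists_ordering hc hl ha
  have hk : 0 < Fintype.card V := by
    have : Nonempty V := SimpleGraph.Connected.nonempty hc
    exact Fintype.card_pos
  refine polyTimeSolvable_of_isSolver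
    (H' := fun i j => ∃ a b, (σ a : ℕ) = i ∧ (σ b : ℕ) = j ∧ H.Adj a b) σ
    (fun a b => ⟨?_, fun h => ⟨a, b, rfl, rfl, h⟩⟩) fun o => isSolver_acyclicCmd hk ?_ o
  · rintro ⟨a', b', ha, hb, h⟩
    rwa [σ.injective (Fin.ext ha), σ.injective (Fin.ext hb)] at h
  · rintro _ _ _ _ x y ⟨a, b, rfl, rfl, h⟩ ⟨a', b', rfl, rfl, h'⟩ hx hx' hy hy'
    -- The bounds `x ≤ σ a` and `y ≤ σ b'` show that both numbers belong to vertices, so the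
    -- interval property carries over to natural numbers.
    obtain ⟨u, hu⟩ := σ.surjective ⟨x, hx'.trans_lt (σ a).isLt⟩
    obtain ⟨v, hv⟩ := σ.surjective ⟨y, hy'.trans_lt (σ b').isLt⟩
    have hu' : (σ u : ℕ) = x := by rw [hu]
    have hv' : (σ v : ℕ) = y := by rw [hv]
    subst hu' hv'
    exact ⟨u, v, rfl, rfl, hσ _ _ _ _ _ _ h h' hx hx' hy hy'⟩

theorem polyTimeSolvable_of_isDirectedCycle {V : Type*} [Fintype V] {H : Digraph V}
    (hH : IsDirectedCycle H) : PolyTimeSolvable H := by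
  obtain ⟨k, hk, ⟨r⟩⟩ := hH
  have : NeZero k := ⟨by omega⟩
  have hcard : Fintype.card V = k := (Fintype.card_congr r.toEquiv).trans (ZMod.card k)
  have hinj : Function.Injective fun a : V =>
      (⟨(r a).val, by rw [hcard]; exact ZMod.val_lt _⟩ : Fin (Fintype.card V)) := fun a b h =>
    r.injective (ZMod.val_injective k (Fin.ext_iff.1 h))
  let σ : V ≃ Fin (Fintype.card V) := Equiv.ofBijective _
    ((Fintype.bijective_iff_injective_and_card _).2 ⟨hinj, (Fintype.card_fin _).symm⟩)
  refine polyTimeSolvable_of_isSolver (H' := CycleArc (Fintype.card V)) σ (fun a b => ?_)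
    fun o => isSolver_cycleCmd (by omega) o
  have h1 : ∀ v, (σ v : ℕ) = (r v).val := fun v => rfl
  -- Divisibility of the difference by `k` is equality in `ZMod k`, which is the arc relation of the
  -- cycle.
  rw [CycleArc, h1, h1, hcard, ← ZMod.intCast_eq_intCast_iff_dvd_sub, ← r.map_rel_iff]
  simp [directedCycle, ZMod.val_lt]

end MinHOM

theorem theorem3p2 {V : Type*} [Fintype V] (H : Digraph V)
    (hloopless : MinHOM.Loopless H)
    (hconn : MinHOM.Connected H)
    (hlsc : MinHOM.LocallySemicomplete H)
    (hH : MinHOM.Acyclic H ∨ MinHOM.IsDirectedCycle H) :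
    MinHOM.PolyTimeSolvable H := by
  rcases hH with h | h
  · exact MinHOM.polyTimeSolvable_of_acyclic hconn hlsc h
  · exact MinHOM.polyTimeSolvable_of_isDirectedCycle h
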